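/- Let $F$ be a field of characteristic different from $2$ and $V$ a finite-dimensional $F$-vector space with a nondegenerate symmetric bilinear form $\Phi$. Let $W,W'$ be totally isotropic subspaces of $V$ whose sum is direct and nondegenerate, and put $X=(W+W')^\perp$, so $V=W\oplus X\oplus W'$. Put $k=\dim W$ and assume that $k$ is odd and $k\le \dim X$. Let $H=\mathrm{Isom}(X)$ (extended by the identity on $W+W'$), let $M$ be the group of isometries of $V$ preserving $W$ and $W'$, and let $N$ be the unipotent radical of the stabilizer of $W$ in $\mathrm{Isom}(V)$. Its elements are the isometries $n(\xi,\eta)$ given, for linear maps $\xi:X\to W$ and $\eta:W'\to W$ with $\eta+\eta^*+\xi\xi^*=0$, by $n|_W=1$, $n|_X=1+\xi$, $n|_{W'}=1-\xi^*+\eta$; here $\xi^*:W'\to X$ and $\eta^*:W'\to W$ are the adjoints, $\Phi(\xi^*w',x)=\Phi(w',\xi x)$ and $\Phi(\eta^*w_1',w_2')=\Phi(w_1',\eta w_2')$. Let $N'\subseteq N$ be the set of $n(\xi,\eta)$ with $\eta$ invertible, and for such $n$ put $\mathrm{Norm}(n)=1+\xi^*\eta^{-1}\xi\in H$. Write $\mathrm{Int}(g)$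 for conjugation by $g$. For a nondegenerate $k$-dimensional subspace $Y\subseteq X$ let $H_Y$ be the group of $h\in H$ that are the identity on $Y^\perp$, and let $\epsilon_Y=P_{Y^\perp}-P_Y$, i.e. $-1$ on $Y$ and $1$ on $Y^\perp$. Choose an isomorphism $\xi_Y:Y\to W$, extended to $X$ by $0$ on $Y^\perp$. For $h\in H_Y$ with $(h-1)|_Y$ invertible let $$n_Y(h)=n\bigl(\xi_Y,\ (\xi_Y(h-1)\xi_Y^+)^{-1}\xi_Y\xi_Y^*\bigr),\qquad \xi_Y^+=\xi_Y^*(\xi_Y\xi_Y^*)^{-1}.$$ For a maximal torus $T$ of $H_Y$ let $T_{\rm reg}$ be the set of regular $\gamma\in T$ (the identity component of the centralizer of $\gamma$ in $H_Y$ is $T$) such that $(\epsilon_Y\gamma-1)|_Y$ is invertible. Let $N_{Y,T}$ be the set of $n\in N'$ such that $\mathrm{Norm}(n)$ is $H_Y$-conjugate to an element of $\epsilon_YT_{\rm reg}$, and $N^{Y,T}=\mathrm{Int}(H)(N_{Y,T})$. Bold letters denote the corresponding objects over the algebraic closure $\overline F$. There exist a nondegenerate $k$-dimensional subspace $\mathbf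 Y_0$ of $\mathbf X$ and a maximal torus $\mathbf T_0$ of $\mathbf H_{\mathbf Y_0}$. For every such pair put $\mathbf H^{\mathbf T_0}=\mathrm{Int}(\mathbf H)(\epsilon_{\mathbf Y_0}\mathbf T_{0,\rm reg})$, let $\mathbf N_{\rm reg}=\{n\in\mathbf N' : \mathrm{Norm}(n)\in\mathbf H^{\mathbf T_0}\}$, and let $N_{\rm reg}$ be the set of $F$-points of $\mathbf N_{\rm reg}$. Then: 1. $\mathbf N_{\rm reg}$ is nonempty and Zariski open in $\mathbf N$. 2. $N_{\rm reg}=\bigcup_{Y,T}N^{Y,T}$. 3. $N_{\rm reg}=\bigsqcup_{Y,T}\{\mathrm{Int}(m)\,n_Y(\epsilon_Y\gamma) : m\in M,\ \gamma\in T_{\rm reg}\}$, a disjoint union. In 2 and 3, $Y$ runs over any set of representatives of the $H$-orbits of nondegenerate $k$-dimensional subspaces of $X$ and, for each $Y$, $T$ runs over any set of representatives of the $H_Y$-conjugacy classes of maximal tori of $H_Y$ defined over $F$; $M$, $H$, $H_Y$ and $T_{\rm reg}$ stand for groups and sets of $F$-points, the regularity and the maximality of tori being understood over $\overline F$; the isomorphisms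 $\xi_Y$ are arbitrary. -/

import Mathlib

open scoped TensorProduct Topology

namespace OddNorm

noncomputable section

/-! ### Linear algebra -/

section LinearAlgebra

variable {K : Type*} [Field K]

open Classical in
/-- The projection onto `A` along `B` (for complementary `A`, `B`; zero otherwise). -/
def proj {V : Type*} [AddCommGroup V] [Module K V] (A B : Submodule K V) : V →ₗ[K] A :=
  if h : IsCompl A B then A.projectionOnto B h else 0

open Classical in
/-- The inverse of a bijective linear map (zero if the map is not bijective). -/
def linInv {A B : Type*} [AddCommGroup A] [Module K A] [AddCommGroup B] [Module K B]
    (f : A →ₗ[K] B) : B →ₗ[K] A :=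
  if h : Function.Bijective f then ((LinearEquiv.ofBijective f h).symm : B →ₗ[K] A) else 0

end LinearAlgebra

/-! ### Zariski topology and tori -/

section Zariski

variable (K : Type*) [Field K]

/-- The polynomial functions on a finite-dimensional vector space. -/
def polyFun (E : Type*) [AddCommGroup E] [Module K E] : Subalgebra K (E → K) :=
  Algebra.adjoin K {f | ∃ φ : Module.Dual K E, f = fun v => φ v}

/-- The Zariski topology on a finite-dimensional vector space, generated by the principal open
sets `f ≠ 0`. -/
@[reducible] def zariski (E : Type*) [AddCommGroup E] [Module K E] : TopologicalSpace E :=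
  TopologicalSpace.generateFrom {U | ∃ f ∈ polyFun K E, U = {v | f v ≠ 0}}

/-- The Zariski topology on `GL(V)`, an open subvariety of `End(V)`. -/
@[reducible] def zariskiGL (V : Type*) [AddCommGroup V] [Module K V] : TopologicalSpace (V ≃ₗ[K] V) :=
  TopologicalSpace.induced (fun g => (g : Module.End K V)) (zariski K (Module.End K V))

variable {K} {V : Type*} [AddCommGroup V] [Module K V]

/-- Tori in `GL(V)`, for `K` algebraically closed: the Zariski closed, connected, diagonalizable
subgroups. -/
def IsTorus (T : Subgroup (V ≃ₗ[K] V)) : Prop :=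
  IsClosed[zariskiGL K V] (T : Set (V ≃ₗ[K] V)) ∧
  @IsConnected _ (zariskiGL K V) (T : Set (V ≃ₗ[K] V)) ∧
  ∃ b : Module.Basis (Fin (Module.finrank K V)) K V, ∀ t ∈ T, ∀ i, ∃ c : K, t (b i) = c • b i

/-- The maximal tori of a subgroup `G` of `GL(V)`, for `K` algebraically closed. -/
def IsMaximalTorus (G T : Subgroup (V ≃ₗ[K] V)) : Prop :=
  Maximal (fun S : Subgroup (V ≃ₗ[K] V) => IsTorus S ∧ S ≤ G) T

/-- The element `γ` of the maximal torus `T` of `G` is regular: the identity component of its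
centralizer in `G` is `T`. -/
def IsRegularIn (G T : Subgroup (V ≃ₗ[K] V)) (γ : V ≃ₗ[K] V) : Prop :=
  @connectedComponentIn _ (zariskiGL K V) {g | g ∈ G ∧ g * γ = γ * g} 1 =
    (T : Set (V ≃ₗ[K] V))

end Zariski

section Rational

variable (F K : Type*) [Field F] [Field K] [Algebra F K]
variable (V : Type*) [AddCommGroup V] [Module F V]

/-- The polynomial functions with coefficients in `F` on `End(K ⊗ V)`: they are generated by the
matrix coefficients of `F`-rational vectors and functionals. -/
def ratPolyFun : Subalgebra F (Module.End K (K ⊗[F] V) → K) :=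
  Algebra.adjoin F {f | ∃ (φ : Module.Dual F V) (v : V),
    f = fun a => Module.Dual.baseChange K φ (a (1 ⊗ₜ[F] v))}

variable {F K V}

/-- A closed subgroup `T` of `GL(K ⊗ V)` (closed in `End(K ⊗ V)`) is defined over `F`: its vanishing
ideal is generated by polynomial functions with coefficients in `F`. (As every polynomial function
is a `K`-combination of functions with coefficients in `F`, the ideal generated by the
`F`-polynomial functions vanishing on `T` is their `K`-span.) -/
def IsDefinedOver (T : Subgroup ((K ⊗[F] V) ≃ₗ[K] (K ⊗[F] V))) : Prop :=
  ∀ f ∈ polyFun K (Module.End K (K ⊗[F] V)), (∀ t ∈ T, f (t : Module.End K (K ⊗[F] V)) = 0) →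
    f ∈ Submodule.span K {g : Module.End K (K ⊗[F] V) → K |
      g ∈ ratPolyFun F K V ∧ ∀ t ∈ T, g (t : Module.End K (K ⊗[F] V)) = 0}

/-- `V` with scalars extended to the algebraic closure. -/
abbrev Vbar (F V : Type*) [Field F] [AddCommGroup V] [Module F V] : Type _ :=
  AlgebraicClosure F ⊗[F] V

/-- `GL(V)` over the algebraic closure. -/
abbrev GLbar (F V : Type*) [Field F] [AddCommGroup V] [Module F V] : Type _ :=
  Vbar F V ≃ₗ[AlgebraicClosure F] Vbar F V

/-- The inclusion of `GL(V)` in its points over the algebraic closure. -/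
def toBar (g : V ≃ₗ[F] V) : GLbar F V := LinearEquiv.baseChange F (AlgebraicClosure F) V V g

end Rational

/-- `S` is a set of representatives, consisting of elements satisfying `P`, of the classes of the
relation `r` on the elements satisfying `P`. -/
def IsRepresentatives {α : Type*} (P : α → Prop) (r : α → α → Prop) (S : Set α) : Prop :=
  (∀ a ∈ S, P a) ∧ ∀ a, P a → ∃! b, b ∈ S ∧ r b a

/-! ### The parabolic subgroup, its Levi subgroup and its unipotent radical -/

/-- A bilinear form `Φ` on `V` and two subspaces `W`, `W'`. -/
structure Datum (K V : Type*) [Field K] [AddCommGroup V] [Module K V] where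
  /-- the form -/
  Φ : LinearMap.BilinForm K V
  /-- the isotropic subspace whose stabilizer is the parabolic subgroup -/
  W : Submodule K V
  /-- the opposite isotropic subspace -/
  W' : Submodule K V

namespace Datum

section Field

variable {K V : Type*} [Field K] [AddCommGroup V] [Module K V] (D : Datum K V)

/-- `Φ` is symmetric and nondegenerate, `W` and `W'` are totally isotropic, and their sum is direct
and nondegenerate. -/
structure IsOrthogonal : Prop where
  symm : D.Φ.IsSymm
  nondegenerate : D.Φ.Nondegenerate
  isotropic : ∀ v ∈ D.W, ∀ w ∈ D.W, D.Φ v w = 0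
  isotropic' : ∀ v ∈ D.W', ∀ w ∈ D.W', D.Φ v w = 0
  disjoint : Disjoint D.W D.W'
  nondegenerate_sup : (D.Φ.restrict (D.W ⊔ D.W')).Nondegenerate

/-- `X = (W + W')^⊥`. -/
def X : Submodule K V := D.Φ.orthogonal (D.W ⊔ D.W')

/-- `G¹ = Isom(V)`. -/
def isom : Subgroup (V ≃ₗ[K] V) where
  carrier := {g | ∀ v w, D.Φ (g v) (g w) = D.Φ v w}
  mul_mem' := by
    intro a b ha hb v w
    rw [LinearEquiv.mul_apply, LinearEquiv.mul_apply, ha, hb]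
  one_mem' := by
    intro v w
    rfl
  inv_mem' := by
    intro a ha v w
    have h := ha (a⁻¹ v) (a⁻¹ w)
    have e : ∀ u, a (a⁻¹ u) = u := fun u => a.apply_symm_apply u
    rw [e, e] at h
    exact h.symm

/-- The subgroup of isometries of `V` that fix the subspace `A` pointwise. -/
def fixing (A : Submodule K V) : Subgroup (V ≃ₗ[K] V) where
  carrier := {g | g ∈ D.isom ∧ ∀ v ∈ A, g v = v}
  mul_mem' := by
    rintro a b ⟨ha, ha'⟩ ⟨hb, hb'⟩
    refine ⟨mul_mem ha hb, fun v hv => ?_⟩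
    rw [LinearEquiv.mul_apply, hb' v hv, ha' v hv]
  one_mem' := ⟨one_mem _, fun v _ => rfl⟩
  inv_mem' := by
    rintro a ⟨ha, ha'⟩
    refine ⟨inv_mem ha, fun v hv => ?_⟩
    have h := a.symm_apply_apply v
    rw [ha' v hv] at h
    exact h

/-- `H = Isom(X)`, as a subgroup of `Isom(V)`: the isometries of `X` extended by the identity of
`W + W'`. -/
def H : Subgroup (V ≃ₗ[K] V) := D.fixing (D.W ⊔ D.W')

/-- The Levi subgroup `M`: the isometries of `V` that preserve `W` and `W'`. -/
def M : Subgroup (V ≃ₗ[K] V) where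
  carrier := {g | g ∈ D.isom ∧ D.W.map (g : V →ₗ[K] V) = D.W ∧
    D.W'.map (g : V →ₗ[K] V) = D.W'}
  mul_mem' := by
    rintro a b ⟨ha, ha1, ha2⟩ ⟨hb, hb1, hb2⟩
    refine ⟨mul_mem ha hb, ?_, ?_⟩
    · have h : ((a * b : V ≃ₗ[K] V) : V →ₗ[K] V) = (a : V →ₗ[K] V) ∘ₗ (b : V →ₗ[K] V) := rfl
      rw [h, Submodule.map_comp, hb1, ha1]
    · have h : ((a * b : V ≃ₗ[K] V) : V →ₗ[K] V) = (a : V →ₗ[K] V) ∘ₗ (b : V →ₗ[K] V) := rfl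
      rw [h, Submodule.map_comp, hb2, ha2]
  one_mem' := ⟨one_mem _, Submodule.map_id _, Submodule.map_id _⟩
  inv_mem' := by
    rintro a ⟨ha, ha1, ha2⟩
    have h : ((a⁻¹ : V ≃ₗ[K] V) : V →ₗ[K] V) ∘ₗ (a : V →ₗ[K] V) = LinearMap.id :=
      LinearMap.ext fun v => a.symm_apply_apply v
    refine ⟨inv_mem ha, ?_, ?_⟩
    · conv_lhs => rw [← ha1]
      rw [← Submodule.map_comp, h, Submodule.map_id]
    · conv_lhs => rw [← ha2]
      rw [← Submodule.map_comp, h, Submodule.map_id]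

/-- The unipotent radical `N` of the stabilizer of `W`, inside `End(V)`: the isometries `n` of the
form `n|_W = 1`, `n|_X = 1 + ξ`, `n|_{W'} = 1 + ξ' + η` with `ξ : X → W`, `ξ' : W' → X` and
`η : W' → W`. -/
def N : Set (Module.End K V) :=
  {n | (∀ v w, D.Φ (n v) (n w) = D.Φ v w) ∧ (∀ w ∈ D.W, n w = w) ∧
    (∀ x ∈ D.X, n x - x ∈ D.W) ∧ ∀ w' ∈ D.W', n w' - w' ∈ D.X ⊔ D.W}

/-- The projections of `V = W ⊕ X ⊕ W'` onto its summands. -/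
def projW : V →ₗ[K] D.W := proj D.W (D.X ⊔ D.W')
/-- The projection of `V = W ⊕ X ⊕ W'` onto `X`. -/
def projX : V →ₗ[K] D.X := proj D.X (D.W ⊔ D.W')
/-- The projection of `V = W ⊕ X ⊕ W'` onto `W'`. -/
def projW' : V →ₗ[K] D.W' := proj D.W' (D.W ⊔ D.X)

/-- The component `ξ : X → W` of `n = n(ξ, η)`. -/
def xiOf (n : Module.End K V) : D.X →ₗ[K] D.W := D.projW ∘ₗ n ∘ₗ D.X.subtype

/-- The component `η : W' → W` of `n = n(ξ, η)`. -/
def etaOf (n : Module.End K V) : D.W' →ₗ[K] D.W := D.projW ∘ₗ n ∘ₗ D.W'.subtype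

/-- The isomorphism `x ↦ Φ(x, ·)` of `X` with its dual. -/
def flatX : D.X →ₗ[K] Module.Dual K D.X := D.Φ.restrict D.X

/-- The map `ξ* : W' → X` with `Φ(ξ* w', x) = Φ(w', ξ x)`. -/
def xiStar (ξ : D.X →ₗ[K] D.W) : D.W' →ₗ[K] D.X :=
  linInv D.flatX ∘ₗ (D.W.subtype ∘ₗ ξ).dualMap ∘ₗ D.Φ ∘ₗ D.W'.subtype

/-- The element `n(ξ, η)`, with `ξ' = -ξ*`. -/
def nOf (ξ : D.X →ₗ[K] D.W) (η : D.W' →ₗ[K] D.W) : Module.End K V :=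
  1 + D.W.subtype ∘ₗ ξ ∘ₗ D.projX - D.X.subtype ∘ₗ D.xiStar ξ ∘ₗ D.projW' +
    D.W.subtype ∘ₗ η ∘ₗ D.projW'

/-- `N'`: the elements `n(ξ, η)` of `N` with `η` invertible. -/
def N' : Set (Module.End K V) := {n | n ∈ D.N ∧ Function.Bijective (D.etaOf n)}

/-- `Norm(n(ξ, η)) = 1 + ξ* η⁻¹ ξ` on `X`, extended by the identity of `W + W'`. -/
def norm (n : Module.End K V) : Module.End K V :=
  1 + D.X.subtype ∘ₗ D.xiStar (D.xiOf n) ∘ₗ linInv (D.etaOf n) ∘ₗ D.xiOf n ∘ₗ D.projX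

/-! ### Nondegenerate subspaces of `X` -/

/-- `Y` is a nondegenerate subspace of `X` with `dim Y = dim W`. -/
def IsNondegSub (Y : Submodule K V) : Prop :=
  Y ≤ D.X ∧ (D.Φ.restrict Y).Nondegenerate ∧ Module.finrank K Y = Module.finrank K D.W

/-- `H_Y`: the elements of `H` that are the identity on the orthogonal complement of `Y` in `X`;
equivalently, the isometries of `V` that are the identity on the orthogonal complement of `Y` in
`V`. -/
def HY (Y : Submodule K V) : Subgroup (V ≃ₗ[K] V) := D.fixing (D.Φ.orthogonal Y)

/-- `ε_Y = P_{Y^⊥} - P_Y` (on `X`, and extended by the identity of `W + W'`; here `Y^⊥` is the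
orthogonal complement in `V`). -/
def eps (Y : Submodule K V) : Module.End K V :=
  (D.Φ.orthogonal Y).subtype ∘ₗ proj (D.Φ.orthogonal Y) Y -
    Y.subtype ∘ₗ proj Y (D.Φ.orthogonal Y)

/-- The extension by zero on `Y^⊥` of a linear map `Y → W`. -/
def extend (Y : Submodule K V) (ξ : Y →ₗ[K] D.W) : D.X →ₗ[K] D.W :=
  ξ ∘ₗ proj Y (D.Φ.orthogonal Y) ∘ₗ D.X.subtype

/-- `ξ⁺ = ξ* (ξ ξ*)⁻¹`. -/
def xiPlus (ξ : D.X →ₗ[K] D.W) : D.W →ₗ[K] D.X :=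
  D.xiStar ξ ∘ₗ linInv (ξ ∘ₗ D.xiStar ξ)

/-- `Ξ(A) = ξ A ξ⁺`. -/
def Xi (ξ : D.X →ₗ[K] D.W) (A : Module.End K V) : Module.End K D.W :=
  ξ ∘ₗ D.projX ∘ₗ A ∘ₗ D.X.subtype ∘ₗ D.xiPlus ξ

/-- `n_Y(h) = n(ξ_Y, Ξ(h - 1)⁻¹ ξ_Y ξ_Y*)`, where `ξ_Y : Y → W` is extended by zero on `Y^⊥`. -/
def nY (Y : Submodule K V) (ξ : Y →ₗ[K] D.W) (h : Module.End K V) : Module.End K V :=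
  D.nOf (D.extend Y ξ)
    (linInv (D.Xi (D.extend Y ξ) (h - 1)) ∘ₗ D.extend Y ξ ∘ₗ D.xiStar (D.extend Y ξ))

/-! ### Over an algebraically closed field -/

/-- `T_reg`, for a maximal torus `T` of `H_Y` and `K` algebraically closed: the regular elements `γ`
of `T` such that `(ε_Y γ - 1)|_Y` is invertible. -/
def Treg (Y : Submodule K V) (T : Subgroup (V ≃ₗ[K] V)) : Set (V ≃ₗ[K] V) :=
  {γ | γ ∈ T ∧ IsRegularIn (D.HY Y) T γ ∧
    Set.BijOn (D.eps Y * (γ : Module.End K V) - 1 : Module.End K V) (Y : Set V) (Y : Set V)}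

/-- `H^T = Int(H)(ε_Y T_reg)`. -/
def HT (Y : Submodule K V) (T : Subgroup (V ≃ₗ[K] V)) : Set (Module.End K V) :=
  {a | ∃ h ∈ D.H, ∃ γ ∈ D.Treg Y T, a = h.conj (D.eps Y * (γ : Module.End K V))}

/-- The set of elements of `N'` whose norm lies in `H^T`. -/
def Nreg (Y : Submodule K V) (T : Subgroup (V ≃ₗ[K] V)) : Set (Module.End K V) :=
  {n | n ∈ D.N' ∧ D.norm n ∈ D.HT Y T}

end Field

/-! ### Rational points -/

section Rational

variable {F V : Type*} [Field F] [AddCommGroup V] [Module F V] (D : Datum F V)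

/-- Extension of scalars. -/
def baseChange (K : Type*) [Field K] [Algebra F K] : Datum K (K ⊗[F] V) where
  Φ := LinearMap.BilinForm.baseChange K D.Φ
  W := D.W.baseChange K
  W' := D.W'.baseChange K

/-- Extension of scalars to the algebraic closure. -/
def bar : Datum (AlgebraicClosure F) (Vbar F V) :=
  D.baseChange (AlgebraicClosure F)

/-- The `F`-points of the variety `Nreg`. -/
def NregRat (Y : Submodule (AlgebraicClosure F) (Vbar F V))
    (T : Subgroup (GLbar F V)) : Set (Module.End F V) :=
  {n | n ∈ D.N ∧ LinearMap.baseChange (AlgebraicClosure F) n ∈ D.bar.Nreg Y T}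

/-- `T` is (the group of points over the algebraic closure of) a maximal torus of `H_Y`, defined
over `F`. -/
def IsRatMaximalTorus (Y : Submodule F V)
    (T : Subgroup (GLbar F V)) : Prop :=
  IsMaximalTorus (D.bar.HY (Y.baseChange (AlgebraicClosure F))) T ∧ IsDefinedOver T

/-- The `F`-points of `T_reg`. -/
def TregRat (Y : Submodule F V)
    (T : Subgroup (GLbar F V)) : Set (V ≃ₗ[F] V) :=
  {γ | toBar γ ∈
    D.bar.Treg (Y.baseChange (AlgebraicClosure F)) T}

/-- `T` and `T'` are conjugate by an element of `H_Y` (over `F`). -/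
def ConjTori (Y : Submodule F V)
    (T T' : Subgroup (GLbar F V)) : Prop :=
  ∃ h ∈ D.HY Y, T.map (MulAut.conj (toBar h)).toMonoidHom = T'

/-- `Y` and `Y'` are in the same orbit of `H`. -/
def SameOrbit (Y Y' : Submodule F V) : Prop :=
  ∃ h ∈ D.H, Y.map (h : V →ₗ[F] V) = Y'

/-- `N_{Y,T}`: the elements of `N'` whose norm is conjugate in `H_Y` to an element of
`ε_Y T_reg`. -/
def NYTlower (Y : Submodule F V)
    (T : Subgroup (GLbar F V)) : Set (Module.End F V) :=
  {n | n ∈ D.N' ∧ ∃ h ∈ D.HY Y, ∃ γ ∈ D.TregRat Y T,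
    h.conj (D.norm n) = D.eps Y * (γ : Module.End F V)}

/-- `N^{Y,T} = Int(H)(N_{Y,T})`. -/
def NYTupper (Y : Submodule F V)
    (T : Subgroup (GLbar F V)) : Set (Module.End F V) :=
  {n | ∃ h ∈ D.H, ∃ n₀ ∈ D.NYTlower Y T, n = h.conj n₀}

/-- The set of all `Int(m) n_Y(ε_Y γ)` with `m ∈ M` and `γ ∈ T_reg`. -/
def cell (Y : Submodule F V) (ξ : Y →ₗ[F] D.W)
    (T : Subgroup (GLbar F V)) : Set (Module.End F V) :=
  {n | ∃ m ∈ D.M, ∃ γ ∈ D.TregRat Y T, n = m.conj (D.nY Y ξ (D.eps Y * (γ : Module.End F V)))}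

end Rational

end Datum

end

end OddNorm

open OddNorm

set_option linter.unusedSectionVars false

/-! Everything is read off one matrix. Fix a basis `w` of `W'` and let `B` be the matrix of `Φ(u, n
v)` on `W'`, for `n = n(ξ, η)`. Since `W'` pairs perfectly with `W`, `η` is invertible iff `det B ≠
0`. The vectors `x_j`, the `X`-components of `n w_j`, equal `-ξ* w_j`. The relation `η + η* + ξξ* =
0` says that their Gram matrix is `-(B + Bᵀ)` (`gram_xiFamily`), and the norm acts on them by
`-B⁻¹Bᵀ` (`norm_xiFamily`). Hence, if `det (B + Bᵀ) ≠ 0`, the image `Y` of `ξ*` is nondegenerate of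
dimension `k`, the norm is supported on `Y`, `Norm - 1` is invertible there, and `γ = ε_Y Norm` acts
on `Y` by `B⁻¹Bᵀ`.

Over an algebraically closed field a nondegenerate `Y` of odd dimension has a basis of hyperbolic
pairs and one anisotropic vector. The maximal tori of `H_Y` are the groups that are diagonal in such
a basis and fix the anisotropic vector (`exists_eq_hypTorus`, `hypTorus_isMaximalTorus`). The
eigenvalue 1 on that vector is why the twist `ε_Y` is needed for `Norm - 1` to be invertible. For
`γ` in the torus without eigenvalue `-1`, regular means having distinct eigenvalues: a repeated
eigenvalue gives a connected family of Eichler transformations in the centralizer but not in the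
torus. As `H` permutes all hyperbolic bases transitively, `N_reg` is cut out in `N` by `det B ≠ 0`,
`det (B + Bᵀ) ≠ 0` and distinct eigenvalues of `B⁻¹Bᵀ` (`mem_Nreg_iff`), whatever `(Y₀, T₀)` is. The
last condition is a resultant, so the set is open; generic eigenvalues show that it is nonempty.

For a rational `n` in `N_reg`, both `Y` and `γ` are rational. The torus of an eigenbasis of `γ` over
the closure is defined over `F` (`hypTorus_isDefinedOver`). Modulo the rational equations expressing
isometry, commutation with `γ` and triviality on the fixed vectors of `γ`, every polynomial function
is a combination of monomials in the diagonal entries. Monomials with the same character agree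
there, and distinct characters are linearly independent. This argument needs no Galois descent, so
no perfectness of `F`. Moving `Y` and the torus to the chosen representatives proves part 2.

Part 3 rests on the fibres of the norm. Once `ξ` is surjective, `ξ` and the norm determine `η`, and
the subgroup `GL(W)` of `M` moves `ξ` freely among the maps with a given kernel without changing the
norm. So the elements of `N'` with norm `a` supported on `Y` are `M`-conjugate to `n_Y(a)`, and each
cell equals the corresponding `N^{Y,T}`. The cells are disjoint because `n` determines `Y` as the
image of `ξ*`, and a regular element determines its torus. -/

namespace OddNorm

noncomputable section

/-! ### Projections and inverses of linear maps -/

section Complements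

variable {K V : Type*} [Field K] [AddCommGroup V] [Module K V]

theorem proj_of_mem_left {A B : Submodule K V} (h : IsCompl A B) {x : V} (hx : x ∈ A) :
    (proj A B x : V) = x := by
  rw [proj, dif_pos h]
  exact congrArg Subtype.val (Submodule.projectionOnto_apply_left h ⟨x, hx⟩)

theorem proj_of_mem_right {A B : Submodule K V} (h : IsCompl A B) {x : V} (hx : x ∈ B) :
    proj A B x = 0 := by
  rw [proj, dif_pos h]
  exact Submodule.projectionOnto_apply_right h ⟨x, hx⟩

theorem proj_add_proj {A B : Submodule K V} (h : IsCompl A B) (x : V) :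
    (proj A B x : V) + proj B A x = x := by
  obtain ⟨a, ha, b, hb, rfl⟩ := Submodule.mem_sup.1 (h.sup_eq_top ▸ Submodule.mem_top : x ∈ A ⊔ B)
  simp only [map_add, Submodule.coe_add, proj_of_mem_left h ha, proj_of_mem_right h hb,
    proj_of_mem_left h.symm hb, proj_of_mem_right h.symm ha]
  simp

variable {A B : Type*} [AddCommGroup A] [Module K A] [AddCommGroup B] [Module K B]

theorem linInv_apply_self {f : A →ₗ[K] B} (h : Function.Bijective f) (x : A) :
    linInv f (f x) = x := by
  rw [linInv, dif_pos h]
  exact (LinearEquiv.ofBijective f h).symm_apply_apply x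

theorem apply_linInv {f : A →ₗ[K] B} (h : Function.Bijective f) (y : B) :
    f (linInv f y) = y := by
  rw [linInv, dif_pos h]
  exact (LinearEquiv.ofBijective f h).apply_symm_apply y

theorem linInv_bijective {f : A →ₗ[K] B} (h : Function.Bijective f) :
    Function.Bijective (linInv f) :=
  ⟨Function.LeftInverse.injective (apply_linInv h),
    Function.RightInverse.surjective (linInv_apply_self h)⟩

end Complements

/-! ### Extension of isometries and Gram matrices -/

section Isometries

variable {K V : Type*} [Field K] [AddCommGroup V] [Module K V] [FiniteDimensional K V]
  {Φ : LinearMap.BilinForm K V}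

theorem isCompl_orthogonal (hs : Φ.IsSymm) {A : Submodule K V}
    (hA : (Φ.restrict A).Nondegenerate) : IsCompl A (Φ.orthogonal A) :=
  LinearMap.BilinForm.isCompl_orthogonal_of_restrict_nondegenerate hs.isRefl hA

theorem orthogonal_restrict_nondegenerate (hs : Φ.IsSymm) (hΦ : Φ.Nondegenerate)
    {A : Submodule K V} (hA : (Φ.restrict A).Nondegenerate) :
    (Φ.restrict (Φ.orthogonal A)).Nondegenerate := by
  rw [LinearMap.BilinForm.restrict_nondegenerate_iff_isCompl_orthogonal hs.isRefl,
    LinearMap.BilinForm.orthogonal_orthogonal hΦ hs.isRefl]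
  exact (isCompl_orthogonal hs hA).symm

theorem apply_eq_zero_of_mem_orthogonal {A : Submodule K V} {a b : V} (ha : a ∈ A)
    (hb : b ∈ Φ.orthogonal A) : Φ a b = 0 := hb a ha

theorem apply_eq_zero_of_mem_orthogonal' (hs : Φ.IsSymm) {A : Submodule K V} {a b : V} (ha : a ∈ A)
    (hb : b ∈ Φ.orthogonal A) : Φ b a = 0 := by
  rw [hs.eq_iff]; exact hb a ha

theorem apply_of_decomposition (hs : Φ.IsSymm) {A : Submodule K V} {a b a' b' : V} (ha : a ∈ A)
    (ha' : a' ∈ A) (hb : b ∈ Φ.orthogonal A) (hb' : b' ∈ Φ.orthogonal A) :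
    Φ (a + b) (a' + b') = Φ a a' + Φ b b' := by
  simp only [map_add, LinearMap.add_apply, apply_eq_zero_of_mem_orthogonal ha hb',
    apply_eq_zero_of_mem_orthogonal' hs ha' hb]
  ring

/-- An isometry of a nondegenerate subspace extends by the identity. -/
theorem exists_isometry_of_linearMap (hs : Φ.IsSymm) (hΦ : Φ.Nondegenerate) {A : Submodule K V}
    (hA : (Φ.restrict A).Nondegenerate) (e : A →ₗ[K] V) (heA : ∀ a, e a ∈ A)
    (he : ∀ a a', Φ (e a) (e a') = Φ a a') :
    ∃ u : V ≃ₗ[K] V, (∀ x y, Φ (u x) (u y) = Φ x y) ∧ (∀ a : A, u a = e a) ∧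
      ∀ x ∈ Φ.orthogonal A, u x = x := by
  have hc := isCompl_orthogonal hs hA
  let f : V →ₗ[K] V := e ∘ₗ proj A (Φ.orthogonal A) +
    (Φ.orthogonal A).subtype ∘ₗ proj (Φ.orthogonal A) A
  have hf : ∀ x, f x = e (proj A (Φ.orthogonal A) x) + (proj (Φ.orthogonal A) A x : V) :=
    fun x => rfl
  have hiso : ∀ x y, Φ (f x) (f y) = Φ x y := by
    intro x y
    conv_rhs => rw [← proj_add_proj hc x, ← proj_add_proj hc y]
    rw [hf, hf, apply_of_decomposition hs (heA _) (heA _) (Subtype.mem _) (Subtype.mem _),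
      apply_of_decomposition hs (Subtype.mem _) (Subtype.mem _) (Subtype.mem _) (Subtype.mem _), he]
  have hinj : Function.Injective f := by
    rw [injective_iff_map_eq_zero]
    intro x hx
    refine hΦ.1 x fun y => ?_
    rw [← hiso, hx, map_zero, LinearMap.zero_apply]
  refine ⟨LinearEquiv.ofInjectiveEndo f hinj, hiso, fun a => ?_, fun x hx => ?_⟩
  · change f a = e a
    have h1 : proj A (Φ.orthogonal A) (a : V) = a := Subtype.ext (proj_of_mem_left hc a.2)
    rw [hf, h1, proj_of_mem_right hc.symm a.2]
    simp
  · change f x = x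
    rw [hf, proj_of_mem_right hc hx, proj_of_mem_left hc.symm hx]
    simp

/-- Independence of `v'` is not assumed: equal Gram matrices already make the induced map of `A` an
isometry, which is injective by nondegeneracy. -/
theorem exists_isometry_of_families (hs : Φ.IsSymm) (hΦ : Φ.Nondegenerate) {A : Submodule K V}
    (hA : (Φ.restrict A).Nondegenerate) {ι : Type*} {v v' : ι → V} (hv : LinearIndependent K v)
    (hspan : Submodule.span K (Set.range v) = A) (hv' : ∀ i, v' i ∈ A)
    (hG : ∀ i j, Φ (v' i) (v' j) = Φ (v i) (v j)) :
    ∃ u : V ≃ₗ[K] V, (∀ x y, Φ (u x) (u y) = Φ x y) ∧ (∀ i, u (v i) = v' i) ∧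
      ∀ x ∈ Φ.orthogonal A, u x = x := by
  subst hspan
  let b := Module.Basis.span hv
  have hb : ∀ i, (b i : V) = v i := fun i => congrArg Subtype.val (Module.Basis.span_apply hv i)
  let e := b.constr K v'
  have heb : ∀ i, e (b i) = v' i := fun i => b.constr_basis K v' i
  have heA : ∀ a, e a ∈ Submodule.span K (Set.range v) := by
    intro a
    have h : e a ∈ LinearMap.range e := ⟨a, rfl⟩
    rw [b.constr_range] at h
    refine Submodule.span_le.2 ?_ h
    rintro _ ⟨i, rfl⟩
    exact hv' i
  have he : ∀ a a', Φ (e a) (e a') = Φ a a' := by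
    have h : (Φ.comp e e) = Φ.restrict (Submodule.span K (Set.range v)) := by
      refine b.ext fun i => b.ext fun j => ?_
      change Φ (e (b i)) (e (b j)) = Φ (b i) (b j)
      rw [heb, heb, hb, hb, hG]
    exact fun a a' => congrArg (fun B : LinearMap.BilinForm K _ => B a a') h
  obtain ⟨u, h1, h2, h3⟩ := exists_isometry_of_linearMap hs hΦ hA e heA he
  refine ⟨u, h1, fun i => ?_, h3⟩
  rw [← hb, h2, heb]

theorem exists_isometry_of_map_le (hs : Φ.IsSymm) (hΦ : Φ.Nondegenerate) {A : Submodule K V}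
    (hA : (Φ.restrict A).Nondegenerate) (m : V →ₗ[K] V) (hm : ∀ x y, Φ (m x) (m y) = Φ x y)
    (hmA : ∀ a ∈ A, m a ∈ A) :
    ∃ u : V ≃ₗ[K] V, (∀ x y, Φ (u x) (u y) = Φ x y) ∧ (∀ a ∈ A, u a = m a) ∧
      ∀ x ∈ Φ.orthogonal A, u x = x := by
  obtain ⟨u, h1, h2, h3⟩ := exists_isometry_of_linearMap hs hΦ hA (m ∘ₗ A.subtype)
    (fun a => hmA a a.2) (fun a a' => hm a a')
  exact ⟨u, h1, fun a ha => h2 ⟨a, ha⟩, h3⟩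

/-- An isometry that fixes `A` pointwise preserves the orthogonal complement of `A`. -/
theorem map_mem_orthogonal {u : V ≃ₗ[K] V} (hu : ∀ x y, Φ (u x) (u y) = Φ x y)
    {A : Submodule K V} (hA : ∀ a ∈ A, u a = a) {x : V} (hx : x ∈ Φ.orthogonal A) :
    u x ∈ Φ.orthogonal A := by
  intro a ha
  have := hu a x
  rw [hA a ha] at this
  exact this.trans (hx a ha)

/-- If `∑ c_j v_j` is orthogonal to every `v_i`, then `c` is in the kernel of the Gram matrix.
Applied to the zero vector this gives independence, applied to the radical of the span it gives
nondegeneracy. -/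
theorem restrict_nondegenerate_of_gram {ι : Type*} [Fintype ι] [DecidableEq ι] (hs : Φ.IsSymm)
    {v : ι → V} (hdet : (Matrix.of fun i j => Φ (v i) (v j)).det ≠ 0) :
    LinearIndependent K v ∧ (Φ.restrict (Submodule.span K (Set.range v))).Nondegenerate := by
  have key : ∀ c : ι → K, (∀ i, Φ (v i) (∑ j, c j • v j) = 0) → c = 0 := by
    intro c hc
    refine Matrix.eq_zero_of_mulVec_eq_zero hdet (funext fun i => ?_)
    rw [Pi.zero_apply, ← hc i, map_sum, Matrix.mulVec, dotProduct]
    refine Finset.sum_congr rfl fun j _ => ?_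
    rw [map_smul, smul_eq_mul, mul_comm, Matrix.of_apply]
  constructor
  · rw [Fintype.linearIndependent_iff]
    intro c hc
    exact fun i => congrFun (key c fun i => by rw [hc, map_zero]) i
  · rw [LinearMap.BilinForm.restrict_nondegenerate_iff_isCompl_orthogonal hs.isRefl,
      LinearMap.BilinForm.isCompl_orthogonal_iff_disjoint hs.isRefl, Submodule.disjoint_def]
    intro x hx hx'
    obtain ⟨c, rfl⟩ := (Submodule.mem_span_range_iff_exists_fun K).1 hx
    have : c = 0 := key c fun i => hx' _ (Submodule.subset_span ⟨i, rfl⟩)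
    simp [this]

/-- A vector in the kernel of the Gram matrix would give a nonzero element of the radical of the
span. -/
theorem gram_det_ne_zero {ι : Type*} [Fintype ι] [DecidableEq ι] 
    {v : ι → V} (hv : LinearIndependent K v)
    (hn : (Φ.restrict (Submodule.span K (Set.range v))).Nondegenerate) :
    (Matrix.of fun i j => Φ (v i) (v j)).det ≠ 0 := by
  intro h
  obtain ⟨c, hc0, hc⟩ := Matrix.exists_mulVec_eq_zero_iff.2 h
  have hmem : ∑ j, c j • v j ∈ Submodule.span K (Set.range v) :=
    Submodule.sum_mem _ fun j _ => Submodule.smul_mem _ _ (Submodule.subset_span ⟨j, rfl⟩)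
  have h0 : ∀ i, Φ (v i) (∑ j, c j • v j) = 0 := by
    intro i
    have := congrFun hc i
    rw [Pi.zero_apply, Matrix.mulVec, dotProduct] at this
    rw [map_sum, ← this]
    refine Finset.sum_congr rfl fun j _ => ?_
    rw [map_smul, smul_eq_mul, mul_comm, Matrix.of_apply]
  have h1 := hn.2 ⟨_, hmem⟩ (by
    rintro ⟨x, hx⟩
    change Φ x _ = 0
    induction hx using Submodule.span_induction with
    | mem x hx => obtain ⟨i, rfl⟩ := hx; exact h0 i
    | zero => simp
    | add x y _ _ hx hy => rw [map_add, LinearMap.add_apply, hx, hy, add_zero]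
    | smul a x _ hx => rw [map_smul, LinearMap.smul_apply, hx, smul_zero])
  exact hc0 (funext (Fintype.linearIndependent_iff.1 hv c (congrArg Subtype.val h1)))

end Isometries

end

end OddNorm

namespace OddNorm

noncomputable section

namespace Datum

/-! ### The decomposition `V = W ⊕ X ⊕ W'` -/

section Decomposition

variable {K V : Type*} [Field K] [AddCommGroup V] [Module K V] [FiniteDimensional K V]
  {D : Datum K V}

namespace IsOrthogonal

variable (hD : D.IsOrthogonal)
include hD

theorem comm (x y : V) : D.Φ x y = D.Φ y x := hD.symm.eq x y

theorem isCompl_sup_X : IsCompl (D.W ⊔ D.W') D.X :=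
  isCompl_orthogonal hD.symm hD.nondegenerate_sup

theorem restrict_X_nondegenerate : (D.Φ.restrict D.X).Nondegenerate :=
  orthogonal_restrict_nondegenerate hD.symm hD.nondegenerate hD.nondegenerate_sup

theorem orthogonal_X : D.Φ.orthogonal D.X = D.W ⊔ D.W' :=
  LinearMap.BilinForm.orthogonal_orthogonal hD.nondegenerate hD.symm.isRefl _

omit [FiniteDimensional K V] hD in
theorem apply_W_X {w x : V} (hw : w ∈ D.W) (hx : x ∈ D.X) : D.Φ w x = 0 :=
  hx w (Submodule.mem_sup_left hw)

theorem apply_X_W {w x : V} (hw : w ∈ D.W) (hx : x ∈ D.X) : D.Φ x w = 0 := by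
  rw [hD.comm, apply_W_X hw hx]

omit [FiniteDimensional K V] hD in
theorem apply_W'_X {w x : V} (hw : w ∈ D.W') (hx : x ∈ D.X) : D.Φ w x = 0 :=
  hx w (Submodule.mem_sup_right hw)

theorem apply_X_W' {w x : V} (hw : w ∈ D.W') (hx : x ∈ D.X) : D.Φ x w = 0 := by
  rw [hD.comm, apply_W'_X hw hx]

theorem exists_decomposition (v : V) :
    ∃ w ∈ D.W, ∃ x ∈ D.X, ∃ w' ∈ D.W', v = w + x + w' := by
  have h : v ∈ (D.W ⊔ D.W') ⊔ D.X := hD.isCompl_sup_X.sup_eq_top ▸ Submodule.mem_top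
  obtain ⟨u, hu, x, hx, rfl⟩ := Submodule.mem_sup.1 h
  obtain ⟨w, hw, w', hw', rfl⟩ := Submodule.mem_sup.1 hu
  exact ⟨w, hw, x, hx, w', hw', by abel⟩

theorem eq_zero_of_mem_W {w : V} (hw : w ∈ D.W) (h : ∀ w' ∈ D.W', D.Φ w w' = 0) : w = 0 := by
  refine hD.nondegenerate.1 w fun v => ?_
  obtain ⟨w₁, hw₁, x, hx, w', hw', rfl⟩ := hD.exists_decomposition v
  rw [map_add, map_add, hD.isotropic w hw w₁ hw₁, apply_W_X hw hx, h w' hw']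
  simp

theorem eq_zero_of_mem_W' {w' : V} (hw' : w' ∈ D.W') (h : ∀ w ∈ D.W, D.Φ w w' = 0) : w' = 0 := by
  refine hD.nondegenerate.2 w' fun v => ?_
  obtain ⟨w₁, hw₁, x, hx, w'', hw'', rfl⟩ := hD.exists_decomposition v
  simp only [map_add, LinearMap.add_apply]
  rw [h w₁ hw₁, hD.apply_X_W' hw' hx, hD.isotropic' w'' hw'' w' hw']
  simp

theorem eq_zero_of_mem_X {x : V} (hx : x ∈ D.X) (h : ∀ y ∈ D.X, D.Φ x y = 0) : x = 0 :=
  congrArg Subtype.val (hD.restrict_X_nondegenerate.1 ⟨x, hx⟩ fun y => h y y.2)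

theorem isCompl_W : IsCompl D.W (D.X ⊔ D.W') := by
  refine IsCompl.of_eq (eq_bot_iff.2 ?_) (eq_top_iff.2 fun v _ => ?_)
  · rintro v ⟨hv, hv'⟩
    obtain ⟨x, hx, w', hw', rfl⟩ := Submodule.mem_sup.1 hv'
    have h0 : w' = 0 := by
      refine hD.eq_zero_of_mem_W' hw' fun w hw => ?_
      have := hD.isotropic w hw _ hv
      rwa [map_add, apply_W_X hw hx, zero_add] at this
    subst h0
    rw [add_zero] at hv ⊢
    exact hD.eq_zero_of_mem_X hx fun y hy => apply_W_X hv hy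
  · obtain ⟨w, hw, x, hx, w', hw', rfl⟩ := hD.exists_decomposition v
    rw [add_assoc]
    exact Submodule.add_mem_sup hw (Submodule.add_mem_sup hx hw')

theorem isCompl_W' : IsCompl D.W' (D.W ⊔ D.X) := by
  refine IsCompl.of_eq (eq_bot_iff.2 ?_) (eq_top_iff.2 fun v _ => ?_)
  · rintro v ⟨hv, hv'⟩
    obtain ⟨w, hw, x, hx, rfl⟩ := Submodule.mem_sup.1 hv'
    have h0 : w = 0 := by
      refine hD.eq_zero_of_mem_W hw fun w' hw' => ?_
      have := hD.isotropic' _ hv w' hw'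
      rwa [map_add, LinearMap.add_apply, hD.apply_X_W' hw' hx, add_zero] at this
    subst h0
    rw [zero_add] at hv ⊢
    exact hD.eq_zero_of_mem_X hx fun y hy => apply_W'_X hv hy
  · obtain ⟨w, hw, x, hx, w', hw', rfl⟩ := hD.exists_decomposition v
    rw [add_comm]
    exact Submodule.add_mem_sup hw' (Submodule.add_mem_sup hw hx)

theorem isCompl_X : IsCompl D.X (D.W ⊔ D.W') := hD.isCompl_sup_X.symm

theorem projW_of_mem_W {v : V} (hv : v ∈ D.W) : (D.projW v : V) = v :=
  proj_of_mem_left hD.isCompl_W hv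
theorem projW_of_mem_X {v : V} (hv : v ∈ D.X) : D.projW v = 0 :=
  proj_of_mem_right hD.isCompl_W (Submodule.mem_sup_left hv)
theorem projW_of_mem_W' {v : V} (hv : v ∈ D.W') : D.projW v = 0 :=
  proj_of_mem_right hD.isCompl_W (Submodule.mem_sup_right hv)
theorem projX_of_mem_W {v : V} (hv : v ∈ D.W) : D.projX v = 0 :=
  proj_of_mem_right hD.isCompl_X (Submodule.mem_sup_left hv)
theorem projX_of_mem_X {v : V} (hv : v ∈ D.X) : (D.projX v : V) = v :=
  proj_of_mem_left hD.isCompl_X hv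
theorem projX_of_mem_W' {v : V} (hv : v ∈ D.W') : D.projX v = 0 :=
  proj_of_mem_right hD.isCompl_X (Submodule.mem_sup_right hv)
theorem projW'_of_mem_W {v : V} (hv : v ∈ D.W) : D.projW' v = 0 :=
  proj_of_mem_right hD.isCompl_W' (Submodule.mem_sup_left hv)
theorem projW'_of_mem_X {v : V} (hv : v ∈ D.X) : D.projW' v = 0 :=
  proj_of_mem_right hD.isCompl_W' (Submodule.mem_sup_right hv)
theorem projW'_of_mem_W' {v : V} (hv : v ∈ D.W') : (D.projW' v : V) = v :=
  proj_of_mem_left hD.isCompl_W' hv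

theorem projW_coe (v : D.W) : D.projW (v : V) = v := Subtype.ext (hD.projW_of_mem_W v.2)
theorem projX_coe (v : D.X) : D.projX (v : V) = v := Subtype.ext (hD.projX_of_mem_X v.2)
theorem projW'_coe (v : D.W') : D.projW' (v : V) = v := Subtype.ext (hD.projW'_of_mem_W' v.2)

theorem linearMap_ext {E : Type*} [AddCommGroup E] [Module K E] {f g : V →ₗ[K] E}
    (hW : ∀ w ∈ D.W, f w = g w) (hX : ∀ x ∈ D.X, f x = g x) (hW' : ∀ w' ∈ D.W', f w' = g w') :
    f = g := by
  ext v
  obtain ⟨w, hw, x, hx, w', hw', rfl⟩ := hD.exists_decomposition v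
  simp only [map_add, hW w hw, hX x hx, hW' w' hw']

/-- `W'` is the dual of `W`. -/
theorem pairing_bijective :
    Function.Bijective ((D.Φ.domRestrict₁₂ D.W' D.W : D.W' →ₗ[K] Module.Dual K D.W)) ∧
    Function.Bijective ((D.Φ.domRestrict₁₂ D.W D.W' : D.W →ₗ[K] Module.Dual K D.W')) := by
  have h1 : Function.Injective ((D.Φ.domRestrict₁₂ D.W' D.W : D.W' →ₗ[K] Module.Dual K D.W)) := by
    rw [injective_iff_map_eq_zero]
    intro a ha
    refine Subtype.ext (hD.eq_zero_of_mem_W' a.2 fun w hw => ?_)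
    rw [hD.comm]
    exact LinearMap.congr_fun ha ⟨w, hw⟩
  have h2 : Function.Injective ((D.Φ.domRestrict₁₂ D.W D.W' : D.W →ₗ[K] Module.Dual K D.W')) := by
    rw [injective_iff_map_eq_zero]
    intro a ha
    exact Subtype.ext (hD.eq_zero_of_mem_W a.2 fun w hw => LinearMap.congr_fun ha ⟨w, hw⟩)
  -- The two injections give inequalities in both directions between `dim W` and `dim W'`, so both
  -- injections are bijective.
  have e1 := LinearMap.finrank_le_finrank_of_injective h1
  have e2 := LinearMap.finrank_le_finrank_of_injective h2
  rw [Subspace.dual_finrank_eq] at e1 e2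
  exact ⟨⟨h1, (LinearMap.injective_iff_surjective_of_finrank_eq_finrank
      (by rw [Subspace.dual_finrank_eq]; omega)).1 h1⟩,
    ⟨h2, (LinearMap.injective_iff_surjective_of_finrank_eq_finrank
      (by rw [Subspace.dual_finrank_eq]; omega)).1 h2⟩⟩

theorem finrank_W' : Module.finrank K D.W' = Module.finrank K D.W := by
  rw [(LinearEquiv.ofBijective _ hD.pairing_bijective.1).finrank_eq, Subspace.dual_finrank_eq]

theorem flatX_bijective : Function.Bijective D.flatX := by
  have h1 : Function.Injective D.flatX := by
    rw [injective_iff_map_eq_zero]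
    intro a ha
    exact hD.restrict_X_nondegenerate.1 a fun y => LinearMap.congr_fun ha y
  exact ⟨h1, (LinearMap.injective_iff_surjective_of_finrank_eq_finrank
      Subspace.dual_finrank_eq.symm).1 h1⟩

theorem xiStar_apply (ξ : D.X →ₗ[K] D.W) (w' : D.W') (x : D.X) :
    D.Φ (D.xiStar ξ w') x = D.Φ w' (ξ x) := by
  have h := apply_linInv hD.flatX_bijective
    (((D.W.subtype ∘ₗ ξ).dualMap ∘ₗ D.Φ ∘ₗ D.W'.subtype) w')
  exact LinearMap.congr_fun h x

theorem xiStar_apply' (ξ : D.X →ₗ[K] D.W) (w' : D.W') (x : D.X) :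
    D.Φ x (D.xiStar ξ w') = D.Φ (ξ x) w' := by
  rw [hD.comm, hD.xiStar_apply, hD.comm]

theorem xiStar_unique (ξ : D.X →ₗ[K] D.W) (w' : D.W') (z : D.X)
    (h : ∀ x : D.X, D.Φ z x = D.Φ w' (ξ x)) : D.xiStar ξ w' = z := by
  have := hD.eq_zero_of_mem_X (D.xiStar ξ w' - z).2 fun y hy => by
    have h1 := hD.xiStar_apply ξ w' ⟨y, hy⟩
    have h2 := h ⟨y, hy⟩
    simp only [Submodule.coe_sub, map_sub, LinearMap.sub_apply]
    exact sub_eq_zero.2 (h1.trans h2.symm)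
  exact sub_eq_zero.1 (Subtype.ext this)

end IsOrthogonal

end Decomposition

end Datum

end

end OddNorm

namespace OddNorm

noncomputable section

namespace Datum

/-! ### The elements `n(ξ, η)` and their norms -/

section UnipotentRadical

variable {K V : Type*} [Field K] [AddCommGroup V] [Module K V] [FiniteDimensional K V]
  {D : Datum K V} (hD : D.IsOrthogonal)
include hD

theorem nOf_apply_W (ξ : D.X →ₗ[K] D.W) (η : D.W' →ₗ[K] D.W) {w : V} (hw : w ∈ D.W) :
    D.nOf ξ η w = w := by
  simp [nOf, hD.projX_of_mem_W hw, hD.projW'_of_mem_W hw]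

theorem nOf_apply_X (ξ : D.X →ₗ[K] D.W) (η : D.W' →ₗ[K] D.W) (x : D.X) :
    D.nOf ξ η x = x + ξ x := by
  simp [nOf, hD.projX_coe, hD.projW'_of_mem_X x.2]

theorem nOf_apply_W' (ξ : D.X →ₗ[K] D.W) (η : D.W' →ₗ[K] D.W) (w' : D.W') :
    D.nOf ξ η w' = w' - D.xiStar ξ w' + η w' := by
  simp [nOf, hD.projW'_coe, hD.projX_of_mem_W' w'.2]

theorem apply_eq_add_xiOf {n : Module.End K V} (hn : n ∈ D.N) (x : D.X) :
    n x = x + D.xiOf n x := by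
  have h := hn.2.2.1 x x.2
  have h1 : D.projW (n x) = D.projW (n x - x) := by
    rw [map_sub, hD.projW_of_mem_X x.2, sub_zero]
  have h2 : (D.xiOf n x : V) = n x - x := by
    change (D.projW (n x) : V) = _
    rw [h1, hD.projW_of_mem_W h]
  rw [h2]; abel

theorem apply_eq_add_etaOf {n : Module.End K V} (hn : n ∈ D.N) (w' : D.W') :
    n w' = w' + D.projX (n w') + D.etaOf n w' := by
  obtain ⟨x, hx, w, hw, h⟩ := Submodule.mem_sup.1 (hn.2.2.2 w' w'.2)
  have h1 : n w' = w' + x + w := by rw [add_assoc, h]; abel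
  have h2 : (D.etaOf n w' : V) = D.projW (n w') := rfl
  rw [h2]
  conv_rhs => rw [h1]
  simp only [map_add, Submodule.coe_add, hD.projX_of_mem_W' w'.2, hD.projX_of_mem_X hx,
    hD.projX_of_mem_W hw, hD.projW_of_mem_W' w'.2, hD.projW_of_mem_X hx, hD.projW_of_mem_W hw]
  rw [h1]
  simp

/-- Expanding `Φ(n w', n x) = Φ(w', x) = 0` leaves `Φ(w', ξ x) + Φ(z, x) = 0`, with `z` the
`X`-component of `n w'`. So that component is forced, and `n` is determined by `ξ` and `η`. -/
theorem xiStar_xiOf {n : Module.End K V} (hn : n ∈ D.N) (w' : D.W') :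
    D.xiStar (D.xiOf n) w' = -D.projX (n w') := by
  refine hD.xiStar_unique _ _ _ fun x => ?_
  have h := hn.1 w' x
  rw [apply_eq_add_xiOf hD hn, apply_eq_add_etaOf hD hn] at h
  simp only [map_add, LinearMap.add_apply, IsOrthogonal.apply_W'_X w'.2 x.2,
    IsOrthogonal.apply_W_X (D.etaOf n w').2 x.2,
    hD.isotropic _ (D.etaOf n w').2 _ (D.xiOf n x).2,
    hD.apply_X_W (D.xiOf n x).2 (D.projX (n w')).2] at h
  rw [Submodule.coe_neg, map_neg, LinearMap.neg_apply]
  linear_combination -h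

/-- `n = n(ξ, η)` for `n ∈ N`. -/
theorem nOf_xiOf_etaOf {n : Module.End K V} (hn : n ∈ D.N) :
    D.nOf (D.xiOf n) (D.etaOf n) = n := by
  refine hD.linearMap_ext (fun w hw => ?_) (fun x hx => ?_) (fun w' hw' => ?_)
  · rw [nOf_apply_W hD _ _ hw, hn.2.1 w hw]
  · rw [nOf_apply_X hD _ _ ⟨x, hx⟩]
    exact (apply_eq_add_xiOf hD hn ⟨x, hx⟩).symm
  · rw [nOf_apply_W' hD _ _ ⟨w', hw'⟩, xiStar_xiOf hD hn, Submodule.coe_neg, sub_neg_eq_add]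
    exact (apply_eq_add_etaOf hD hn ⟨w', hw'⟩).symm

theorem xiOf_nOf (ξ : D.X →ₗ[K] D.W) (η : D.W' →ₗ[K] D.W) : D.xiOf (D.nOf ξ η) = ξ := by
  ext x
  change (D.projW (D.nOf ξ η x) : V) = _
  rw [nOf_apply_X hD, map_add, hD.projW_of_mem_X x.2, zero_add, hD.projW_coe]

theorem etaOf_nOf (ξ : D.X →ₗ[K] D.W) (η : D.W' →ₗ[K] D.W) : D.etaOf (D.nOf ξ η) = η := by
  ext x
  change (D.projW (D.nOf ξ η x) : V) = _
  rw [nOf_apply_W' hD, map_add, map_sub, hD.projW_of_mem_W' x.2,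
    hD.projW_of_mem_X (D.xiStar ξ x).2, hD.projW_coe]
  simp

/-- The hypothesis is `η + η* + ξξ* = 0` tested on `W'`. It is the `W' × W'` block of the isometry
condition; the `X × W'` blocks hold by the definition of `ξ*`, and the other blocks are immediate.
-/
theorem nOf_mem_N (ξ : D.X →ₗ[K] D.W) (η : D.W' →ₗ[K] D.W)
    (h : ∀ u w : D.W', D.Φ (η u) w + D.Φ u (η w) + D.Φ (D.xiStar ξ u) (D.xiStar ξ w) = 0) :
    D.nOf ξ η ∈ D.N := by
  refine ⟨?_, fun w hw => nOf_apply_W hD ξ η hw, fun x hx => ?_, fun w' hw' => ?_⟩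
  · intro v₁ v₂
    obtain ⟨w, hw, x, hx, w', hw', rfl⟩ := hD.exists_decomposition v₁
    obtain ⟨u, hu, y, hy, u', hu', rfl⟩ := hD.exists_decomposition v₂
    lift w' to D.W' using hw'
    lift u' to D.W' using hu'
    lift x to D.X using hx
    lift y to D.X using hy
    have h1 := h w' u'
    have h2 := hD.xiStar_apply ξ w' y
    have h3 := hD.xiStar_apply' ξ u' x
    simp only [map_add, nOf_apply_W hD _ _ hw, nOf_apply_W hD _ _ hu, nOf_apply_X hD,
      nOf_apply_W' hD, LinearMap.add_apply, map_sub, LinearMap.sub_apply,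
      IsOrthogonal.apply_W'_X (Subtype.mem _) (Subtype.mem _),
      IsOrthogonal.apply_W_X (Subtype.mem (ξ _)) (Subtype.mem _),
      IsOrthogonal.apply_W_X (Subtype.mem (η _)) (Subtype.mem _),
      hD.apply_X_W' (Subtype.mem _) (Subtype.mem _),
      hD.apply_X_W (Subtype.mem (ξ _)) (Subtype.mem _),
      hD.apply_X_W (Subtype.mem (η _)) (Subtype.mem _),
      IsOrthogonal.apply_W_X hw (Subtype.mem _), hD.apply_X_W hu (Subtype.mem _),
      hD.isotropic _ hw _ hu, hD.isotropic _ hw _ (Subtype.mem _),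
      hD.isotropic _ (Subtype.mem _) _ hu,
      hD.isotropic _ (Subtype.mem (ξ _)) _ (Subtype.mem _),
      hD.isotropic _ (Subtype.mem (η _)) _ (Subtype.mem _),
      hD.isotropic' _ (Subtype.mem _) _ (Subtype.mem _)]
    linear_combination h1 - h2 - h3
  · rw [nOf_apply_X hD _ _ ⟨x, hx⟩]
    simp
  · rw [nOf_apply_W' hD _ _ ⟨w', hw'⟩, sub_add, sub_sub_cancel_left, neg_sub]
    rw [sub_eq_add_neg, add_comm]
    exact Submodule.add_mem_sup (neg_mem (Subtype.mem _)) (Subtype.mem _)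

/-! ### The norm -/

theorem norm_apply_W (n : Module.End K V) {w : V} (hw : w ∈ D.W) : D.norm n w = w := by
  simp [norm, hD.projX_of_mem_W hw]

theorem norm_apply_W' (n : Module.End K V) {w : V} (hw : w ∈ D.W') : D.norm n w = w := by
  simp [norm, hD.projX_of_mem_W' hw]

theorem norm_apply_X (n : Module.End K V) (x : D.X) :
    D.norm n x = x + D.xiStar (D.xiOf n) (linInv (D.etaOf n) (D.xiOf n x)) := by
  simp [norm, hD.projX_coe]

theorem norm_mem_X (n : Module.End K V) {x : V} (hx : x ∈ D.X) : D.norm n x ∈ D.X := by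
  rw [norm_apply_X hD n ⟨x, hx⟩]
  exact add_mem hx (Subtype.mem _)

/-- For `w' = η⁻¹ξx` the `W`-components of `n x` and `n w'` cancel. Together with the uniqueness in
`eq_norm_of_relation` this describes the norm by a relation that is visibly compatible with
isometries, conjugation and extension of scalars. -/
theorem norm_relation {n : Module.End K V} (hn : n ∈ D.N') {x : V} (hx : x ∈ D.X) :
    ∃ w' ∈ D.W', n (x - w') = D.norm n x - w' := by
  lift x to D.X using hx
  refine ⟨_, (linInv (D.etaOf n) (D.xiOf n x)).2, ?_⟩
  rw [norm_apply_X hD, map_sub, apply_eq_add_xiOf hD hn.1, apply_eq_add_etaOf hD hn.1,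
    apply_linInv hn.2, xiStar_xiOf hD hn.1, Submodule.coe_neg]
  abel

/-- Two solutions differ by an element of `W'` killed by `η`, hence by zero. -/
theorem eq_norm_of_relation {n : Module.End K V} (hn : n ∈ D.N') {x y w' : V} (hx : x ∈ D.X)
    (hy : y ∈ D.X) (hw' : w' ∈ D.W') (h : n (x - w') = y - w') : y = D.norm n x := by
  obtain ⟨u, hu, hu'⟩ := norm_relation hD hn hx
  have h1 : n (w' - u) = (w' - u) + (D.norm n x - y) := by
    have : w' - u = (x - u) - (x - w') := by abel
    rw [this, map_sub, h, hu']; abel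
  have h2 : D.etaOf n ⟨w' - u, sub_mem hw' hu⟩ = 0 := by
    change D.projW (n (w' - u)) = 0
    rw [h1, map_add, hD.projW_of_mem_W' (sub_mem hw' hu),
      hD.projW_of_mem_X (sub_mem (norm_mem_X hD n hx) hy), add_zero]
  have h3 : w' - u = 0 :=
    congrArg Subtype.val ((injective_iff_map_eq_zero _).1 hn.2.1 _ h2)
  rw [h3, map_zero, zero_add] at h1
  exact (sub_eq_zero.1 h1.symm).symm

theorem eq_norm {n a : Module.End K V} (hn : n ∈ D.N') (hW : ∀ w ∈ D.W, a w = w)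
    (hW' : ∀ w ∈ D.W', a w = w) (hX : ∀ x ∈ D.X, a x ∈ D.X ∧ ∃ w' ∈ D.W', n (x - w') = a x - w') :
    a = D.norm n := by
  refine hD.linearMap_ext (fun w hw => ?_) (fun x hx => ?_) (fun w hw => ?_)
  · rw [hW w hw, norm_apply_W hD n hw]
  · obtain ⟨h, w', hw', e⟩ := hX x hx
    exact eq_norm_of_relation hD hn hx h hw' e
  · rw [hW' w hw, norm_apply_W' hD n hw]

/-- Apply `n` to the pair `x - u`, `y - w` of the norm relation: since `W'` is isotropic and
orthogonal to `X`, only the `X`-parts contribute on either side. -/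
theorem norm_isometry_X {n : Module.End K V} (hn : n ∈ D.N') {x y : V} (hx : x ∈ D.X)
    (hy : y ∈ D.X) : D.Φ (D.norm n x) (D.norm n y) = D.Φ x y := by
  obtain ⟨u, hu, hu'⟩ := norm_relation hD hn hx
  obtain ⟨w, hw, hw'⟩ := norm_relation hD hn hy
  have h := hn.1.1 (x - u) (y - w)
  rw [hu', hw'] at h
  simp only [map_sub, LinearMap.sub_apply, hD.isotropic' _ hu _ hw,
    IsOrthogonal.apply_W'_X hu hy, hD.apply_X_W' hw hx,
    IsOrthogonal.apply_W'_X hu (norm_mem_X hD n hy), hD.apply_X_W' hw (norm_mem_X hD n hx)] at h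
  simpa using h

/-- Elements of `N'` are determined by their norm and `ξ`, if `ξ` is surjective. -/
theorem eq_of_norm_eq {n₁ n₂ : Module.End K V} (h₁ : n₁ ∈ D.N') (h₂ : n₂ ∈ D.N')
    (hξ : D.xiOf n₁ = D.xiOf n₂) (hsurj : Function.Surjective (D.xiOf n₁))
    (hnorm : D.norm n₁ = D.norm n₂) : n₁ = n₂ := by
  -- The adjoint of a surjective `ξ` is injective, by the perfect pairing of `W` and `W'`.
  have hinj : ∀ w' : D.W', D.xiStar (D.xiOf n₁) w' = 0 → w' = 0 := by
    intro w' hw'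
    refine Subtype.ext (hD.eq_zero_of_mem_W' w'.2 fun w hw => ?_)
    obtain ⟨x, hx⟩ := hsurj ⟨w, hw⟩
    have := hD.xiStar_apply' (D.xiOf n₁) w' x
    rw [hw', hx] at this
    simpa using this.symm
  -- From `ξ*η₁⁻¹ξ = ξ*η₂⁻¹ξ`, cancel `ξ*` on the left and `ξ` on the right.
  have hη : linInv (D.etaOf n₁) = linInv (D.etaOf n₂) := by
    refine LinearMap.ext fun w => ?_
    obtain ⟨x, rfl⟩ := hsurj w
    have := LinearMap.congr_fun hnorm x
    rw [norm_apply_X hD, norm_apply_X hD, ← hξ, add_right_inj] at this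
    rw [← sub_eq_zero]
    exact hinj _ (by rw [map_sub, sub_eq_zero]; exact Subtype.ext this)
  have hη' : D.etaOf n₁ = D.etaOf n₂ := by
    refine LinearMap.ext fun w => ?_
    obtain ⟨v, rfl⟩ := (linInv_bijective h₁.2).2 w
    rw [apply_linInv h₁.2, hη, apply_linInv h₂.2]
  rw [← nOf_xiOf_etaOf hD h₁.1, ← nOf_xiOf_etaOf hD h₂.1, hξ, hη']

end UnipotentRadical

end Datum

end

end OddNorm

namespace OddNorm

noncomputable section

namespace Datum

/-! ### The action of the Levi subgroup -/

section Levi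

variable {K V : Type*} [Field K] [AddCommGroup V] [Module K V] [FiniteDimensional K V]
  {D : Datum K V}

omit [FiniteDimensional K V] in
theorem M_mem_W {m : V ≃ₗ[K] V} (hm : m ∈ D.M) {w : V} (hw : w ∈ D.W) : m w ∈ D.W :=
  hm.2.1 ▸ Submodule.mem_map_of_mem hw

omit [FiniteDimensional K V] in
theorem M_mem_W' {m : V ≃ₗ[K] V} (hm : m ∈ D.M) {w : V} (hw : w ∈ D.W') : m w ∈ D.W' :=
  hm.2.2 ▸ Submodule.mem_map_of_mem hw

omit [FiniteDimensional K V] in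
theorem M_symm_mem_W {m : V ≃ₗ[K] V} (hm : m ∈ D.M) {w : V} (hw : w ∈ D.W) : m.symm w ∈ D.W :=
  M_mem_W (inv_mem hm) hw

omit [FiniteDimensional K V] in
theorem M_symm_mem_W' {m : V ≃ₗ[K] V} (hm : m ∈ D.M) {w : V} (hw : w ∈ D.W') :
    m.symm w ∈ D.W' :=
  M_mem_W' (inv_mem hm) hw

omit [FiniteDimensional K V] in
theorem M_mem_X {m : V ≃ₗ[K] V} (hm : m ∈ D.M) {x : V} (hx : x ∈ D.X) : m x ∈ D.X := by
  intro u hu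
  obtain ⟨w, hw, w', hw', rfl⟩ := Submodule.mem_sup.1 hu
  have h := hx (m.symm w + m.symm w')
    (Submodule.add_mem_sup (M_symm_mem_W hm hw) (M_symm_mem_W' hm hw'))
  have h2 := hm.1 (m.symm w + m.symm w') x
  rw [map_add, m.apply_symm_apply, m.apply_symm_apply] at h2
  exact h2.trans h

omit [FiniteDimensional K V] in
theorem M_symm_mem_X {m : V ≃ₗ[K] V} (hm : m ∈ D.M) {x : V} (hx : x ∈ D.X) : m.symm x ∈ D.X :=
  M_mem_X (inv_mem hm) hx

omit [FiniteDimensional K V] in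
theorem symm_isometry {m : V ≃ₗ[K] V} (hm : m ∈ D.isom) (v w : V) :
    D.Φ (m.symm v) (m.symm w) = D.Φ v w :=
  (inv_mem hm : m⁻¹ ∈ D.isom) v w

theorem mem_M_of_mem_H {h : V ≃ₗ[K] V} (hh : h ∈ D.H) : h ∈ D.M := by
  refine ⟨hh.1, ?_, ?_⟩
  · ext v
    refine ⟨?_, fun hv => ⟨v, hv, hh.2 v (Submodule.mem_sup_left hv)⟩⟩
    rintro ⟨w, hw, rfl⟩
    exact (hh.2 w (Submodule.mem_sup_left hw)).symm ▸ hw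
  · ext v
    refine ⟨?_, fun hv => ⟨v, hv, hh.2 v (Submodule.mem_sup_right hv)⟩⟩
    rintro ⟨w, hw, rfl⟩
    exact (hh.2 w (Submodule.mem_sup_right hw)).symm ▸ hw

variable (hD : D.IsOrthogonal)
include hD

/-- The kernel of `η` consists of the `w'` with `n w' - w' ∈ X`, a description without projections
that `M` visibly preserves. Injectivity suffices since `dim W' = dim W`. -/
theorem mem_N'_iff {n : Module.End K V} :
    n ∈ D.N' ↔ n ∈ D.N ∧ ∀ w' ∈ D.W', n w' - w' ∈ D.X → w' = 0 := by
  refine and_congr_right fun hn => ?_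
  have key : ∀ w' : D.W', D.etaOf n w' = 0 ↔ n w' - w' ∈ D.X := by
    intro w'
    have h := apply_eq_add_etaOf hD hn w'
    constructor
    · intro h0
      rw [h0, ZeroMemClass.coe_zero, add_zero] at h
      rw [h, add_sub_cancel_left]
      exact Subtype.mem _
    · intro h0
      change D.projW (n w') = 0
      have : D.projW (n w' - w') = 0 := hD.projW_of_mem_X h0
      rwa [map_sub, hD.projW_of_mem_W' w'.2, sub_zero] at this
  constructor
  · intro h w' hw' h0
    exact congrArg Subtype.val ((injective_iff_map_eq_zero _).1 h.1 ⟨w', hw'⟩ ((key _).2 h0))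
  · intro h
    have hinj : Function.Injective (D.etaOf n) := by
      rw [injective_iff_map_eq_zero]
      exact fun w' h0 => Subtype.ext (h w' w'.2 ((key w').1 h0))
    exact ⟨hinj, (LinearMap.injective_iff_surjective_of_finrank_eq_finrank hD.finrank_W').1 hinj⟩

theorem conj_mem_N {m : V ≃ₗ[K] V} (hm : m ∈ D.M) {n : Module.End K V} (hn : n ∈ D.N) :
    m.conj n ∈ D.N := by
  refine ⟨fun v w => ?_, fun w hw => ?_, fun x hx => ?_, fun w' hw' => ?_⟩
  · simp only [LinearEquiv.conj_apply_apply]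
    rw [hm.1, hn.1, symm_isometry hm.1]
  · rw [LinearEquiv.conj_apply_apply, hn.2.1 _ (M_symm_mem_W hm hw), m.apply_symm_apply]
  · have := M_mem_W hm (hn.2.2.1 _ (M_symm_mem_X hm hx))
    rwa [map_sub, m.apply_symm_apply] at this
  · obtain ⟨x, hx, w, hw, h⟩ := Submodule.mem_sup.1 (hn.2.2.2 _ (M_symm_mem_W' hm hw'))
    have h2 := congrArg m h
    rw [map_sub, m.apply_symm_apply, map_add] at h2
    rw [LinearEquiv.conj_apply_apply, ← h2]
    exact Submodule.add_mem_sup (M_mem_X hm hx) (M_mem_W hm hw)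

theorem conj_mem_N' {m : V ≃ₗ[K] V} (hm : m ∈ D.M) {n : Module.End K V} (hn : n ∈ D.N') :
    m.conj n ∈ D.N' := by
  rw [mem_N'_iff hD] at hn ⊢
  refine ⟨conj_mem_N hD hm hn.1, fun w' hw' h => ?_⟩
  rw [LinearEquiv.conj_apply_apply] at h
  have h2 := hn.2 _ (M_symm_mem_W' hm hw') (by
    have := M_symm_mem_X hm h
    rwa [map_sub, m.symm_apply_apply] at this)
  exact m.symm.map_eq_zero_iff.1 h2

/-- `m` preserves `X` and `W'`, so it carries the norm relation of `n` to that of its conjugate. -/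
theorem norm_conj_apply {m : V ≃ₗ[K] V} (hm : m ∈ D.M) {n : Module.End K V} (hn : n ∈ D.N')
    {x : V} (hx : x ∈ D.X) : D.norm (m.conj n) (m x) = m (D.norm n x) := by
  obtain ⟨w', hw', h⟩ := norm_relation hD hn hx
  refine (eq_norm_of_relation hD (conj_mem_N' hD hm hn) (M_mem_X hm hx)
    (M_mem_X hm (norm_mem_X hD n hx)) (M_mem_W' hm hw') ?_).symm
  rw [LinearEquiv.conj_apply_apply, ← map_sub, m.symm_apply_apply, h, map_sub]

/-- The norm sees only the action of `m` on `X`. With `h = 1` this says that the factor `GL(W)` of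
`M` does not change norms. -/
theorem norm_conj_eq {m h : V ≃ₗ[K] V} (hm : m ∈ D.M) (hh : h ∈ D.H) (hX : ∀ x ∈ D.X, h x = m x)
    {n : Module.End K V} (hn : n ∈ D.N') : D.norm (m.conj n) = h.conj (D.norm n) := by
  have hW : ∀ u ∈ D.W ⊔ D.W', h.symm u = u := fun u hu => (inv_mem hh).2 u hu
  refine hD.linearMap_ext (fun w hw => ?_) (fun x hx => ?_) (fun w hw => ?_)
  · rw [norm_apply_W hD _ hw, LinearEquiv.conj_apply_apply, hW w (Submodule.mem_sup_left hw),
      norm_apply_W hD _ hw, hh.2 w (Submodule.mem_sup_left hw)]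
  · obtain ⟨y, hy, rfl⟩ : ∃ y ∈ D.X, h y = x :=
      ⟨h.symm x, M_symm_mem_X (mem_M_of_mem_H hh) hx, h.apply_symm_apply x⟩
    rw [LinearEquiv.conj_apply_apply, h.symm_apply_apply, hX y hy, norm_conj_apply hD hm hn hy,
      hX _ (norm_mem_X hD n hy)]
  · rw [norm_apply_W' hD _ hw, LinearEquiv.conj_apply_apply, hW w (Submodule.mem_sup_right hw),
      norm_apply_W' hD _ hw, hh.2 w (Submodule.mem_sup_right hw)]

theorem norm_conj_H {h : V ≃ₗ[K] V} (hh : h ∈ D.H) {n : Module.End K V} (hn : n ∈ D.N') :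
    D.norm (h.conj n) = h.conj (D.norm n) :=
  norm_conj_eq hD (mem_M_of_mem_H hh) hh (fun _ _ => rfl) hn

/-- The component in `H` of an element of `M`. -/
theorem exists_mem_H_eq {m : V ≃ₗ[K] V} (hm : m ∈ D.M) :
    ∃ h ∈ D.H, ∀ x ∈ D.X, h x = m x := by
  obtain ⟨u, h1, h2, h3⟩ := exists_isometry_of_map_le hD.symm hD.nondegenerate
    hD.restrict_X_nondegenerate (m : V →ₗ[K] V) hm.1 (fun a ha => M_mem_X hm ha)
  rw [hD.orthogonal_X] at h3
  exact ⟨u, ⟨h1, h3⟩, h2⟩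

/-- `GL(W)` embeds into `M`. -/
theorem exists_mem_M_of_equiv (g : D.W ≃ₗ[K] D.W) :
    ∃ m ∈ D.M, (∀ w : D.W, m w = g w) ∧ ∀ x ∈ D.X, m x = x := by
  let P : D.W' ≃ₗ[K] Module.Dual K D.W := LinearEquiv.ofBijective _ hD.pairing_bijective.1
  have hP : ∀ (w' : D.W') (w : D.W), P w' w = D.Φ w' w := fun _ _ => rfl
  -- The contragredient of `g` under `W' ≅ W*`, the only choice on `W'` that preserves the pairing.
  let g' : D.W' ≃ₗ[K] D.W' := P ≪≫ₗ g.symm.dualMap ≪≫ₗ P.symm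
  have hg' : ∀ (w' : D.W') (w : D.W), D.Φ (g' w') (g w) = D.Φ w' w := by
    intro w' w
    rw [← hP]
    have : P (g' w') = g.symm.dualMap (P w') := P.apply_symm_apply _
    rw [this, LinearEquiv.dualMap_apply, g.symm_apply_apply, hP]
  let e : (D.W ⊔ D.W' : Submodule K V) →ₗ[K] V :=
    (D.W.subtype ∘ₗ (g : D.W →ₗ[K] D.W) ∘ₗ D.projW +
      D.W'.subtype ∘ₗ (g' : D.W' →ₗ[K] D.W') ∘ₗ D.projW') ∘ₗ (D.W ⊔ D.W').subtype
  have heW : ∀ (w : D.W) (w' : D.W') (h : (w : V) + w' ∈ D.W ⊔ D.W'),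
      e ⟨w + w', h⟩ = g w + g' w' := by
    intro w w' h
    simp [e, hD.projW_coe, hD.projW'_coe, hD.projW_of_mem_W' w'.2, hD.projW'_of_mem_W w.2]
  have hdec : ∀ u : (D.W ⊔ D.W' : Submodule K V), ∃ (w : D.W) (w' : D.W'),
      ∃ h : (w : V) + w' ∈ D.W ⊔ D.W', u = ⟨w + w', h⟩ := by
    rintro ⟨u, hu⟩
    obtain ⟨w, hw, w', hw', rfl⟩ := Submodule.mem_sup.1 hu
    exact ⟨⟨w, hw⟩, ⟨w', hw'⟩, hu, rfl⟩
  obtain ⟨m, h1, h2, h3⟩ := exists_isometry_of_linearMap hD.symm hD.nondegenerate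
    hD.nondegenerate_sup e (fun u => by
      obtain ⟨w, w', h, rfl⟩ := hdec u
      rw [heW]
      exact Submodule.add_mem_sup (Subtype.mem _) (Subtype.mem _)) (fun u v => by
      obtain ⟨w, w', h, rfl⟩ := hdec u
      obtain ⟨v, v', h', rfl⟩ := hdec v
      rw [heW, heW]
      have e1 := hg' w' v
      have e2 := hg' v' w
      rw [hD.comm, hD.comm v'] at e2
      simp only [map_add, LinearMap.add_apply, hD.isotropic _ (Subtype.mem _) _ (Subtype.mem _),
        hD.isotropic' _ (Subtype.mem _) _ (Subtype.mem _), e1, e2])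
  have hmW : ∀ w : D.W, m w = g w := by
    intro w
    have h0 : (w : V) + (0 : D.W') ∈ D.W ⊔ D.W' := Submodule.add_mem_sup w.2 (zero_mem _)
    have := (h2 ⟨_, h0⟩).trans (heW w 0 h0)
    simpa using this
  have hmW' : ∀ w : D.W', m w = g' w := by
    intro w
    have h0 : ((0 : D.W) : V) + w ∈ D.W ⊔ D.W' := Submodule.add_mem_sup (zero_mem _) w.2
    have := (h2 ⟨_, h0⟩).trans (heW 0 w h0)
    simpa using this
  refine ⟨m, ⟨h1, ?_, ?_⟩, hmW, h3⟩
  · ext v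
    constructor
    · rintro ⟨w, hw, rfl⟩
      exact (hmW ⟨w, hw⟩).symm ▸ Subtype.mem _
    · intro hv
      exact ⟨g.symm ⟨v, hv⟩, Subtype.mem _, by
        change m _ = _
        rw [hmW, g.apply_symm_apply]⟩
  · ext v
    constructor
    · rintro ⟨w, hw, rfl⟩
      exact (hmW' ⟨w, hw⟩).symm ▸ Subtype.mem _
    · intro hv
      exact ⟨g'.symm ⟨v, hv⟩, Subtype.mem _, by
        change m _ = _
        rw [hmW', g'.apply_symm_apply]⟩

end Levi

end Datum

end

end OddNorm

namespace OddNorm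

noncomputable section

namespace Datum

/-! ### The elements `n_Y(a)` and the fibres of the norm -/

section Sections

variable {K V : Type*} [Field K] [AddCommGroup V] [Module K V] [FiniteDimensional K V]
  {D : Datum K V} (hD : D.IsOrthogonal) {Y : Submodule K V}
include hD

theorem isCompl_of_isNondegSub (hY : D.IsNondegSub Y) : IsCompl Y (D.Φ.orthogonal Y) :=
  isCompl_orthogonal hD.symm hY.2.1

theorem orthogonal_orthogonal (Y : Submodule K V) : D.Φ.orthogonal (D.Φ.orthogonal Y) = Y :=
  LinearMap.BilinForm.orthogonal_orthogonal hD.nondegenerate hD.symm.isRefl Y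

theorem sup_le_orthogonal (hY : D.IsNondegSub Y) : D.W ⊔ D.W' ≤ D.Φ.orthogonal Y := by
  intro u hu y hy
  exact (hD.comm _ _).trans (hY.1 hy u hu)

theorem HY_le_H (hY : D.IsNondegSub Y) : D.HY Y ≤ D.H :=
  fun _ hg => ⟨hg.1, fun v hv => hg.2 v (sup_le_orthogonal hD hY hv)⟩

theorem HY_mem {g : V ≃ₗ[K] V} (hg : g ∈ D.HY Y) {y : V} (hy : y ∈ Y) : g y ∈ Y := by
  rw [← orthogonal_orthogonal hD Y] at hy ⊢
  exact map_mem_orthogonal hg.1 hg.2 hy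

theorem eps_apply_of_mem (hY : D.IsNondegSub Y) {y : V} (hy : y ∈ Y) : D.eps Y y = -y := by
  have hc := isCompl_of_isNondegSub hD hY
  simp [eps, proj_of_mem_left hc hy, proj_of_mem_right hc.symm hy]

theorem eps_apply_of_mem_orthogonal (hY : D.IsNondegSub Y) {y : V} (hy : y ∈ D.Φ.orthogonal Y) :
    D.eps Y y = y := by
  have hc := isCompl_of_isNondegSub hD hY
  simp [eps, proj_of_mem_left hc.symm hy, proj_of_mem_right hc hy]

theorem linearMap_ext_of_isNondegSub (hY : D.IsNondegSub Y) {E : Type*} [AddCommGroup E]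
    [Module K E] {f g : V →ₗ[K] E} (h1 : ∀ y ∈ Y, f y = g y)
    (h2 : ∀ y ∈ D.Φ.orthogonal Y, f y = g y) : f = g := by
  ext v
  rw [← proj_add_proj (isCompl_of_isNondegSub hD hY) v, map_add, map_add, h1 _ (Subtype.mem _),
    h2 _ (Subtype.mem _)]

theorem eps_mul_eps (hY : D.IsNondegSub Y) : D.eps Y * D.eps Y = 1 := by
  refine linearMap_ext_of_isNondegSub hD hY (fun y hy => ?_) fun y hy => ?_
  · simp [eps_apply_of_mem hD hY hy]
  · simp [eps_apply_of_mem_orthogonal hD hY hy]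

theorem eps_isometry (hY : D.IsNondegSub Y) (v w : V) :
    D.Φ (D.eps Y v) (D.eps Y w) = D.Φ v w := by
  have hc := isCompl_of_isNondegSub hD hY
  have he : ∀ v, D.eps Y v = -(proj Y (D.Φ.orthogonal Y) v : V) + proj (D.Φ.orthogonal Y) Y v := by
    intro v
    conv_lhs => rw [← proj_add_proj hc v]
    rw [map_add, eps_apply_of_mem hD hY (Subtype.mem _),
      eps_apply_of_mem_orthogonal hD hY (Subtype.mem _)]
  conv_rhs => rw [← proj_add_proj hc v, ← proj_add_proj hc w]
  rw [he, he, apply_of_decomposition hD.symm (neg_mem (Subtype.mem _)) (neg_mem (Subtype.mem _))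
      (Subtype.mem _) (Subtype.mem _),
    apply_of_decomposition hD.symm (Subtype.mem _) (Subtype.mem _) (Subtype.mem _) (Subtype.mem _)]
  simp

/-- `a` is an isometry, is the identity on `Y^⊥`, and `a - 1` is invertible on `Y`. -/
structure IsNormOn (D : Datum K V) (Y : Submodule K V) (a : Module.End K V) : Prop where
  isometry : ∀ v w, D.Φ (a v) (a w) = D.Φ v w
  fix : ∀ z ∈ D.Φ.orthogonal Y, a z = z
  bijOn : Set.BijOn (a - 1 : Module.End K V) (Y : Set V) (Y : Set V)

theorem isNormOn_eps_mul (hY : D.IsNondegSub Y) {γ : V ≃ₗ[K] V} (hγ : γ ∈ D.HY Y)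
    (h : Set.BijOn (D.eps Y * (γ : Module.End K V) - 1 : Module.End K V) (Y : Set V) (Y : Set V)) :
    IsNormOn D Y (D.eps Y * (γ : Module.End K V)) := by
  refine ⟨fun v w => ?_, fun z hz => ?_, h⟩
  · exact (eps_isometry hD hY _ _).trans (hγ.1 v w)
  · change D.eps Y (γ z) = z
    rw [hγ.2 z hz, eps_apply_of_mem_orthogonal hD hY hz]

omit hD [FiniteDimensional K V] in
theorem IsNormOn.conj {a : Module.End K V} (ha : IsNormOn D Y a) {h : V ≃ₗ[K] V}
    (hh : h ∈ D.isom) : IsNormOn D (Y.map (h : V →ₗ[K] V)) (h.conj a) := by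
  refine ⟨fun v w => ?_, fun z hz => ?_, ?_⟩
  · rw [LinearEquiv.conj_apply_apply, LinearEquiv.conj_apply_apply, hh, ha.isometry,
      symm_isometry hh]
  · rw [LinearEquiv.conj_apply_apply, ha.fix, h.apply_symm_apply]
    intro y hy
    have := hz (h y) ⟨y, hy, rfl⟩
    rw [← h.apply_symm_apply z] at this
    exact (hh _ _).symm.trans this
  · have e : ∀ y, (h.conj a - 1 : Module.End K V) (h y) = h ((a - 1 : Module.End K V) y) := by
      intro y
      simp [LinearEquiv.conj_apply_apply]
    refine ⟨?_, ?_, ?_⟩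
    · rintro _ ⟨y, hy, rfl⟩
      exact ⟨_, ha.bijOn.mapsTo hy, (e y).symm⟩
    · rintro _ ⟨y, hy, rfl⟩ _ ⟨z, hz, rfl⟩ hyz
      have hyz : (h.conj a - 1 : Module.End K V) (h y) = (h.conj a - 1 : Module.End K V) (h z) := hyz
      rw [e, e] at hyz
      exact congrArg h (ha.bijOn.injOn hy hz (h.injective hyz))
    · rintro _ ⟨y, hy, rfl⟩
      obtain ⟨z, hz, rfl⟩ := ha.bijOn.surjOn hy
      exact ⟨h z, ⟨z, hz, rfl⟩, e z⟩

theorem IsNondegSub.map_H (hY : D.IsNondegSub Y) {h : V ≃ₗ[K] V} (hh : h ∈ D.H) :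
    D.IsNondegSub (Y.map (h : V →ₗ[K] V)) := by
  refine ⟨?_, ?_, ?_⟩
  · rintro _ ⟨y, hy, rfl⟩
    exact map_mem_orthogonal hh.1 hh.2 (hY.1 hy)
  · let e : Y ≃ₗ[K] Y.map (h : V →ₗ[K] V) := h.submoduleMap Y
    refine (LinearMap.BilinForm.nondegenerate_congr_iff (B := D.Φ.restrict Y) e).2 hY.2.1 |>.imp
      (fun H => ?_) fun H => ?_
    all_goals
      convert H using 1
      refine LinearMap.ext fun y => LinearMap.ext fun z => ?_
      obtain ⟨y, rfl⟩ := e.surjective y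
      obtain ⟨z, rfl⟩ := e.surjective z
      rw [LinearMap.BilinForm.congr_apply, e.symm_apply_apply, e.symm_apply_apply]
      exact hh.1 y z
  · rw [← hY.2.2]
    exact (h.submoduleMap Y).finrank_eq.symm

/-- If the norm of `n` is supported on `Y`, then `ξ` maps `Y` onto `W`, with kernel `Y^⊥`. -/
theorem IsNormOn.xiOf {n : Module.End K V} (hY : D.IsNondegSub Y)
    (h : IsNormOn D Y (D.norm n)) :
    (∀ x : D.X, D.xiOf n x = 0 ↔ (x : V) ∈ D.Φ.orthogonal Y) ∧
      (∀ w : D.W, ∃ y : D.X, (y : V) ∈ Y ∧ D.xiOf n y = w) ∧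
      (D.X.subtype ∘ₗ D.xiStar (D.xiOf n)).range = Y := by
  -- On `X`, `Norm - 1 = ξ*η⁻¹ξ` takes values in the image of `ξ*`, so `Y` lies in that image; the
  -- latter has dimension at most `k = dim Y`.
  have hle : Y ≤ (D.X.subtype ∘ₗ D.xiStar (D.xiOf n)).range := by
    intro y hy
    obtain ⟨x, hx, rfl⟩ := h.bijOn.surjOn hy
    have := norm_apply_X hD n ⟨x, hY.1 hx⟩
    refine ⟨_, (sub_eq_iff_eq_add'.2 this).symm⟩
  have hr : (D.X.subtype ∘ₗ D.xiStar (D.xiOf n)).range = Y := by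
    refine (Submodule.eq_of_le_of_finrank_le hle ?_).symm
    rw [hY.2.2, ← hD.finrank_W']
    exact LinearMap.finrank_range_le _
  have hker : ∀ x : D.X, D.xiOf n x = 0 ↔ (x : V) ∈ D.Φ.orthogonal Y := by
    intro x
    constructor
    · intro h0 y hy
      rw [← hr] at hy
      obtain ⟨w', rfl⟩ := hy
      exact (hD.xiStar_apply (D.xiOf n) w' x).trans (by rw [h0]; simp)
    · intro h0
      refine Subtype.ext (hD.eq_zero_of_mem_W (Subtype.mem _) fun w' hw' => ?_)
      rw [← hD.xiStar_apply' (D.xiOf n) ⟨w', hw'⟩ x, hD.comm]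
      exact h0 _ (hr ▸ ⟨⟨w', hw'⟩, rfl⟩)
  refine ⟨hker, ?_, hr⟩
  let f : Y →ₗ[K] D.W := D.xiOf n ∘ₗ Submodule.inclusion hY.1
  have hf : Function.Injective f := by
    rw [injective_iff_map_eq_zero]
    intro y h0
    have := (hker ⟨y, hY.1 y.2⟩).1 h0
    exact Subtype.ext
      (Submodule.disjoint_def.1 (isCompl_of_isNondegSub hD hY).disjoint y y.2 this)
  have hf' := (LinearMap.injective_iff_surjective_of_finrank_eq_finrank hY.2.2).1 hf
  intro w
  obtain ⟨y, rfl⟩ := hf' w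
  exact ⟨_, y.2, rfl⟩

section nY

variable (hY : D.IsNondegSub Y) {ξ : Y →ₗ[K] D.W} (hξ : Function.Bijective ξ)
include hY hξ

omit hξ in
theorem extend_apply_of_mem {y : V} (hy : y ∈ Y) :
    D.extend Y ξ ⟨y, hY.1 hy⟩ = ξ ⟨y, hy⟩ := by
  have h1 : proj Y (D.Φ.orthogonal Y) y = ⟨y, hy⟩ :=
    Subtype.ext (proj_of_mem_left (isCompl_of_isNondegSub hD hY) hy)
  simp [extend, h1]

theorem extend_eq_zero_iff (x : D.X) : D.extend Y ξ x = 0 ↔ (x : V) ∈ D.Φ.orthogonal Y := by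
  have hc := isCompl_of_isNondegSub hD hY
  change ξ (proj Y (D.Φ.orthogonal Y) (x : V)) = 0 ↔ _
  rw [map_eq_zero_iff ξ hξ.1]
  constructor
  · intro h
    rw [← proj_add_proj hc x, h]
    simp
  · exact fun h => proj_of_mem_right hc h

theorem extend_surjective (w : D.W) : ∃ y : D.X, (y : V) ∈ Y ∧ D.extend Y ξ y = w := by
  obtain ⟨y, rfl⟩ := hξ.2 w
  exact ⟨⟨y, hY.1 y.2⟩, y.2, extend_apply_of_mem hD hY y.2⟩

/-- `ξ* w'` is orthogonal to `W + W'` and to the kernel `X ∩ Y^⊥` of `ξ`, hence to `Y^⊥`. -/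
theorem xiStar_extend_mem (w' : D.W') : (D.xiStar (D.extend Y ξ) w' : V) ∈ Y := by
  refine (orthogonal_orthogonal hD Y).le fun v hv => ?_
  obtain ⟨u, hu, x, hx, rfl⟩ : ∃ u ∈ D.W ⊔ D.W', ∃ x ∈ D.X, u + x = v :=
    Submodule.mem_sup.1 (hD.isCompl_sup_X.sup_eq_top ▸ Submodule.mem_top)
  have hx' : x ∈ D.Φ.orthogonal Y :=
    (Submodule.add_mem_iff_right _ (sup_le_orthogonal hD hY hu)).1 hv
  have h1 := hD.xiStar_apply' (D.extend Y ξ) w' ⟨x, hx⟩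
  rw [(extend_eq_zero_iff hD hY hξ ⟨x, hx⟩).2 hx'] at h1
  change D.Φ _ _ = 0
  rw [map_add, LinearMap.add_apply, h1, (D.xiStar (D.extend Y ξ) w').2 u hu]
  simp

/-- `ξ*` is injective with values in `Y`, where `ξ` is injective. This makes `ξ⁺ = ξ*(ξξ*)⁻¹` a
genuine formula rather than the default value of `linInv`. -/
theorem extend_comp_xiStar_bijective :
    Function.Bijective (D.extend Y ξ ∘ₗ D.xiStar (D.extend Y ξ)) := by
  have hinj : Function.Injective (D.extend Y ξ ∘ₗ D.xiStar (D.extend Y ξ)) := by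
    rw [injective_iff_map_eq_zero]
    intro w' h
    have h1 := (extend_eq_zero_iff hD hY hξ _).1 h
    have h2 := Submodule.disjoint_def.1 (isCompl_of_isNondegSub hD hY).disjoint _
      (xiStar_extend_mem hD hY hξ w') h1
    refine Subtype.ext (hD.eq_zero_of_mem_W' w'.2 fun w hw => ?_)
    obtain ⟨y, -, hy⟩ := extend_surjective hD hY hξ ⟨w, hw⟩
    have h3 := hD.xiStar_apply' (D.extend Y ξ) w' y
    rw [h2, hy] at h3
    simpa using h3.symm
  exact ⟨hinj, (LinearMap.injective_iff_surjective_of_finrank_eq_finrank hD.finrank_W').1 hinj⟩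

theorem xiStar_extend_surjective {y : V} (hy : y ∈ Y) :
    ∃ w' : D.W', (D.xiStar (D.extend Y ξ) w' : V) = y := by
  obtain ⟨w', hw'⟩ := (extend_comp_xiStar_bijective hD hY hξ).2 (D.extend Y ξ ⟨y, hY.1 hy⟩)
  refine ⟨w', ?_⟩
  have h1 : D.extend Y ξ (D.xiStar (D.extend Y ξ) w' - ⟨y, hY.1 hy⟩) = 0 := by
    rw [map_sub]; exact sub_eq_zero.2 hw'
  have h2 := Submodule.disjoint_def.1 (isCompl_of_isNondegSub hD hY).disjoint _
    (sub_mem (xiStar_extend_mem hD hY hξ w') hy) ((extend_eq_zero_iff hD hY hξ _).1 h1)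
  exact sub_eq_zero.1 h2

/-- Write `y = ξ* w'`; then `ξ⁺ξy = ξ*(ξξ*)⁻¹ξξ* w' = y`. Thus `ξ⁺` inverts `ξ` on `Y`, and `Ξ(a -
1)` is `(a - 1)|_Y` transported to `W`. -/
theorem xiPlus_extend {y : V} (hy : y ∈ Y) :
    (D.xiPlus (D.extend Y ξ) (D.extend Y ξ ⟨y, hY.1 hy⟩) : V) = y := by
  obtain ⟨w', hw'⟩ := xiStar_extend_surjective hD hY hξ hy
  have e : (⟨y, hY.1 hy⟩ : D.X) = D.xiStar (D.extend Y ξ) w' := Subtype.ext hw'.symm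
  rw [e]
  have := linInv_apply_self (extend_comp_xiStar_bijective hD hY hξ) w'
  rw [LinearMap.comp_apply] at this
  rw [xiPlus, LinearMap.comp_apply, this, hw']

variable {a : Module.End K V} (ha : IsNormOn D Y a)
include ha

theorem Xi_apply {y z : V} (hy : y ∈ Y) (hz : z ∈ Y) (h : a y - y = z) :
    D.Xi (D.extend Y ξ) (a - 1) (D.extend Y ξ ⟨y, hY.1 hy⟩) = D.extend Y ξ ⟨z, hY.1 hz⟩ := by
  change D.extend Y ξ (D.projX ((a - 1 : Module.End K V)
    (D.xiPlus (D.extend Y ξ) (D.extend Y ξ ⟨y, hY.1 hy⟩) : V))) = _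
  rw [xiPlus_extend hD hY hξ hy]
  congr 1
  refine Subtype.ext ?_
  rw [LinearMap.sub_apply, Module.End.one_apply, h, hD.projX_of_mem_X (hY.1 hz)]

theorem Xi_bijective : Function.Bijective (D.Xi (D.extend Y ξ) (a - 1)) := by
  have hs : Function.Surjective (D.Xi (D.extend Y ξ) (a - 1)) := by
    intro w
    obtain ⟨z, hz, rfl⟩ := extend_surjective hD hY hξ w
    obtain ⟨y, hy, h⟩ := ha.bijOn.surjOn hz
    exact ⟨_, Xi_apply hD hY hξ ha hy hz h⟩
  exact ⟨LinearMap.injective_iff_surjective.2 hs, hs⟩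

/-- The component `η` of `n_Y(a)` is characterized by `η w' = ξ y` for `(a - 1) y = ξ* w'`. -/
theorem etaOf_nY_apply {y : V} {w' : D.W'} (hy : y ∈ Y)
    (h : a y - y = D.xiStar (D.extend Y ξ) w') :
    D.etaOf (D.nY Y ξ a) w' = D.extend Y ξ ⟨y, hY.1 hy⟩ := by
  rw [nY, etaOf_nOf hD]
  have h1 := Xi_apply hD hY hξ ha hy (xiStar_extend_mem hD hY hξ w') h
  have h2 := linInv_apply_self (Xi_bijective hD hY hξ ha) (D.extend Y ξ ⟨y, hY.1 hy⟩)
  rw [h1] at h2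
  exact h2

theorem exists_sub_eq_xiStar (w' : D.W') :
    ∃ y ∈ Y, a y - y = D.xiStar (D.extend Y ξ) w' :=
  ha.bijOn.surjOn (xiStar_extend_mem hD hY hξ w')

/-- With `(a - 1)y = ξ*u` and `(a - 1)z = ξ*w`, the relation `η + η* + ξξ* = 0` at `(u, w)` reads
`Φ(y, (a - 1)z) + Φ((a - 1)y, z) + Φ((a - 1)y, (a - 1)z) = 0`, that is, `Φ(ay, az) = Φ(y, z)`. -/
theorem nY_mem_N' : D.nY Y ξ a ∈ D.N' := by
  have hN : D.nY Y ξ a ∈ D.N := by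
    refine nOf_mem_N hD _ _ fun u w => ?_
    obtain ⟨y, hy, hyu⟩ := exists_sub_eq_xiStar hD hY hξ ha u
    obtain ⟨z, hz, hzw⟩ := exists_sub_eq_xiStar hD hY hξ ha w
    have e1 := etaOf_nY_apply hD hY hξ ha hy hyu
    have e2 := etaOf_nY_apply hD hY hξ ha hz hzw
    rw [nY, etaOf_nOf hD] at e1 e2
    rw [e1, e2, ← hD.xiStar_apply' _ w ⟨y, hY.1 hy⟩, ← hD.xiStar_apply _ u ⟨z, hY.1 hz⟩]
    rw [← hyu, ← hzw]
    have := ha.isometry y z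
    simp only [map_sub, LinearMap.sub_apply]
    linear_combination this
  refine ⟨hN, ?_⟩
  have hs : Function.Surjective (D.etaOf (D.nY Y ξ a)) := by
    intro w
    obtain ⟨y, hy, rfl⟩ := extend_surjective hD hY hξ w
    obtain ⟨w', hw'⟩ := xiStar_extend_surjective hD hY hξ (ha.bijOn.mapsTo hy)
    exact ⟨w', etaOf_nY_apply hD hY hξ ha hy hw'.symm⟩
  exact ⟨(LinearMap.injective_iff_surjective_of_finrank_eq_finrank hD.finrank_W').2 hs, hs⟩

omit hY hξ ha in
theorem xiOf_nY : D.xiOf (D.nY Y ξ a) = D.extend Y ξ := by rw [nY, xiOf_nOf hD]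

/-- If `(a - 1)y = ξ* w'` then `η w' = ξy`, so `ξ*η⁻¹ξy = ξ* w' = (a - 1)y` on `Y`; on `Y^⊥` the map
`ξ` vanishes. -/
theorem norm_nY : D.norm (D.nY Y ξ a) = a := by
  refine linearMap_ext_of_isNondegSub hD hY (fun y hy => ?_) fun z hz => ?_
  · rw [norm_apply_X hD _ ⟨y, hY.1 hy⟩]
    obtain ⟨w', hw'⟩ := xiStar_extend_surjective hD hY hξ (ha.bijOn.mapsTo hy)
    have h1 := etaOf_nY_apply hD hY hξ ha hy hw'.symm
    rw [xiOf_nY hD, ← h1, linInv_apply_self (nY_mem_N' hD hY hξ ha).2, hw']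
    simp
  · rw [ha.fix z hz]
    obtain ⟨u, hu, x, hx, rfl⟩ : ∃ u ∈ D.W ⊔ D.W', ∃ x ∈ D.X, u + x = z :=
      Submodule.mem_sup.1 (hD.isCompl_sup_X.sup_eq_top ▸ Submodule.mem_top)
    have hx' : x ∈ D.Φ.orthogonal Y :=
      (Submodule.add_mem_iff_right _ (sup_le_orthogonal hD hY hu)).1 hz
    obtain ⟨w, hw, w', hw', rfl⟩ := Submodule.mem_sup.1 hu
    rw [map_add, map_add, norm_apply_W hD _ hw, norm_apply_W' hD _ hw', norm_apply_X hD _ ⟨x, hx⟩,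
      xiOf_nY hD, (extend_eq_zero_iff hD hY hξ ⟨x, hx⟩).2 hx']
    simp

/-- The elements of `N'` with norm `a` are the `M`-conjugates of `n_Y(a)`. -/
theorem exists_conj_nY {n : Module.End K V} (hn : n ∈ D.N') (hna : D.norm n = a) :
    ∃ m ∈ D.M, n = m.conj (D.nY Y ξ a) := by
  obtain ⟨hk, hs, -⟩ := IsNormOn.xiOf hD hY (hna ▸ ha : IsNormOn D Y (D.norm n))
  let f : Y →ₗ[K] D.W := D.xiOf n ∘ₗ Submodule.inclusion hY.1
  have hfs : Function.Surjective f := fun w => by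
    obtain ⟨y, hy, e⟩ := hs w
    exact ⟨⟨y, hy⟩, e⟩
  have hf : Function.Bijective f :=
    ⟨(LinearMap.injective_iff_surjective_of_finrank_eq_finrank hY.2.2).2 hfs, hfs⟩
  -- `g` carries `ξ_Y` to the restriction of `ξ` to `Y`. Conjugating by the corresponding element of
  -- `M` aligns the two maps `ξ` and keeps the norm, and the pair determines the element.
  let g : D.W ≃ₗ[K] D.W := (LinearEquiv.ofBijective ξ hξ).symm ≪≫ₗ LinearEquiv.ofBijective f hf
  have hg : ∀ y, g (ξ y) = f y := by
    intro y
    change f ((LinearEquiv.ofBijective ξ hξ).symm (ξ y)) = _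
    congr 1
    exact (LinearEquiv.ofBijective ξ hξ).symm_apply_apply y
  obtain ⟨m, hm, hmW, hmX⟩ := exists_mem_M_of_equiv hD g
  have hN' := nY_mem_N' hD hY hξ ha
  refine ⟨m, hm, eq_of_norm_eq hD hn (conj_mem_N' hD hm hN') ?_
    (fun w => (hs w).imp fun y h => h.2) ?_⟩
  · have hmX' : ∀ x ∈ D.X, m.symm x = x := fun x hx => by
      rw [LinearEquiv.symm_apply_eq, hmX x hx]
    refine LinearMap.ext fun x => ?_
    have e1 : D.xiOf (m.conj (D.nY Y ξ a)) x = g (D.extend Y ξ x) := by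
      refine Subtype.ext ?_
      have := apply_eq_add_xiOf hD (conj_mem_N' hD hm hN').1 x
      rw [LinearEquiv.conj_apply_apply, hmX' x x.2, apply_eq_add_xiOf hD hN'.1, xiOf_nY hD, map_add,
        hmX x x.2, hmW, add_right_inj] at this
      exact this.symm
    rw [e1]
    have hc := isCompl_of_isNondegSub hD hY
    have e2 : (proj Y (D.Φ.orthogonal Y) (x : V) : V) ∈ D.X := hY.1 (Subtype.mem _)
    have e3 : D.xiOf n (x - ⟨_, e2⟩) = 0 := by
      rw [hk]
      have := proj_add_proj hc (x : V)
      rw [Submodule.coe_sub, sub_eq_iff_eq_add'.2 this.symm]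
      exact Subtype.mem _
    rw [map_sub, sub_eq_zero] at e3
    rw [e3]
    exact (hg _).symm
  · rw [norm_conj_eq hD hm (one_mem D.H) (fun x hx => (hmX x hx).symm) hN', norm_nY hD hY hξ ha,
      hna]
    rfl

end nY

end Sections

end Datum

end

end OddNorm

namespace OddNorm

noncomputable section

/-! ### Distinct eigenvalues as the nonvanishing of a resultant -/

section DistinctEigenvalues

variable {K : Type*} [Field K] {ι : Type*} [Fintype ι] [DecidableEq ι]

/-- A square matrix with as many distinct eigenvalues as its size. -/
def HasDistinctEigenvalues (A : Matrix ι ι K) : Prop :=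
  ∃ c : ι → K, Function.Injective c ∧ ∀ i, ∃ q : ι → K, q ≠ 0 ∧ A.mulVec q = c i • q

theorem isRoot_charpoly_iff {A : Matrix ι ι K} {c : K} :
    A.charpoly.IsRoot c ↔ ∃ q : ι → K, q ≠ 0 ∧ A.mulVec q = c • q := by
  rw [Polynomial.IsRoot, Matrix.eval_charpoly, ← Matrix.exists_mulVec_eq_zero_iff]
  refine exists_congr fun q => and_congr_right fun _ => ?_
  rw [Matrix.sub_mulVec, sub_eq_zero, Matrix.scalar_apply, ← Matrix.smul_one_eq_diagonal,
    Matrix.smul_mulVec, Matrix.one_mulVec, eq_comm]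

theorem hasDistinctEigenvalues_iff_separable [IsAlgClosed K] {A : Matrix ι ι K} :
    HasDistinctEigenvalues A ↔ A.charpoly.Separable := by
  classical
  rw [← Polynomial.nodup_roots_iff_of_splits A.charpoly_monic.ne_zero (IsAlgClosed.splits _)]
  have hcard : A.charpoly.roots.card = Fintype.card ι := by
    rw [← (IsAlgClosed.splits A.charpoly).natDegree_eq_card_roots,
      Matrix.charpoly_natDegree_eq_dim]
  constructor
  · rintro ⟨c, hc, h⟩
    rw [← Multiset.toFinset_card_eq_card_iff_nodup]
    refine le_antisymm (Multiset.toFinset_card_le _) ?_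
    rw [hcard, ← Finset.card_univ, ← Finset.card_image_of_injective _ hc]
    refine Finset.card_le_card fun x hx => ?_
    obtain ⟨i, -, rfl⟩ := Finset.mem_image.1 hx
    rw [Multiset.mem_toFinset, Polynomial.mem_roots A.charpoly_monic.ne_zero]
    exact isRoot_charpoly_iff.2 (h i)
  · intro h
    have hc : Fintype.card A.charpoly.roots.toFinset = Fintype.card ι := by
      rw [Fintype.card_coe, Multiset.toFinset_card_of_nodup h, hcard]
    let e := (Fintype.equivOfCardEq hc).symm
    refine ⟨fun i => e i, Subtype.val_injective.comp e.injective, fun i => ?_⟩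
    have := (e i).2
    rw [Multiset.mem_toFinset, Polynomial.mem_roots A.charpoly_monic.ne_zero] at this
    exact isRoot_charpoly_iff.1 this

theorem HasDistinctEigenvalues.smul {A : Matrix ι ι K} (h : HasDistinctEigenvalues A) {s : K}
    (hs : s ≠ 0) : HasDistinctEigenvalues (s • A) := by
  obtain ⟨c, hc, h⟩ := h
  refine ⟨fun i => s * c i, (mul_right_injective₀ hs).comp hc, fun i => ?_⟩
  obtain ⟨q, hq, e⟩ := h i
  exact ⟨q, hq, by rw [Matrix.smul_mulVec, e, mul_smul]⟩

/-- Used to replace `B⁻¹` by the adjugate of `B`, which is polynomial in the entries. -/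
theorem hasDistinctEigenvalues_smul_iff {A : Matrix ι ι K} {s : K} (hs : s ≠ 0) :
    HasDistinctEigenvalues (s • A) ↔ HasDistinctEigenvalues A :=
  ⟨fun h => by simpa [smul_smul, inv_mul_cancel₀ hs] using h.smul (inv_ne_zero hs),
    fun h => h.smul hs⟩

/-- The degree arguments are the fixed numbers `k` and `k - 1`, so that the resultant is one
polynomial in the entries even when the derivative drops degree in positive characteristic. The
padding only contributes powers of the leading coefficient 1. -/
theorem hasDistinctEigenvalues_iff_resultant [IsAlgClosed K] [Nonempty ι] {A : Matrix ι ι K} :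
    HasDistinctEigenvalues A ↔
      Polynomial.resultant A.charpoly A.charpoly.derivative (Fintype.card ι)
        (Fintype.card ι - 1) ≠ 0 := by
  rw [hasDistinctEigenvalues_iff_separable, Polynomial.Separable]
  have hd := A.charpoly_natDegree_eq_dim
  have hle : A.charpoly.derivative.natDegree ≤ Fintype.card ι - 1 :=
    hd ▸ Polynomial.natDegree_derivative_le _
  have h := Polynomial.resultant_add_right_deg A.charpoly A.charpoly.derivative A.charpoly.natDegree
    A.charpoly.derivative.natDegree (Fintype.card ι - 1 - A.charpoly.derivative.natDegree) le_rfl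
  rw [Nat.add_sub_cancel' hle, A.charpoly_monic.coeff_natDegree, one_pow, one_mul, hd] at h
  rw [h, ← hd, ← isUnit_iff_ne_zero, Polynomial.isUnit_resultant_iff_isCoprime A.charpoly_monic]

end DistinctEigenvalues

namespace Datum

/-! ### The matrix of `η` and the norm in coordinates -/

section Gram

variable {K V : Type*} [Field K] [AddCommGroup V] [Module K V] [FiniteDimensional K V]
  {D : Datum K V} {ι : Type*} (w : Module.Basis ι K D.W')

/-- The matrix of the bilinear form `Φ(u, n v)` on `W'`. -/
def etaMatrix (n : Module.End K V) : Matrix ι ι K :=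
  Matrix.of fun i j => D.Φ (w i) (n (w j))

/-- The components in `X` of `n w_j`, for a basis `w` of `W'`. -/
def xiFamily (n : Module.End K V) (j : ι) : V := D.projX (n (w j))

variable (hD : D.IsOrthogonal)
include hD

theorem apply_etaOf {n : Module.End K V} (hn : n ∈ D.N) (u v : D.W') :
    D.Φ u (D.etaOf n v) = D.Φ u (n v) := by
  rw [apply_eq_add_etaOf hD hn v, map_add, map_add, hD.isotropic' _ u.2 _ v.2,
    IsOrthogonal.apply_W'_X u.2 (Subtype.mem _)]
  simp

variable [Fintype ι]

theorem apply_sum_etaMatrix (n : Module.End K V) (c : ι → K) (i : ι) :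
    (etaMatrix w n).mulVec c i = D.Φ (w i) (n (∑ j, c j • w j : D.W')) := by
  simp only [etaMatrix, Matrix.mulVec, dotProduct, Matrix.of_apply, Submodule.coe_sum,
    Submodule.coe_smul, map_sum, map_smul, smul_eq_mul, mul_comm]

theorem eq_zero_of_apply_basis {v : D.W} (h : ∀ i, D.Φ (w i) v = 0) : v = 0 := by
  refine Subtype.ext (hD.eq_zero_of_mem_W v.2 fun w' hw' => ?_)
  rw [hD.comm]
  have e := w.sum_repr ⟨w', hw'⟩
  have : w' = ((∑ i, w.repr ⟨w', hw'⟩ i • w i : D.W') : V) := by rw [e]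
  rw [this, Submodule.coe_sum, map_sum, LinearMap.sum_apply]
  refine Finset.sum_eq_zero fun i _ => ?_
  rw [Submodule.coe_smul, map_smul, LinearMap.smul_apply, h, smul_zero]

variable [DecidableEq ι]

/-- The `W'`- and `X`-components of `n v` are orthogonal to `W'`, so `etaMatrix w n` is the matrix
of `η` read through the perfect pairing of `W'` with `W`. -/
theorem mem_N'_iff_det {n : Module.End K V} (hn : n ∈ D.N) :
    n ∈ D.N' ↔ (etaMatrix w n).det ≠ 0 := by
  constructor
  · intro h h0
    obtain ⟨c, hc0, hc⟩ := Matrix.exists_mulVec_eq_zero_iff.2 h0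
    have h1 : D.etaOf n (∑ j, c j • w j) = 0 := by
      refine eq_zero_of_apply_basis w hD fun i => ?_
      rw [apply_etaOf hD hn, ← apply_sum_etaMatrix w hD, hc]
      rfl
    have h2 := (map_eq_zero_iff _ h.2.1).1 h1
    exact hc0 (funext fun i => Fintype.linearIndependent_iff.1 w.linearIndependent c h2 i)
  · intro h
    refine ⟨hn, ?_⟩
    have hinj : Function.Injective (D.etaOf n) := by
      rw [injective_iff_map_eq_zero]
      intro u hu
      have h1 : (etaMatrix w n).mulVec (w.repr u) = 0 := by
        funext i
        rw [apply_sum_etaMatrix w hD, w.sum_repr, ← apply_etaOf hD hn, hu]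
        simp
      have h2 := Matrix.eq_zero_of_mulVec_eq_zero h h1
      exact w.repr.map_eq_zero_iff.1 (DFunLike.coe_injective h2)
    exact ⟨hinj, (LinearMap.injective_iff_surjective_of_finrank_eq_finrank hD.finrank_W').1 hinj⟩

omit [Fintype ι] [DecidableEq ι] in
-- This is `η + η* + ξξ* = 0` in coordinates, obtained by expanding `Φ(n w_i, n w_j) = 0`.
theorem gram_xiFamily {n : Module.End K V} (hn : n ∈ D.N) (i j : ι) :
    D.Φ (xiFamily w n i) (xiFamily w n j) =
      -((etaMatrix w n + (etaMatrix w n).transpose) i j) := by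
  have h := hn.1 (w i) (w j)
  have e1 := apply_etaOf hD hn (w i) (w j)
  have e2 := apply_etaOf hD hn (w j) (w i)
  rw [apply_eq_add_etaOf hD hn (w i), apply_eq_add_etaOf hD hn (w j)] at h
  simp only [map_add, LinearMap.add_apply, hD.isotropic' _ (Subtype.mem _) _ (Subtype.mem _),
    hD.isotropic _ (Subtype.mem _) _ (Subtype.mem _),
    IsOrthogonal.apply_W'_X (Subtype.mem (w i)) (Subtype.mem _),
    hD.apply_X_W' (Subtype.mem (w j)) (Subtype.mem _),
    hD.apply_X_W (Subtype.mem (D.etaOf n _)) (Subtype.mem _),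
    IsOrthogonal.apply_W_X (Subtype.mem (D.etaOf n _)) (Subtype.mem _)] at h
  rw [hD.comm (D.etaOf n (w i)), e2, e1] at h
  change D.Φ _ _ = -(D.Φ _ _ + D.Φ _ _)
  unfold xiFamily
  linear_combination h

omit [Fintype ι] [DecidableEq ι] in
theorem span_xiFamily {n : Module.End K V} (hn : n ∈ D.N) :
    Submodule.span K (Set.range (xiFamily w n)) = (D.X.subtype ∘ₗ D.xiStar (D.xiOf n)).range := by
  have h : ∀ j, xiFamily w n j = -(D.X.subtype ∘ₗ D.xiStar (D.xiOf n)) (w j) := by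
    intro j
    rw [LinearMap.comp_apply, xiStar_xiOf hD hn]
    simp [xiFamily]
  have h2 : xiFamily w n = (-(D.X.subtype ∘ₗ D.xiStar (D.xiOf n))) ∘ w := funext h
  rw [h2, Set.range_comp, ← Submodule.map_span, w.span_eq, Submodule.map_top, LinearMap.range_neg]

/-- The norm relation at `x_j` holds with `u = w_j + ∑ C i j • w i`, `C = B⁻¹Bᵀ`. Indeed `ηu` and
`ξx_j` both pair with `w_l` to the entry `(B + Bᵀ) l j`, the first because `B(1 + C) = B + Bᵀ`, the
second by the Gram matrix. What remains of `n(x_j - u)` is `-∑ C i j • x_i - u`. -/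
theorem norm_xiFamily {n : Module.End K V} (hn : n ∈ D.N') (j : ι) :
    D.norm n (xiFamily w n j) =
      -∑ i, ((etaMatrix w n)⁻¹ * (etaMatrix w n).transpose) i j • xiFamily w n i := by
  set B := etaMatrix w n with hB
  have hdet : IsUnit B.det := isUnit_iff_ne_zero.2 ((mem_N'_iff_det w hD hn.1).1 hn)
  set C := B⁻¹ * B.transpose with hC
  have hBC : B * C = B.transpose := by rw [hC, Matrix.mul_nonsing_inv_cancel_left _ _ hdet]
  have hpX : ∀ i, xiFamily w n i ∈ D.X := fun i => Subtype.mem _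
  set u : D.W' := w j + ∑ i, C i j • w i with hu
  symm
  refine eq_norm_of_relation hD hn (hpX j)
    (neg_mem (Submodule.sum_mem _ fun i _ => Submodule.smul_mem _ _ (hpX i))) u.2 ?_
  have h1 : (D.projX (n u) : V) = xiFamily w n j + ∑ i, C i j • xiFamily w n i := by
    simp [hu, xiFamily]
  have h2 : D.etaOf n u = D.xiOf n (D.projX (n (w j))) := by
    rw [← sub_eq_zero]
    refine eq_zero_of_apply_basis w hD fun l => ?_
    have e1 : D.Φ (w l) (D.xiOf n (D.projX (n (w j)))) = (B + B.transpose) l j := by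
      rw [← hD.xiStar_apply, xiStar_xiOf hD hn.1, Submodule.coe_neg, map_neg, LinearMap.neg_apply]
      have := gram_xiFamily w hD hn.1 l j
      unfold xiFamily at this
      rw [this, neg_neg]
    have e2 : D.Φ (w l) (D.etaOf n u) = (B + B.transpose) l j := by
      rw [apply_etaOf hD hn.1, hu, Submodule.coe_add, map_add, map_add,
        ← apply_sum_etaMatrix w hD n (fun i => C i j), Matrix.add_apply, ← hBC]
      rfl
    rw [Submodule.coe_sub, map_sub, e1, e2, sub_self]
  have h3 := apply_eq_add_xiOf hD hn.1 (D.projX (n (w j)))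
  rw [← h2] at h3
  change n (D.projX (n (w j)) - u) = _
  rw [map_sub, h3, apply_eq_add_etaOf hD hn.1 u, h1]
  change xiFamily w n j + _ - _ = _
  abel

omit hD in
/-- The conditions on `n` that define `N_reg` are given by one polynomial function. -/
theorem exists_polyFun [IsAlgClosed K] [Nonempty ι] :
    ∃ f ∈ polyFun K (Module.End K V), ∀ n, f n ≠ 0 ↔
      (etaMatrix w n).det ≠ 0 ∧ (etaMatrix w n + (etaMatrix w n).transpose).det ≠ 0 ∧
        HasDistinctEigenvalues ((etaMatrix w n)⁻¹ * (etaMatrix w n).transpose) := by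
  -- The matrix is formed over the ring of polynomial functions, so determinants, adjugates and
  -- resultants are polynomial functions; evaluation at `n` is a ring homomorphism and commutes with
  -- them.
  let R := polyFun K (Module.End K V)
  have hmem : ∀ i j, (fun n : Module.End K V => D.Φ (w i) (n (w j))) ∈ R := fun i j =>
    Algebra.subset_adjoin ⟨(D.Φ (w i)) ∘ₗ LinearMap.applyₗ (w j : V), rfl⟩
  let B : Matrix ι ι R := Matrix.of fun i j => ⟨_, hmem i j⟩
  let ev : Module.End K V → R →+* K := fun n =>
    (Pi.evalRingHom (fun _ => K) n).comp R.val.toRingHom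
  have hev : ∀ n, B.map (ev n) = etaMatrix w n := fun n => rfl
  let M : Matrix ι ι R := B.adjugate * B.transpose
  let r : R := Polynomial.resultant M.charpoly M.charpoly.derivative (Fintype.card ι)
        (Fintype.card ι - 1)
  let f : R := B.det * (B + B.transpose).det * r
  refine ⟨f, f.2, fun n => ?_⟩
  have e1 : ev n B.det = (etaMatrix w n).det := by rw [RingHom.map_det]; rfl
  have e2 : ev n (B + B.transpose).det = (etaMatrix w n + (etaMatrix w n).transpose).det := by
    rw [RingHom.map_det]
    congr 1
  have e3 : M.map (ev n) = (etaMatrix w n).adjugate * (etaMatrix w n).transpose := by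
    rw [Matrix.map_mul, ← RingHom.mapMatrix_apply (ev n) B.adjugate,
      RingHom.map_adjugate]
    rfl
  have e4 : ev n r ≠ 0 ↔
      HasDistinctEigenvalues ((etaMatrix w n).adjugate * (etaMatrix w n).transpose) := by
    rw [hasDistinctEigenvalues_iff_resultant, ← e3, Matrix.charpoly_map, Polynomial.derivative_map,
      Polynomial.resultant_map_map]
  have e5 : (f : Module.End K V → K) n = ev n B.det * ev n (B + B.transpose).det * ev n r := rfl
  rw [e5, mul_ne_zero_iff, mul_ne_zero_iff, e1, e2, e4, and_assoc]
  refine and_congr_right fun hdet => and_congr_right fun _ => ?_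
  rw [Matrix.inv_def, Matrix.smul_mul, Ring.inverse_eq_inv',
    hasDistinctEigenvalues_smul_iff (inv_ne_zero hdet)]

end Gram

end Datum

end

end OddNorm

namespace OddNorm

noncomputable section

/-! ### The Zariski topology on `GL(V)` and connectedness -/

section ZariskiTopology

variable {K : Type*} [Field K]

section Vector

variable {E : Type*} [AddCommGroup E] [Module K E]

theorem dual_mem_polyFun (φ : Module.Dual K E) : (fun v => φ v) ∈ polyFun K E :=
  Algebra.subset_adjoin ⟨φ, rfl⟩

theorem polyFun_comp {E' : Type*} [AddCommGroup E'] [Module K E'] (L : E →ₗ[K] E') {f : E' → K}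
    (hf : f ∈ polyFun K E') : f ∘ L ∈ polyFun K E := by
  induction hf using Algebra.adjoin_induction with
  | mem f hf =>
    obtain ⟨φ, rfl⟩ := hf
    exact dual_mem_polyFun (φ ∘ₗ L)
  | algebraMap r => exact (polyFun K E).algebraMap_mem r
  | add f g _ _ hf hg => exact add_mem hf hg
  | mul f g _ _ hf hg => exact mul_mem hf hg

theorem isOpen_ne_zero {f : E → K} (hf : f ∈ polyFun K E) : IsOpen[zariski K E] {v | f v ≠ 0} :=
  TopologicalSpace.isOpen_generateFrom_of_mem ⟨f, hf, rfl⟩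

/-- The principal open sets form a basis. -/
theorem exists_principal_subset {U : Set E} (hU : IsOpen[zariski K E] U) {x : E} (hx : x ∈ U) :
    ∃ f ∈ polyFun K E, f x ≠ 0 ∧ ∀ v, f v ≠ 0 → v ∈ U := by
  induction hU with
  | basic s hs =>
    obtain ⟨f, hf, rfl⟩ := hs
    exact ⟨f, hf, hx, fun v hv => hv⟩
  | univ => exact ⟨1, one_mem _, one_ne_zero, fun v _ => trivial⟩
  | inter s t _ _ hs ht =>
    obtain ⟨f, hf, hfx, hfs⟩ := hs hx.1
    obtain ⟨g, hg, hgx, hgt⟩ := ht hx.2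
    exact ⟨f * g, mul_mem hf hg, mul_ne_zero hfx hgx,
      fun v hv => ⟨hfs v (left_ne_zero_of_mul hv), hgt v (right_ne_zero_of_mul hv)⟩⟩
  | sUnion S _ ih =>
    obtain ⟨s, hs, hxs⟩ := hx
    obtain ⟨f, hf, hfx, hfs⟩ := ih s hs hxs
    exact ⟨f, hf, hfx, fun v hv => ⟨s, hs, hfs v hv⟩⟩

end Vector

variable {V : Type*} [AddCommGroup V] [Module K V]

theorem coefficient_mem_polyFun (φ : Module.Dual K V) (v : V) :
    (fun a : Module.End K V => φ (a v)) ∈ polyFun K (Module.End K V) :=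
  dual_mem_polyFun (φ ∘ₗ LinearMap.applyₗ v)

theorem form_mem_polyFun [FiniteDimensional K V] (Φ : LinearMap.BilinForm K V) (v w : V) :
    (fun a : Module.End K V => Φ (a v) (a w)) ∈ polyFun K (Module.End K V) := by
  let b := Module.finBasis K V
  have : (fun a : Module.End K V => Φ (a v) (a w)) =
      ∑ i, (fun a : Module.End K V => Φ.flip (b i) (a v)) *
        fun a : Module.End K V => b.coord i (a w) := by
    funext a
    rw [Finset.sum_apply]
    conv_lhs => rw [← b.sum_repr (a w), map_sum]
    refine Finset.sum_congr rfl fun i _ => ?_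
    rw [map_smul, smul_eq_mul, mul_comm]
    rfl
  rw [this]
  exact sum_mem fun i _ => mul_mem (coefficient_mem_polyFun _ _) (coefficient_mem_polyFun _ _)

theorem isOpenGL_ne_zero {f : Module.End K V → K} (hf : f ∈ polyFun K (Module.End K V)) :
    IsOpen[zariskiGL K V] {g : V ≃ₗ[K] V | f (g : Module.End K V) ≠ 0} :=
  ⟨_, isOpen_ne_zero hf, rfl⟩

theorem isClosedGL_zeros {S : Set (Module.End K V → K)} (hS : S ⊆ polyFun K (Module.End K V)) :
    IsClosed[zariskiGL K V] {g : V ≃ₗ[K] V | ∀ f ∈ S, f (g : Module.End K V) = 0} := by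
  let _ := zariskiGL K V
  rw [Set.ofPred_forall]
  refine isClosed_iInter fun f => ?_
  rw [Set.ofPred_forall]
  refine isClosed_iInter fun hf => ?_
  rw [← isOpen_compl_iff]
  exact isOpenGL_ne_zero (hS hf)

/-- A polynomial function with only two values on a connected set is constant on it. -/
theorem eq_of_isPreconnected {S : Set (V ≃ₗ[K] V)} (hS : @IsPreconnected _ (zariskiGL K V) S)
    {f : Module.End K V → K} (hf : f ∈ polyFun K (Module.End K V)) {a b : K} (hab : a ≠ b)
    (h : ∀ g ∈ S, f (g : Module.End K V) = a ∨ f (g : Module.End K V) = b) {g₀ g : V ≃ₗ[K] V}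
    (hg₀ : g₀ ∈ S) (h₀ : f (g₀ : Module.End K V) = a) (hg : g ∈ S) :
    f (g : Module.End K V) = a := by
  let _ := zariskiGL K V
  by_contra hne
  have hsub : ∀ c : K, f - algebraMap K _ c ∈ polyFun K (Module.End K V) := fun c =>
    sub_mem hf ((polyFun K (Module.End K V)).algebraMap_mem c)
  obtain ⟨x, hx, h1, h2⟩ := hS _ _ (isOpenGL_ne_zero (hsub a)) (isOpenGL_ne_zero (hsub b))
    (fun g hg => by
      rcases h g hg with h | h
      · right
        change f g - b ≠ 0
        rw [h]; exact sub_ne_zero.2 hab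
      · left
        change f g - a ≠ 0
        rw [h]; exact sub_ne_zero.2 hab.symm)
    ⟨g, hg, (sub_ne_zero.2 hne : f g - a ≠ 0)⟩
    ⟨g₀, hg₀, (by rw [h₀]; exact sub_ne_zero.2 hab : f g₀ - b ≠ 0)⟩
  have h1 : f x - a ≠ 0 := h1
  have h2 : f x - b ≠ 0 := h2
  rcases h x hx with h | h
  · exact h1 (sub_eq_zero.2 h)
  · exact h2 (sub_eq_zero.2 h)

/-- Functions that are quotients of polynomials on `U`. -/
def rationalOn (U : Set K) : Subalgebra K (K → K) where
  carrier := {r | ∃ P Q : Polynomial K, ∀ s ∈ U, Q.eval s ≠ 0 ∧ r s * Q.eval s = P.eval s}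
  mul_mem' := by
    rintro f g ⟨P, Q, h⟩ ⟨P', Q', h'⟩
    refine ⟨P * P', Q * Q', fun s hs => ?_⟩
    rw [Polynomial.eval_mul, Polynomial.eval_mul]
    refine ⟨mul_ne_zero (h s hs).1 (h' s hs).1, ?_⟩
    rw [← (h s hs).2, ← (h' s hs).2, Pi.mul_apply]
    ring
  add_mem' := by
    rintro f g ⟨P, Q, h⟩ ⟨P', Q', h'⟩
    refine ⟨P * Q' + P' * Q, Q * Q', fun s hs => ?_⟩
    rw [Polynomial.eval_mul, Polynomial.eval_add, Polynomial.eval_mul, Polynomial.eval_mul]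
    refine ⟨mul_ne_zero (h s hs).1 (h' s hs).1, ?_⟩
    rw [← (h s hs).2, ← (h' s hs).2, Pi.add_apply]
    ring
  algebraMap_mem' := by
    intro c
    exact ⟨Polynomial.C c, 1, fun s _ => by simp⟩

/-- A rational curve in `GL(V)` is connected. -/
theorem isPreconnected_curve [Infinite K] {U : Set K} (hU : Uᶜ.Finite) (c : K → V ≃ₗ[K] V)
    {ι : Type*} [Fintype ι] (r : ι → K → K) (A : ι → Module.End K V)
    (hr : ∀ i, r i ∈ rationalOn U)
    (hc : ∀ s ∈ U, (c s : Module.End K V) = ∑ i, r i s • A i) :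
    @IsPreconnected _ (zariskiGL K V) (c '' U) := by
  let _ := zariskiGL K V
  -- The curve is even irreducible: a nonempty open subset of it contains the nonvanishing locus of
  -- a nonzero rational function of the parameter, and two cofinite subsets of an infinite field
  -- meet.
  refine IsPreirreducible.isPreconnected ?_
  have key : ∀ f ∈ polyFun K (Module.End K V),
      (fun s => f (∑ i, r i s • A i)) ∈ rationalOn U := by
    intro f hf
    induction hf using Algebra.adjoin_induction with
    | mem f hf =>
      obtain ⟨φ, rfl⟩ := hf
      have : (fun s => φ (∑ i, r i s • A i)) = ∑ i, φ (A i) • r i := by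
        funext s
        rw [map_sum, Finset.sum_apply]
        refine Finset.sum_congr rfl fun i _ => ?_
        rw [map_smul, Pi.smul_apply, smul_eq_mul, smul_eq_mul, mul_comm]
      rw [this]
      exact sum_mem fun i _ => Subalgebra.smul_mem _ (hr i) _
    | algebraMap x => exact (rationalOn U).algebraMap_mem x
    | add f g _ _ hf hg => exact add_mem hf hg
    | mul f g _ _ hf hg => exact mul_mem hf hg
  rintro _ _ ⟨u, hu, rfl⟩ ⟨v, hv, rfl⟩ ⟨_, ⟨s, hs, rfl⟩, hsu⟩ ⟨_, ⟨t, ht, rfl⟩, htv⟩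
  obtain ⟨f, hf, hfs, hfu⟩ := exists_principal_subset hu hsu
  obtain ⟨g, hg, hgt, hgv⟩ := exists_principal_subset hv htv
  obtain ⟨P, Q, hPQ⟩ := key f hf
  obtain ⟨P', Q', hPQ'⟩ := key g hg
  have hfs : f (c s : Module.End K V) ≠ 0 := hfs
  have hgt : g (c t : Module.End K V) ≠ 0 := hgt
  rw [hc s hs] at hfs
  rw [hc t ht] at hgt
  have hP : P ≠ 0 := by
    rintro rfl
    have := (hPQ s hs).2
    rw [Polynomial.eval_zero] at this
    exact mul_ne_zero hfs (hPQ s hs).1 this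
  have hP' : P' ≠ 0 := by
    rintro rfl
    have := (hPQ' t ht).2
    rw [Polynomial.eval_zero] at this
    exact mul_ne_zero hgt (hPQ' t ht).1 this
  have hfin : (Uᶜ ∪ {x | (P * P').IsRoot x}).Finite :=
    hU.union (Polynomial.finite_setOfPred_isRoot (mul_ne_zero hP hP'))
  obtain ⟨x, hx⟩ := hfin.exists_notMem
  simp only [Set.mem_union, Set.mem_compl_iff, not_or, not_not, Set.mem_ofPred_eq,
    Polynomial.IsRoot, Polynomial.eval_mul, mul_eq_zero] at hx
  obtain ⟨hxU, hx1, hx2⟩ := hx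
  refine ⟨c x, ⟨x, hxU, rfl⟩, hfu (c x : Module.End K V) ?_, hgv (c x : Module.End K V) ?_⟩
  · rw [hc x hxU]
    intro h0
    exact hx1 ((hPQ x hxU).2.symm.trans ((congrArg (· * _) h0).trans (zero_mul _)))
  · rw [hc x hxU]
    intro h0
    exact hx2 ((hPQ' x hxU).2.symm.trans ((congrArg (· * _) h0).trans (zero_mul _)))

theorem continuous_mulAut_conj (h : V ≃ₗ[K] V) :
    @Continuous _ _ (zariskiGL K V) (zariskiGL K V) (MulAut.conj h) := by
  let L : Module.End K V →ₗ[K] Module.End K V := (h.conj : _ ≃ₗ[K] _)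
  let _ := zariski K (Module.End K V)
  let _ := zariskiGL K V
  rw [continuous_induced_rng]
  have h1 : Continuous L := by
    refine continuous_generateFrom_iff.2 ?_
    rintro _ ⟨f, hf, rfl⟩
    exact isOpen_ne_zero (polyFun_comp L hf)
  exact h1.comp continuous_induced_dom

/-- Conjugation by `h` is a homeomorphism that fixes 1 and carries the centralizer of `γ` in `G` to
that of the conjugate. -/
theorem IsRegularIn.conj {G T : Subgroup (V ≃ₗ[K] V)} {γ h : V ≃ₗ[K] V} (hγ : IsRegularIn G T γ)
    (hh : h ∈ G) :
    IsRegularIn G (T.map (MulAut.conj h).toMonoidHom) (MulAut.conj h γ) := by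
  let _ := zariskiGL K V
  let e : (V ≃ₗ[K] V) ≃ₜ (V ≃ₗ[K] V) :=
    { toEquiv := (MulAut.conj h).toEquiv
      continuous_toFun := continuous_mulAut_conj h
      continuous_invFun := by
        have := continuous_mulAut_conj (K := K) h⁻¹
        rw [map_inv] at this
        exact this }
  have he : ∀ g, e g = MulAut.conj h g := fun _ => rfl
  unfold IsRegularIn at hγ ⊢
  have h1 : (T.map (MulAut.conj h).toMonoidHom : Set (V ≃ₗ[K] V)) = e '' T := rfl
  have h2 : {g | g ∈ G ∧ g * MulAut.conj h γ = MulAut.conj h γ * g} =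
      e '' {g | g ∈ G ∧ g * γ = γ * g} := by
    ext g
    constructor
    · rintro ⟨hg, e1⟩
      refine ⟨h⁻¹ * g * h, ⟨mul_mem (mul_mem (inv_mem hh) hg) hh, ?_⟩, ?_⟩
      · rw [MulAut.conj_apply] at e1
        have e2 := congrArg (fun x => h⁻¹ * x * h) e1
        simpa [mul_assoc] using e2
      · simp [he, MulAut.conj_apply, mul_assoc]
    · rintro ⟨g, ⟨hg, e1⟩, rfl⟩
      refine ⟨mul_mem (mul_mem hh hg) (inv_mem hh), ?_⟩
      rw [he, ← map_mul, e1, map_mul]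
  have h3 : e 1 = 1 := map_one (MulAut.conj h)
  rw [h1, ← hγ, h2]
  conv_lhs => rw [← h3]
  have h4 : (1 : V ≃ₗ[K] V) ∈ {g | g ∈ G ∧ g * γ = γ * g} := ⟨one_mem _, by simp⟩
  exact (e.image_connectedComponentIn h4).symm

end ZariskiTopology

end

end OddNorm

/-! ### Hyperbolic bases and their diagonal tori -/

namespace OddNorm

noncomputable section

/-- The index set of a hyperbolic basis: `m` hyperbolic pairs and an anisotropic vector. -/
abbrev HypIndex (m : ℕ) : Type := Option (Fin m × Bool)

namespace HypIndex

variable {m : ℕ}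

/-- The involution that exchanges the members of every pair. -/
def dual (i : HypIndex m) : HypIndex m := i.map fun p => (p.1, !p.2)

@[simp] theorem dual_dual (i : HypIndex m) : i.dual.dual = i := by
  rcases i with _ | ⟨i, s⟩ <;> simp [dual]

@[simp] theorem dual_none : dual (none : HypIndex m) = none := rfl

theorem dual_eq_iff {i j : HypIndex m} : i.dual = j ↔ i = j.dual :=
  ⟨fun h => by rw [← h, dual_dual], fun h => by rw [h, dual_dual]⟩

theorem dual_injective : Function.Injective (dual : HypIndex m → HypIndex m) :=
  fun i j h => by rw [← dual_dual i, h, dual_dual]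

theorem dual_eq_self_iff {i : HypIndex m} : i.dual = i ↔ i = none := by
  rcases i with _ | ⟨i, s⟩ <;> simp [dual]

theorem card (m : ℕ) : Fintype.card (HypIndex m) = 2 * m + 1 := by
  simp [Fintype.card_option, mul_comm]

end HypIndex

namespace Datum

section Hyperbolic

variable {K V : Type*} [Field K] [AddCommGroup V] [Module K V] [FiniteDimensional K V]
  {D : Datum K V} {Y : Submodule K V} {m : ℕ} {b : HypIndex m → V}

/-- `b` is a hyperbolic basis of `Y`. -/
structure IsHypBasis (D : Datum K V) (Y : Submodule K V) (b : HypIndex m → V) : Prop where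
  gram : ∀ i j, D.Φ (b i) (b j) = if j = i.dual then 1 else 0
  span : Submodule.span K (Set.range b) = Y

namespace IsHypBasis

variable (hb : IsHypBasis D Y b)
include hb

theorem mem (i : HypIndex m) : b i ∈ Y := hb.span ▸ Submodule.subset_span ⟨i, rfl⟩

theorem apply_sum (i : HypIndex m) (c : HypIndex m → K) :
    D.Φ (b i.dual) (∑ j, c j • b j) = c i := by
  simp [-Fintype.sum_option, hb.gram]

theorem linearIndependent : LinearIndependent K b := by
  rw [Fintype.linearIndependent_iff]
  intro c hc i
  rw [← hb.apply_sum i c, hc, map_zero]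

theorem ne_zero (i : HypIndex m) : b i ≠ 0 := hb.linearIndependent.ne_zero i

theorem eq_sum {v : V} (hv : v ∈ Y) : v = ∑ i, D.Φ (b i.dual) v • b i := by
  rw [← hb.span] at hv
  obtain ⟨c, rfl⟩ := (Submodule.mem_span_range_iff_exists_fun K).1 hv
  exact Finset.sum_congr rfl fun i _ => by rw [hb.apply_sum]

theorem finrank_eq : Module.finrank K Y = 2 * m + 1 := by
  rw [← hb.span, finrank_span_eq_card hb.linearIndependent, HypIndex.card]

theorem apply_eq_smul {g : Module.End K V} {i : HypIndex m} (h : ∃ c : K, g (b i) = c • b i) :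
    g (b i) = D.Φ (b i.dual) (g (b i)) • b i := by
  obtain ⟨c, hc⟩ := h
  rw [hc, map_smul, hb.gram, HypIndex.dual_dual, if_pos rfl, smul_eq_mul, mul_one]

end IsHypBasis

/-- The subgroup of `H_Y` that acts diagonally on a hyperbolic basis of `Y` and fixes its
anisotropic vector. -/
def hypTorus (D : Datum K V) (Y : Submodule K V) (b : HypIndex m → V) :
    Subgroup (V ≃ₗ[K] V) where
  carrier := {g | g ∈ D.HY Y ∧ (∀ i, ∃ c : K, g (b i) = c • b i) ∧ g (b none) = b none}
  mul_mem' := by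
    rintro g h ⟨hg, hg1, hg2⟩ ⟨hh, hh1, hh2⟩
    refine ⟨mul_mem hg hh, fun i => ?_, by rw [LinearEquiv.mul_apply, hh2, hg2]⟩
    obtain ⟨c, hc⟩ := hg1 i
    obtain ⟨d, hd⟩ := hh1 i
    exact ⟨d * c, by rw [LinearEquiv.mul_apply, hd, map_smul, hc, smul_smul]⟩
  one_mem' := ⟨one_mem _, fun i => ⟨1, by simp⟩, rfl⟩
  inv_mem' := by
    rintro g ⟨hg, hg1, hg2⟩
    refine ⟨inv_mem hg, fun i => ?_, ?_⟩
    · obtain ⟨c, hc⟩ := hg1 i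
      refine ⟨c⁻¹, ?_⟩
      have h1 : b i = c • g⁻¹ (b i) := by
        have := g.symm_apply_apply (b i)
        rw [hc, map_smul] at this
        exact this.symm
      rcases eq_or_ne c 0 with rfl | h0
      · rw [zero_smul] at h1
        rw [h1]; simp
      · conv_rhs => rw [h1]
        rw [smul_smul, inv_mul_cancel₀ h0, one_smul]
    · have := g.symm_apply_apply (b none)
      rw [hg2] at this
      exact this

variable (hD : D.IsOrthogonal) (hY : D.IsNondegSub Y) (hb : IsHypBasis D Y b)
include hD hY hb

theorem linearMap_ext_of_isHypBasis {E : Type*} [AddCommGroup E]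
    [Module K E] {f g : V →ₗ[K] E} (h1 : ∀ i, f (b i) = g (b i))
    (h2 : ∀ y ∈ D.Φ.orthogonal Y, f y = g y) : f = g := by
  refine linearMap_ext_of_isNondegSub hD hY (fun y hy => ?_) h2
  rw [hb.eq_sum hy, map_sum, map_sum]
  exact Finset.sum_congr rfl fun i _ => by rw [map_smul, map_smul, h1]

theorem exists_mem_hypTorus (c : HypIndex m → K) (hc : ∀ i, c i * c i.dual = 1)
    (hc0 : c none = 1) : ∃ g ∈ hypTorus D Y b, ∀ i, g (b i) = c i • b i := by
  obtain ⟨u, h1, h2, h3⟩ := exists_isometry_of_families hD.symm hD.nondegenerate hY.2.1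
    hb.linearIndependent hb.span (v' := fun i => c i • b i)
    (fun i => Submodule.smul_mem _ _ (hb.mem i)) (fun i j => by
      simp only [map_smul, LinearMap.smul_apply, hb.gram, smul_eq_mul]
      split_ifs with h
      · rw [h]; linear_combination hc i
      · ring)
  exact ⟨u, ⟨⟨h1, h3⟩, fun i => ⟨_, h2 i⟩, by rw [h2, hc0, one_smul]⟩, h2⟩

omit hD hY in
theorem mul_dual_eq_one {g : V ≃ₗ[K] V} (hg : g ∈ D.isom) {c : HypIndex m → K}
    (hc : ∀ i, g (b i) = c i • b i) (i : HypIndex m) : c i * c i.dual = 1 := by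
  have := hg (b i) (b i.dual)
  simpa [hc, hb.gram, mul_comm] using this

theorem hypTorus_isClosed : IsClosed[zariskiGL K V] (hypTorus D Y b : Set (V ≃ₗ[K] V)) := by
  let R := polyFun K (Module.End K V)
  have hsub : ∀ {f : Module.End K V → K}, f ∈ R → ∀ c : K, (fun a => f a - c) ∈ R :=
    fun hf c => sub_mem hf (R.algebraMap_mem c)
  -- The equations of the torus: isometry, identity on `Y^⊥` (tested by the nondegenerate form),
  -- vanishing off-diagonal entries on `Y`, and value 1 on the anisotropic vector.
  let S : Set (Module.End K V → K) :=
    {f | ∃ v w, f = fun a => D.Φ (a v) (a w) - D.Φ v w} ∪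
    {f | ∃ v, ∃ z ∈ D.Φ.orthogonal Y, f = fun a => D.Φ v (a z) - D.Φ v z} ∪
    {f | ∃ i j, j ≠ i ∧ f = fun a => D.Φ (b j.dual) (a (b i))} ∪
    {fun a => D.Φ (b none) (a (b none)) - 1}
  have hS : S ⊆ R := by
    rintro f (((⟨v, w, rfl⟩ | ⟨v, z, -, rfl⟩) | ⟨i, j, -, rfl⟩) | rfl)
    · exact hsub (form_mem_polyFun _ _ _) _
    · exact hsub (coefficient_mem_polyFun _ _) _
    · exact coefficient_mem_polyFun _ _
    · exact hsub (coefficient_mem_polyFun _ _) _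
  convert isClosedGL_zeros hS using 1
  ext g
  constructor
  · rintro ⟨hg, hg1, hg2⟩ f (((⟨v, w, rfl⟩ | ⟨v, z, hz, rfl⟩) | ⟨i, j, hij, rfl⟩) | rfl)
    · exact sub_eq_zero.2 (hg.1 v w)
    · exact sub_eq_zero.2 (congrArg _ (hg.2 z hz))
    · obtain ⟨c, hc⟩ := hg1 i
      change D.Φ _ (g (b i)) = 0
      rw [hc, map_smul, hb.gram, HypIndex.dual_dual, if_neg hij.symm, smul_zero]
    · change D.Φ _ (g (b none)) - 1 = 0
      rw [hg2, hb.gram, HypIndex.dual_none, if_pos rfl, sub_self]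
  · intro h
    have hg : g ∈ D.HY Y := by
      refine ⟨fun v w => sub_eq_zero.1 (h _ (Or.inl (Or.inl (Or.inl ⟨v, w, rfl⟩)))), fun z hz => ?_⟩
      refine sub_eq_zero.1 (hD.nondegenerate.2 _ fun v => ?_)
      rw [map_sub]
      exact h _ (Or.inl (Or.inl (Or.inr ⟨v, z, hz, rfl⟩)))
    have hd : ∀ i, g (b i) = D.Φ (b i.dual) (g (b i)) • b i := by
      intro i
      conv_lhs => rw [hb.eq_sum (HY_mem hD hg (hb.mem i))]
      refine Finset.sum_eq_single i (fun j _ hj => ?_) (fun hi => absurd (Finset.mem_univ i) hi)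
      have : D.Φ (b j.dual) (g (b i)) = 0 := h _ (Or.inl (Or.inr ⟨i, j, hj, rfl⟩))
      rw [this, zero_smul]
    refine ⟨hg, fun i => ⟨_, hd i⟩, ?_⟩
    have : D.Φ (b none) (g (b none)) - 1 = 0 := h _ (Or.inr rfl)
    rw [hd none, HypIndex.dual_none, sub_eq_zero.1 this, one_smul]

/-- Each `g` in the torus lies with 1 on a rational curve inside the torus. -/
theorem hypTorus_isConnected [Infinite K] :
    @IsConnected _ (zariskiGL K V) (hypTorus D Y b : Set (V ≃ₗ[K] V)) := by
  let _ := zariskiGL K V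
  refine ⟨⟨1, one_mem _⟩, isPreconnected_of_forall 1 fun g hg => ?_⟩
  obtain ⟨hg0, hg1, hg2⟩ := hg
  choose c hc using hg1
  have hcd := mul_dual_eq_one hb hg0.1 hc
  have hcn : c none = 1 := by
    have := hc none
    rw [hg2] at this
    have h2 : (c none - 1) • b none = 0 := by rw [sub_smul, ← this, one_smul, sub_self]
    exact sub_eq_zero.1 ((smul_eq_zero.1 h2).resolve_right (hb.ne_zero _))
  -- A splitting `c i = y i / y i.dual` of the eigenvalues of `g`. Moving `y` along the line from 1
  -- and taking the quotients `r s i` makes `r s i * r s i.dual = 1` automatic, with value 1 at `s =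
  -- 0` and `g` at `s = 1`.
  let y : HypIndex m → K := fun i => i.elim 1 fun p => if p.2 then c (some p) else 1
  have hy : ∀ i, y i = c i * y i.dual := by
    rintro (_ | ⟨i, s⟩)
    · simp [y, HypIndex.dual, hcn]
    · cases s
      · simpa [y, HypIndex.dual] using (hcd (some (i, false))).symm
      · simp [y, HypIndex.dual]
  let p : HypIndex m → Polynomial K := fun i => 1 + Polynomial.C (y i - 1) * Polynomial.X
  have hp : ∀ i s, (p i).eval s = 1 + (y i - 1) * s := fun i s => by simp [p]
  have hp0 : ∀ i, p i ≠ 0 := fun i h => by simpa [h] using hp i 0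
  let U : Set K := {s | ∀ i, (p i).eval s ≠ 0}
  have hU : Uᶜ.Finite := by
    have : Uᶜ = ⋃ i, {s | (p i).IsRoot s} := by
      ext s
      simp [U, Polynomial.IsRoot]
    rw [this]
    exact Set.finite_iUnion fun i => Polynomial.finite_setOfPred_isRoot (hp0 i)
  let r : K → HypIndex m → K := fun s i => (p i).eval s / (p i.dual).eval s
  have hex : ∀ s, ∃ h : V ≃ₗ[K] V, s ∈ U → h ∈ hypTorus D Y b ∧ ∀ i, h (b i) = r s i • b i := by
    intro s
    by_cases hs : s ∈ U
    · obtain ⟨h, hh, hh'⟩ := exists_mem_hypTorus hD hY hb (r s) (fun i => by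
        simp only [r, HypIndex.dual_dual]
        have h1 := hs i
        have h2 := hs i.dual
        field_simp) (by simp only [r, HypIndex.dual_none]; exact div_self (hs none))
      exact ⟨h, fun _ => ⟨hh, hh'⟩⟩
    · exact ⟨1, fun h => absurd h hs⟩
  choose u hu using hex
  have h0 : (0 : K) ∈ U := fun i => by rw [hp]; simp
  have hc0 : ∀ i, c i ≠ 0 := fun i => left_ne_zero_of_mul_eq_one (hcd i)
  have hy0 : ∀ i, y i ≠ 0 := by
    rintro (_ | ⟨i, s⟩)
    · simp [y]
    · cases s <;> simp [y, hc0]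
  have h1 : (1 : K) ∈ U := fun i => by rw [hp]; simpa using hy0 i
  have hext : ∀ {f g : V ≃ₗ[K] V}, f ∈ D.HY Y → g ∈ D.HY Y → (∀ i, f (b i) = g (b i)) → f = g := by
    intro f g hf hg h
    refine LinearEquiv.toLinearMap_injective (linearMap_ext_of_isHypBasis hD hY hb h fun z hz => ?_)
    exact (hf.2 z hz).trans (hg.2 z hz).symm
  refine ⟨u '' U, ?_, ⟨0, h0, ?_⟩, ⟨1, h1, ?_⟩, ?_⟩
  · rintro _ ⟨s, hs, rfl⟩
    exact (hu s hs).1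
  · refine hext (hu 0 h0).1.1 (one_mem _) fun i => ?_
    rw [(hu 0 h0).2]
    simp [r, hp]
  · refine hext (hu 1 h1).1.1 hg0 fun i => ?_
    rw [(hu 1 h1).2, hc]
    congr 1
    simp only [r, hp]
    rw [hy i]
    have := hy0 i.dual
    ring_nf
    field_simp
  -- The curve is the identity (the outer `none`) plus `r s i - 1` times the projector on the line
  -- of `b i`.
  · refine isPreconnected_curve hU u (ι := Option (HypIndex m))
      (fun i s => i.elim 1 fun i => r s i - 1)
      (fun i => i.elim 1 fun i => (LinearMap.toSpanSingleton K V (b i)) ∘ₗ D.Φ (b i.dual)) ?_ ?_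
    · rintro (_ | i)
      · exact one_mem (rationalOn U)
      · have : (fun s => r s i) ∈ rationalOn U :=
          ⟨p i, p i.dual, fun s hs => ⟨hs _, div_mul_cancel₀ _ (hs _)⟩⟩
        exact sub_mem this (one_mem _)
    · intro s hs
      refine linearMap_ext_of_isHypBasis hD hY hb (fun i => ?_) fun z hz => ?_
      · change u s (b i) = _
        rw [(hu s hs).2, Fintype.sum_option]
        simp [-Fintype.sum_option, LinearMap.sum_apply, hb.gram, sub_smul]
      · change u s z = _
        rw [(hu s hs).1.1.2 z hz, Fintype.sum_option]
        have : ∀ i : HypIndex m, D.Φ (b i) z = 0 := fun i => hz _ (hb.mem i)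
        simp [LinearMap.sum_apply, this]

theorem hypTorus_isTorus [Infinite K] : IsTorus (hypTorus D Y b) := by
  refine ⟨hypTorus_isClosed hD hY hb, hypTorus_isConnected hD hY hb, ?_⟩
  have hc := isCompl_of_isNondegSub hD hY
  let bY : Module.Basis (HypIndex m) K Y := Module.Basis.mk
    (v := fun i => (⟨b i, hb.mem i⟩ : Y)) (by
      have : LinearIndependent K (Y.subtype ∘ fun i => (⟨b i, hb.mem i⟩ : Y)) :=
        hb.linearIndependent
      exact this.of_comp) (by
      rintro ⟨y, hy⟩ -
      have : (⟨y, hy⟩ : Y) = ∑ i, D.Φ (b i.dual) y • (⟨b i, hb.mem i⟩ : Y) :=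
        Subtype.ext (by simpa using hb.eq_sum hy)
      rw [this]
      exact Submodule.sum_mem _ fun i _ =>
        Submodule.smul_mem _ _ (Submodule.subset_span ⟨i, rfl⟩))
  let bZ := Module.finBasis K (D.Φ.orthogonal Y)
  let B := (bY.prod bZ).map (Submodule.prodEquivOfIsCompl Y (D.Φ.orthogonal Y) hc)
  let e := Fintype.equivFinOfCardEq (Module.finrank_eq_card_basis B).symm
  refine ⟨B.reindex e, fun t ht i => ?_⟩
  rw [Module.Basis.reindex_apply]
  rcases e.symm i with j | j
  · have : B (Sum.inl j) = b j := by simp [B, bY]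
    rw [this]
    exact ht.2.1 j
  · have : B (Sum.inr j) = bZ j := by simp [B]
    rw [this]
    exact ⟨1, by rw [ht.1.2 _ (bZ j).2, one_smul]⟩

section Regular

variable {γ : V ≃ₗ[K] V} {c : HypIndex m → K}

omit hY hD in
/-- The eigenspaces of `γ` in `Y` are lines. -/
theorem eq_smul_of_apply_eq_smul (hγ : γ ∈ D.isom) (hc : ∀ i, γ (b i) = c i • b i)
    (hinj : Function.Injective c) {v : V} (hv : v ∈ Y) {i : HypIndex m} (h : γ v = c i • v) :
    v = D.Φ (b i.dual) v • b i := by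
  conv_lhs => rw [hb.eq_sum hv]
  refine Finset.sum_eq_single i (fun j _ hj => ?_) (fun hi => absurd (Finset.mem_univ i) hi)
  have h1 := hγ (b j.dual) v
  rw [hc, h] at h1
  simp only [map_smul, LinearMap.smul_apply, smul_eq_mul] at h1
  have h2 := mul_dual_eq_one hb hγ hc j
  have h3 : (c i - c j) * D.Φ (b j.dual) v = 0 := by
    linear_combination c j * h1 - c i * D.Φ (b j.dual) v * h2
  rw [(mul_eq_zero.1 h3).resolve_left (sub_ne_zero.2 fun h => hj (hinj h.symm)), zero_smul]

omit hY in
theorem apply_eq_smul_of_commute (hγ : γ ∈ D.isom) (hc : ∀ i, γ (b i) = c i • b i)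
    (hinj : Function.Injective c) {g : V ≃ₗ[K] V} (hg : g ∈ D.HY Y) (hgc : g * γ = γ * g)
    (i : HypIndex m) : g (b i) = D.Φ (b i.dual) (g (b i)) • b i := by
  refine eq_smul_of_apply_eq_smul hb hγ hc hinj (HY_mem hD hg (hb.mem i)) ?_
  have : γ (g (b i)) = g (γ (b i)) := (LinearEquiv.congr_fun hgc (b i)).symm
  rw [this, hc, map_smul]

/-- An element of `H_Y` commuting with `γ` is diagonal in `b`, with value `±1` on the anisotropic
vector. That value is constant on the identity component because `1 ≠ -1`, so the component lies in
the torus. Conversely the torus is connected and commutes with `γ`. -/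
theorem isRegularIn_of_injective [Infinite K] (h2 : (2 : K) ≠ 0) (hγ : γ ∈ hypTorus D Y b)
    (hc : ∀ i, γ (b i) = c i • b i) (hinj : Function.Injective c) :
    IsRegularIn (D.HY Y) (hypTorus D Y b) γ := by
  have hcomm : ∀ g ∈ hypTorus D Y b, g * γ = γ * g := by
    intro g hg
    refine LinearEquiv.toLinearMap_injective
      (linearMap_ext_of_isHypBasis hD hY hb (fun i => ?_) fun z hz => ?_)
    · obtain ⟨d, hd⟩ := hg.2.1 i
      change g (γ (b i)) = γ (g (b i))
      rw [hc, hd, map_smul, map_smul, hc, hd, smul_comm]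
    · change g (γ z) = γ (g z)
      rw [hγ.1.2 z hz, hg.1.2 z hz, hγ.1.2 z hz]
  let _ := zariskiGL K V
  unfold IsRegularIn
  have h1 : (1 : V ≃ₗ[K] V) ∈ {g | g ∈ D.HY Y ∧ g * γ = γ * g} := ⟨one_mem _, by simp⟩
  apply Set.Subset.antisymm
  · intro g hg
    have hsub := connectedComponentIn_subset {g | g ∈ D.HY Y ∧ g * γ = γ * g} 1
    have hval : ∀ g ∈ connectedComponentIn {g | g ∈ D.HY Y ∧ g * γ = γ * g} 1,
        D.Φ (b none) (g (b none)) = 1 ∨ D.Φ (b none) (g (b none)) = -1 := by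
      intro g hg
      obtain ⟨hg, hgc⟩ := hsub hg
      have e := apply_eq_smul_of_commute hD hb hγ.1.1 hc hinj hg hgc none
      have e1 := hg.1 (b none) (b none)
      rw [e, HypIndex.dual_none] at e1
      simp only [map_smul, LinearMap.smul_apply, hb.gram, HypIndex.dual_none, if_true, smul_eq_mul,
        mul_one] at e1
      exact mul_self_eq_one_iff.1 e1
    have hne : (1 : K) ≠ -1 := fun h => h2 (by linear_combination h)
    have h3 := eq_of_isPreconnected (isPreconnected_connectedComponentIn)
      (coefficient_mem_polyFun (D.Φ (b none)) (b none)) hne hval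
      (mem_connectedComponentIn h1) (by simp [hb.gram]) hg
    obtain ⟨hgY, hgc⟩ := hsub hg
    have e := apply_eq_smul_of_commute hD hb hγ.1.1 hc hinj hgY hgc
    refine ⟨hgY, fun i => ⟨_, e i⟩, ?_⟩
    have h3 : D.Φ (b none) (g (b none)) = 1 := h3
    rw [e none, HypIndex.dual_none, h3, one_smul]
  · exact (hypTorus_isConnected hD hY hb).isPreconnected.subset_connectedComponentIn (one_mem _)
      fun g hg => ⟨hg.1, hcomm g hg⟩

end Regular

end Hyperbolic

end Datum

end

end OddNorm

namespace OddNorm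

noncomputable section

/-! ### Eichler transformations and regular elements -/

section Eichler

variable {K V : Type*} [Field K] [AddCommGroup V] [Module K V] [FiniteDimensional K V]

/-- The Eichler transformations attached to an isotropic vector `u` and a vector `v` orthogonal
to it. -/
theorem exists_eichler (h2 : (2 : K) ≠ 0) {Φ : LinearMap.BilinForm K V} (hs : Φ.IsSymm)
    (hΦ : Φ.Nondegenerate) {u v : V} (huu : Φ u u = 0) (huv : Φ u v = 0) :
    ∃ E : K → V ≃ₗ[K] V, ∀ s, (∀ x y, Φ (E s x) (E s y) = Φ x y) ∧
      ∀ x, E s x = x + s • (Φ u x • v - Φ v x • u) - s ^ 2 • (2⁻¹ * Φ v v * Φ u x) • u := by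
  have hcomm : ∀ x y, Φ x y = Φ y x := hs.eq
  let f : K → V →ₗ[K] V := fun s => LinearMap.id +
    s • (LinearMap.toSpanSingleton K V v ∘ₗ Φ u - LinearMap.toSpanSingleton K V u ∘ₗ Φ v) -
    s ^ 2 • (2⁻¹ * Φ v v) • (LinearMap.toSpanSingleton K V u ∘ₗ Φ u)
  have hf : ∀ s x, f s x =
      x + s • (Φ u x • v - Φ v x • u) - s ^ 2 • (2⁻¹ * Φ v v * Φ u x) • u := by
    intro s x
    simp [f, smul_smul, mul_assoc]
  have hvu : Φ v u = 0 := by rw [hcomm, huv]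
  have hiso : ∀ s x y, Φ (f s x) (f s y) = Φ x y := by
    intro s x y
    rw [hf, hf]
    simp only [map_add, map_sub, map_smul, LinearMap.add_apply, LinearMap.sub_apply,
      LinearMap.smul_apply, smul_eq_mul, huu, huv, hvu, hcomm x u, hcomm x v]
    have h3 : (2 : K) * 2⁻¹ = 1 := mul_inv_cancel₀ h2
    linear_combination (-(s ^ 2) * Φ v v * Φ u x * Φ u y) * h3
  have hinj : ∀ s, Function.Injective (f s) := by
    intro s
    rw [injective_iff_map_eq_zero]
    intro x hx
    refine hΦ.1 x fun y => ?_
    rw [← hiso s, hx, map_zero, LinearMap.zero_apply]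
  exact ⟨fun s => LinearEquiv.ofInjectiveEndo (f s) (hinj s), fun s => ⟨hiso s, hf s⟩⟩

end Eichler

namespace Datum

section Hyperbolic

variable {K V : Type*} [Field K] [AddCommGroup V] [Module K V] [FiniteDimensional K V]
  {D : Datum K V} {Y : Submodule K V} {m : ℕ} {b : HypIndex m → V}

section Regular

variable (h2 : (2 : K) ≠ 0) (hD : D.IsOrthogonal) (hb : IsHypBasis D Y b)
include h2 hD hb

/-- The Eichler transformations `E s` of `u = b i` and `v = b j.dual` lie in `H_Y` and commute with
`γ`, since `c i * c j.dual = c i / c j = 1`. They form a connected curve through 1, so regularity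
would put `E 1` in the torus; but it is not diagonal. The assumptions on the indices make `u`
isotropic, orthogonal to `v` and different from `v`. -/
theorem not_isRegularIn_of_eq [Infinite K] {γ : V ≃ₗ[K] V} {c : HypIndex m → K}
    (hγ : γ ∈ hypTorus D Y b) (hc : ∀ i, γ (b i) = c i • b i) {i j : HypIndex m} (hi : i ≠ none)
    (hij : i ≠ j) (hij' : i ≠ j.dual) (hcij : c i = c j) :
    ¬IsRegularIn (D.HY Y) (hypTorus D Y b) γ := by
  intro hreg
  have hdual := mul_dual_eq_one hb hγ.1.1 hc
  have huu : D.Φ (b i) (b i) = 0 := by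
    rw [hb.gram, if_neg fun h => hi (HypIndex.dual_eq_self_iff.1 h.symm)]
  have huv : D.Φ (b i) (b j.dual) = 0 := by
    rw [hb.gram, if_neg fun h => hij (HypIndex.dual_injective h).symm]
  obtain ⟨E, hE⟩ := exists_eichler h2 hD.symm hD.nondegenerate huu huv
  -- The quadratic term of `E s` commutes with `γ` only if `Φ(v, v) = 0` or `c i ^ 2 = 1`; for `j =
  -- none`, the one case with `v` anisotropic, the eigenvalue is 1.
  have hvv : D.Φ (b j.dual) (b j.dual) * (c i ^ 2 - 1) = 0 := by
    by_cases hj : j = none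
    · subst hj
      have h1 : c none = 1 := by
        have := hγ.2.2
        rw [hc] at this
        have h3 : (c none - 1) • b none = 0 := by rw [sub_smul, this, one_smul, sub_self]
        exact sub_eq_zero.1 ((smul_eq_zero.1 h3).resolve_right (hb.ne_zero _))
      rw [hcij, h1]; ring
    · rw [hb.gram, if_neg, zero_mul]
      rw [HypIndex.dual_dual]
      exact fun h => hj (HypIndex.dual_eq_self_iff.1 h)
  have hHY : ∀ s, E s ∈ D.HY Y := by
    refine fun s => ⟨(hE s).1, fun z hz => ?_⟩
    rw [(hE s).2, apply_eq_zero_of_mem_orthogonal (hb.mem _) hz,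
      apply_eq_zero_of_mem_orthogonal (hb.mem _) hz]
    simp
  have hcom : ∀ s, E s * γ = γ * E s := by
    intro s
    ext x
    rw [LinearEquiv.mul_apply, LinearEquiv.mul_apply, (hE s).2, (hE s).2]
    have e1 : D.Φ (b i) x = c i * D.Φ (b i) (γ x) := by
      rw [← hγ.1.1 (b i) x, hc, map_smul, LinearMap.smul_apply, smul_eq_mul]
    have e2 : D.Φ (b j.dual) x = c j.dual * D.Φ (b j.dual) (γ x) := by
      rw [← hγ.1.1 (b j.dual) x, hc, map_smul, LinearMap.smul_apply, smul_eq_mul]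
    have e3 : c i * c j.dual = 1 := by rw [hcij, hdual]
    simp only [map_add, map_sub, map_smul, hc, e1, e2, smul_smul]
    have e4 : c i * D.Φ (b i) (γ x) * c j.dual = D.Φ (b i) (γ x) := by
      linear_combination D.Φ (b i) (γ x) * e3
    have e5 : c j.dual * D.Φ (b j.dual) (γ x) * c i = D.Φ (b j.dual) (γ x) := by
      linear_combination D.Φ (b j.dual) (γ x) * e3
    rw [e4, e5]
    congr 2
    linear_combination (-(s ^ 2) * 2⁻¹ * D.Φ (b i) (γ x)) * hvv
  let _ := zariskiGL K V
  have hcurve : IsPreconnected (E '' Set.univ) := by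
    refine isPreconnected_curve (by simp) E (ι := Fin 3) ![1, id, id ^ 2]
      ![1, LinearMap.toSpanSingleton K V (b j.dual) ∘ₗ D.Φ (b i) -
        LinearMap.toSpanSingleton K V (b i) ∘ₗ D.Φ (b j.dual),
        -((2⁻¹ * D.Φ (b j.dual) (b j.dual)) • (LinearMap.toSpanSingleton K V (b i) ∘ₗ D.Φ (b i)))]
      ?_ ?_
    · have hid : (id : K → K) ∈ rationalOn (Set.univ : Set K) :=
        ⟨Polynomial.X, 1, fun s _ => by simp⟩
      intro k
      fin_cases k
      · exact one_mem (rationalOn Set.univ)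
      · exact hid
      · exact pow_mem hid 2
    · intro s _
      ext x
      change E s x = _
      rw [(hE s).2, Fin.sum_univ_three]
      simp [smul_smul, sub_eq_add_neg, mul_assoc]
  have hE0 : E 0 = 1 := by
    ext x
    rw [(hE 0).2]
    simp
  have hsub : E '' Set.univ ⊆ {g | g ∈ D.HY Y ∧ g * γ = γ * g} := by
    rintro _ ⟨s, -, rfl⟩
    exact ⟨hHY s, hcom s⟩
  have hmem : E 1 ∈ hypTorus D Y b := by
    have := hcurve.subset_connectedComponentIn ⟨0, trivial, hE0⟩ hsub ⟨1, trivial, rfl⟩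
    rw [hreg] at this
    exact this
  -- `E 1` sends `b i.dual` to a vector whose coordinate along `b j.dual` is 1.
  obtain ⟨d, hd⟩ := hmem.2.1 i.dual
  have h3 := congrArg (D.Φ (b j)) hd
  rw [(hE 1).2] at h3
  simp only [map_add, map_sub, map_smul, hb.gram, smul_eq_mul, HypIndex.dual_dual] at h3
  have n1 : ¬i.dual = j.dual := fun h => hij (HypIndex.dual_injective h)
  simp [n1, hij'] at h3

/-- A regular element without eigenvalue `-1` has distinct eigenvalues. -/
theorem injective_of_isRegularIn [Infinite K] {γ : V ≃ₗ[K] V} {c : HypIndex m → K}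
    (hγ : γ ∈ hypTorus D Y b) (hc : ∀ i, γ (b i) = c i • b i) (hneg : ∀ i, c i ≠ -1)
    (hreg : IsRegularIn (D.HY Y) (hypTorus D Y b) γ) : Function.Injective c := by
  have hdual := mul_dual_eq_one hb hγ.1.1 hc
  have h1 : c none = 1 := (mul_self_eq_one_iff.1 (hdual none)).resolve_right (hneg none)
  have key : ∀ i j : HypIndex m, i ≠ none → i ≠ j → c i ≠ c j := by
    intro i j hi hij hcij
    -- If `i` and its dual share an eigenvalue, its square is 1, so it is 1 and also occurs at
    -- `none`; the pair `(i, none)` is used instead. The value `-1` must be excluded, as a dual pair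
    -- with eigenvalue `-1` does not contradict regularity.
    by_cases hd : i = j.dual
    · have h3 : c i * c i = 1 := by
        have := hdual i
        rwa [hd, HypIndex.dual_dual, ← hcij, ← hd] at this
      have h4 := (mul_self_eq_one_iff.1 h3).resolve_right (hneg i)
      exact not_isRegularIn_of_eq h2 hD hb hγ hc hi hi hi (h4.trans h1.symm) hreg
    · exact not_isRegularIn_of_eq h2 hD hb hγ hc hi hij hd hcij hreg
  intro i j hij
  by_contra hne
  by_cases hi : i = none
  · exact key j i (fun hj => hne (hi.trans hj.symm)) (Ne.symm hne) hij.symm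
  · exact key i j hi hne hij

end Regular

/-- Take powers of one element `x` with exponents `0, ±1, …, ±m`. Differences and doubles of these
exponents are at most `2m` in absolute value, so it is enough that `x ^ j ≠ 1` for `1 ≤ j ≤ 2m`; an
element of infinite order need not exist. -/
theorem exists_generic [Infinite K] (h2 : (2 : K) ≠ 0) (m : ℕ) :
    ∃ c : HypIndex m → K, Function.Injective c ∧ (∀ i, c i * c i.dual = 1) ∧ c none = 1 ∧
      ∀ i, c i ≠ -1 := by
  let P : Polynomial K := Polynomial.X *
    ∏ j ∈ Finset.Icc 1 (2 * m), (Polynomial.X ^ j - Polynomial.C 1)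
  have hP : P ≠ 0 := mul_ne_zero Polynomial.X_ne_zero (Finset.prod_ne_zero_iff.2 fun j hj =>
    Polynomial.X_pow_sub_C_ne_zero (Finset.mem_Icc.1 hj).1 1)
  obtain ⟨x, hx⟩ := (Polynomial.finite_setOfPred_isRoot hP).exists_notMem
  simp only [P, Set.mem_ofPred_eq, Polynomial.IsRoot, Polynomial.eval_mul, Polynomial.eval_X,
    Polynomial.eval_prod, Polynomial.eval_sub, Polynomial.eval_pow, Polynomial.eval_C, mul_eq_zero,
    not_or, Finset.prod_eq_zero_iff, not_exists, not_and, sub_eq_zero] at hx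
  obtain ⟨hx0, hx1⟩ := hx
  have key : ∀ n : ℤ, n.natAbs ≤ 2 * m → x ^ n = 1 → n = 0 := by
    intro n hn h
    by_contra h0
    refine hx1 n.natAbs (Finset.mem_Icc.2 ⟨by omega, hn⟩) ?_
    rw [← zpow_natCast]
    rcases Int.natAbs_eq n with e | e
    · rwa [← e]
    · rw [e, zpow_neg, inv_eq_one] at h
      exact h
  let a : HypIndex m → ℤ := fun i => i.elim 0 fun p => if p.2 then p.1 + 1 else -(p.1 + 1)
  have ha : ∀ i, (a i).natAbs ≤ m := by
    rintro (_ | ⟨i, s⟩)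
    · simp [a]
    · cases s <;> simp [a] <;> omega
  have hainj : Function.Injective a := by
    rintro (_ | ⟨i, s⟩) (_ | ⟨j, t⟩) h
    · rfl
    · cases t <;> simp [a] at h <;> omega
    · cases s <;> simp [a] at h <;> omega
    · cases s <;> cases t <;> simp [a] at h ⊢ <;> omega
  have hadual : ∀ i, a i.dual = -a i := by
    rintro (_ | ⟨i, s⟩)
    · simp [a, HypIndex.dual]
    · cases s <;> simp [a, HypIndex.dual]
  refine ⟨fun i => x ^ a i, fun i j hij => ?_, fun i => ?_, by simp [a], fun i hi => ?_⟩
  · have h1 : x ^ (a i - a j) = 1 := by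
      rw [zpow_sub₀ hx0]
      exact div_eq_one_iff_eq (zpow_ne_zero _ hx0) |>.2 hij
    have := key _ (by have := ha i; have := ha j; omega) h1
    exact hainj (sub_eq_zero.1 this)
  · change x ^ a i * x ^ a i.dual = 1
    rw [hadual, zpow_neg, mul_inv_cancel₀ (zpow_ne_zero _ hx0)]
  · have h1 : x ^ (2 * a i) = 1 := by
      rw [mul_comm, zpow_mul]
      have hi : x ^ a i = -1 := hi
      rw [hi]
      norm_num
    have h3 := key _ (by have := ha i; omega) h1
    have h4 : a i = 0 := by omega
    have hi : x ^ a i = -1 := hi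
    rw [h4, zpow_zero] at hi
    exact h2 (by linear_combination hi)

theorem restrict_nondegenerate_iff {Φ : LinearMap.BilinForm K V} (hs : Φ.IsSymm)
    {A : Submodule K V} :
    (Φ.restrict A).Nondegenerate ↔ ∀ y ∈ A, (∀ z ∈ A, Φ y z = 0) → y = 0 := by
  constructor
  · intro h y hy hz
    exact congrArg Subtype.val (h.1 ⟨y, hy⟩ fun z => hz z z.2)
  · intro h
    refine ⟨fun y hy => Subtype.ext (h y y.2 fun z hz => hy ⟨z, hz⟩), fun y hy =>
      Subtype.ext (h y y.2 fun z hz => ?_)⟩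
    rw [hs.eq_iff]
    exact hy ⟨z, hz⟩

/-! ### Hyperbolic bases of eigenvectors and the classification of maximal tori -/

section Existence

/-- `v` is an eigenvector of all elements of `𝒢`. -/
def IsCommonEigenvector (𝒢 : Set (V ≃ₗ[K] V)) (v : V) : Prop := ∀ g ∈ 𝒢, ∃ c : K, g v = c • v

variable [IsAlgClosed K] {𝒢 : Set (V ≃ₗ[K] V)}

/-- If all nonzero common eigenvectors were anisotropic, `hfix` would make `𝒢` trivial on `Y`, so
every vector of `Y` would be a common eigenvector. But for orthogonal anisotropic `v`, `w`, the
vector `v + a • w` with `a² = -Φ(v, v) / Φ(w, w)` is isotropic. -/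
theorem exists_isotropic_eigenvector {Φ : LinearMap.BilinForm K V} (hs : Φ.IsSymm)
    (hrank : 2 ≤ Module.finrank K Y)
    (hspan : Y ≤ Submodule.span K {v | v ∈ Y ∧ IsCommonEigenvector 𝒢 v})
    (hfix : ∀ v ∈ Y, IsCommonEigenvector 𝒢 v → Φ v v ≠ 0 → ∀ g ∈ 𝒢, g v = v) :
    ∃ e ∈ Y, IsCommonEigenvector 𝒢 e ∧ e ≠ 0 ∧ Φ e e = 0 := by
  by_contra! hcon
  have hfixed : ∀ g ∈ 𝒢, ∀ v ∈ Y, g v = v := by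
    intro g hg v hv
    replace hv := hspan hv
    induction hv using Submodule.span_induction with
    | mem v hv =>
      rcases eq_or_ne v 0 with rfl | h0
      · exact map_zero g
      · exact hfix v hv.1 hv.2 (hcon v hv.1 hv.2 h0) g hg
    | zero => exact map_zero g
    | add x y _ _ hx hy => rw [map_add, hx, hy]
    | smul a x _ hx => rw [map_smul, hx]
  have heig : ∀ v ∈ Y, IsCommonEigenvector 𝒢 v := fun v hv g hg =>
    ⟨1, by rw [hfixed g hg v hv, one_smul]⟩
  have : Nontrivial Y := Module.nontrivial_of_finrank_pos (R := K) (by omega)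
  obtain ⟨v, hv⟩ := exists_ne (0 : Y)
  have hv0 : (v : V) ≠ 0 := fun h => hv (Subtype.ext h)
  have hvv := hcon v v.2 (heig v v.2) hv0
  obtain ⟨w, hw, hw0⟩ := Submodule.exists_mem_ne_zero_of_ne_bot
    (LinearMap.ker_ne_bot_of_finrank_lt (f := Φ v ∘ₗ Y.subtype)
      (by rw [Module.finrank_self]; omega))
  have hvw : Φ v w = 0 := hw
  have hwv : Φ w v = 0 := by rw [hs.eq_iff]; exact hw
  have hww := hcon w w.2 (heig w w.2) fun h => hw0 (Subtype.ext h)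
  obtain ⟨a, ha⟩ := IsAlgClosed.exists_pow_nat_eq (-Φ v v / Φ w w) (n := 2) (by norm_num)
  have hmem : (v : V) + a • (w : V) ∈ Y := add_mem v.2 (Submodule.smul_mem _ _ w.2)
  refine hcon _ hmem (heig _ hmem) (fun h => hvv ?_) ?_
  · have := congrArg (Φ v) h
    simpa [hvw] using this
  · simp only [map_add, map_smul, LinearMap.add_apply, LinearMap.smul_apply, smul_eq_mul, hvw, hwv]
    field_simp at ha
    linear_combination ha

/-- A common eigenvector `u` not orthogonal to `e` is made isotropic by subtracting a multiple of
`e`. It stays an eigenvector: if `Φ(u, u) = 0` nothing is subtracted, and otherwise `𝒢` fixes `u` by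
`hfix`, hence fixes `e` because `Φ(e, u) ≠ 0`. -/
theorem exists_hyperbolic_pair (h2 : (2 : K) ≠ 0) {Φ : LinearMap.BilinForm K V} (hs : Φ.IsSymm)
    (hY : (Φ.restrict Y).Nondegenerate) (hrank : 2 ≤ Module.finrank K Y)
    (hG : ∀ g ∈ 𝒢, ∀ x y, Φ (g x) (g y) = Φ x y)
    (hspan : Y ≤ Submodule.span K {v | v ∈ Y ∧ IsCommonEigenvector 𝒢 v})
    (hfix : ∀ v ∈ Y, IsCommonEigenvector 𝒢 v → Φ v v ≠ 0 → ∀ g ∈ 𝒢, g v = v) :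
    ∃ e ∈ Y, ∃ f ∈ Y, IsCommonEigenvector 𝒢 e ∧ IsCommonEigenvector 𝒢 f ∧ Φ e e = 0 ∧ Φ f f = 0 ∧
      Φ e f = 1 := by
  obtain ⟨e, he, heig, he0, hee⟩ := exists_isotropic_eigenvector hs hrank hspan hfix
  obtain ⟨u, hu, hueig, heu⟩ : ∃ u ∈ Y, IsCommonEigenvector 𝒢 u ∧ Φ e u ≠ 0 := by
    by_contra! hcon
    refine he0 ((restrict_nondegenerate_iff hs).1 hY e he fun z hz => ?_)
    replace hz := hspan hz
    induction hz using Submodule.span_induction with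
    | mem v hv => exact hcon v hv.1 hv.2
    | zero => exact map_zero _
    | add x y _ _ hx hy => rw [map_add, hx, hy, add_zero]
    | smul a x _ hx => rw [map_smul, hx, smul_zero]
  have hue : Φ u e = Φ e u := hs.eq u e
  refine ⟨e, he, (Φ e u)⁻¹ • (u - (Φ u u / (2 * Φ e u)) • e),
    Submodule.smul_mem _ _ (sub_mem hu (Submodule.smul_mem _ _ he)), heig, fun g hg => ?_, hee,
    ?_, ?_⟩
  · obtain ⟨c, hc⟩ := heig g hg
    by_cases huu : Φ u u = 0
    · obtain ⟨d, hd⟩ := hueig g hg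
      exact ⟨d, by rw [huu, zero_div, zero_smul, sub_zero, map_smul, hd, smul_comm]⟩
    · have h1 := hfix u hu hueig huu g hg
      have h3 := hG g hg e u
      rw [hc, h1, map_smul, LinearMap.smul_apply, smul_eq_mul] at h3
      have h4 : c = 1 := by
        have : (c - 1) * Φ e u = 0 := by linear_combination h3
        exact sub_eq_zero.1 ((mul_eq_zero.1 this).resolve_right heu)
      exact ⟨1, by rw [map_smul, map_sub, map_smul, hc, h1, h4, one_smul, one_smul]⟩
  · simp only [map_sub, map_smul, LinearMap.sub_apply, LinearMap.smul_apply, smul_eq_mul, hee, hue]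
    field_simp
    ring
  · simp only [map_sub, map_smul, smul_eq_mul, hee]
    field_simp
    ring

end Existence

end Hyperbolic

end Datum

end

end OddNorm

namespace OddNorm

noncomputable section

namespace Datum

section Existence

variable {K V : Type*} [Field K] [AddCommGroup V] [Module K V] [FiniteDimensional K V]
  {D : Datum K V} {Y : Submodule K V} {m : ℕ} {b : HypIndex m → V}

/-- A family with the Gram matrix of a hyperbolic basis is a basis if it has the right size. -/
theorem isHypBasis_of_gram (hgram : ∀ i j, D.Φ (b i) (b j) = if j = i.dual then 1 else 0)
    (hmem : ∀ i, b i ∈ Y) (hrank : Module.finrank K Y = 2 * m + 1) : IsHypBasis D Y b := by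
  have h0 : IsHypBasis D (Submodule.span K (Set.range b)) b := ⟨hgram, rfl⟩
  refine ⟨hgram, Submodule.eq_of_le_of_finrank_eq ?_ (h0.finrank_eq.trans hrank.symm)⟩
  rw [Submodule.span_le]
  rintro _ ⟨i, rfl⟩
  exact hmem i

variable [IsAlgClosed K] {𝒢 : Set (V ≃ₗ[K] V)}

/-- Induction by splitting off hyperbolic planes spanned by common eigenvectors; in dimension one a
square root normalizes the last vector. The condition that anisotropic eigenvectors are fixed comes
from connectedness when `𝒢` is a torus, from the absence of the eigenvalue `-1` when `𝒢 = {γ}`, and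
is empty when `𝒢 = ∅`. -/
theorem exists_hypBasis_of_eigenvectors (h2 : (2 : K) ≠ 0) (hs : D.Φ.IsSymm)
    (hG : ∀ g ∈ 𝒢, ∀ x y, D.Φ (g x) (g y) = D.Φ x y) (m : ℕ) :
    ∀ Y : Submodule K V, (D.Φ.restrict Y).Nondegenerate → Module.finrank K Y = 2 * m + 1 →
      Y ≤ Submodule.span K {v | v ∈ Y ∧ IsCommonEigenvector 𝒢 v} →
      (∀ v ∈ Y, IsCommonEigenvector 𝒢 v → D.Φ v v ≠ 0 → ∀ g ∈ 𝒢, g v = v) →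
      ∃ b : HypIndex m → V, IsHypBasis D Y b ∧ (∀ i, IsCommonEigenvector 𝒢 (b i)) ∧
        ∀ g ∈ 𝒢, g (b none) = b none := by
  induction m with
  | zero =>
    intro Y hY hrank hspan hfix
    obtain ⟨u, hu, hu0⟩ : ∃ u ∈ {v | v ∈ Y ∧ IsCommonEigenvector 𝒢 v}, u ≠ 0 := by
      by_contra! hcon
      have h1 : Y = ⊥ := by
        rw [eq_bot_iff]
        exact hspan.trans (Submodule.span_le.2 fun v hv => (Submodule.mem_bot K).2 (hcon v hv))
      rw [h1, finrank_bot] at hrank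
      omega
    have huu : D.Φ u u ≠ 0 := by
      intro h0
      refine hu0 ((restrict_nondegenerate_iff hs).1 hY u hu.1 fun z hz => ?_)
      have hne : (⟨u, hu.1⟩ : Y) ≠ 0 := fun h => hu0 (congrArg Subtype.val h)
      obtain ⟨c, hc⟩ := (finrank_eq_one_iff_of_nonzero' _ hne).1 hrank ⟨z, hz⟩
      have hz' : z = c • u := (congrArg Subtype.val hc).symm
      rw [hz', map_smul, h0, smul_zero]
    obtain ⟨a, ha⟩ := IsAlgClosed.exists_pow_nat_eq (D.Φ u u)⁻¹ (n := 2) (by norm_num)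
    refine ⟨fun _ => a • u, isHypBasis_of_gram ?_ (fun _ => Submodule.smul_mem _ _ hu.1) hrank,
      fun _ g hg => ?_, fun g hg => ?_⟩
    · rintro (_ | ⟨i, -⟩) (_ | ⟨j, -⟩)
      · simp only [HypIndex.dual_none, if_true, map_smul, LinearMap.smul_apply, smul_eq_mul]
        rw [← mul_assoc, ← pow_two, ha, inv_mul_cancel₀ huu]
      · exact j.elim0
      · exact i.elim0
      · exact i.elim0
    · obtain ⟨c, hc⟩ := hu.2 g hg
      exact ⟨c, by rw [map_smul, hc, smul_comm]⟩
    · rw [map_smul, hfix u hu.1 hu.2 huu g hg]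
  | succ m ih =>
    intro Y hY hrank hspan hfix
    obtain ⟨e, he, f, hf, heig, hfeig, hee, hff, hef⟩ :=
      exists_hyperbolic_pair h2 hs hY (by omega) hG hspan hfix
    have hfe : D.Φ f e = 1 := (hs.eq f e).trans hef
    let L : Y →ₗ[K] (Fin 2 → K) := LinearMap.pi ![D.Φ e ∘ₗ Y.subtype, D.Φ f ∘ₗ Y.subtype]
    have hL0 : ∀ y, L y 0 = D.Φ e y := fun _ => rfl
    have hL1 : ∀ y, L y 1 = D.Φ f y := fun _ => rfl
    let Y' : Submodule K V := (LinearMap.ker L).map Y.subtype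
    have hY'mem : ∀ v, v ∈ Y' ↔ v ∈ Y ∧ D.Φ e v = 0 ∧ D.Φ f v = 0 := by
      intro v
      constructor
      · rintro ⟨y, hy, rfl⟩
        exact ⟨y.2, congrFun (LinearMap.mem_ker.1 hy) 0, congrFun (LinearMap.mem_ker.1 hy) 1⟩
      · rintro ⟨hv, h0, h1⟩
        refine ⟨⟨v, hv⟩, LinearMap.mem_ker.2 (funext fun i => ?_), rfl⟩
        fin_cases i
        · exact h0
        · exact h1
    have hrank' : Module.finrank K Y' = 2 * m + 1 := by
      have hLs : Function.Surjective L := by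
        intro w
        refine ⟨⟨w 0 • f + w 1 • e, add_mem (Submodule.smul_mem _ _ hf)
          (Submodule.smul_mem _ _ he)⟩, funext fun i => ?_⟩
        fin_cases i
        · change D.Φ e _ = _
          simp [hee, hef]
        · change D.Φ f _ = _
          simp [hff, hfe]
      have h3 := LinearMap.finrank_range_add_finrank_ker L
      rw [LinearMap.range_eq_top.2 hLs, finrank_top, Module.finrank_fin_fun] at h3
      rw [Submodule.finrank_map_subtype_eq]
      omega
    -- The orthogonal projection off the plane of `e` and `f`. It maps common eigenvectors to common
    -- eigenvectors, so those in `Y'` span `Y'`.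
    let π : V →ₗ[K] V := LinearMap.id - LinearMap.toSpanSingleton K V e ∘ₗ D.Φ f -
      LinearMap.toSpanSingleton K V f ∘ₗ D.Φ e
    have hπ : ∀ v, π v = v - D.Φ f v • e - D.Φ e v • f := fun v => rfl
    have hπY : ∀ v ∈ Y, π v ∈ Y' := by
      intro v hv
      rw [hY'mem, hπ]
      refine ⟨sub_mem (sub_mem hv (Submodule.smul_mem _ _ he)) (Submodule.smul_mem _ _ hf), ?_, ?_⟩
      · simp [hee, hef]
      · simp [hff, hfe]
    have hπY' : ∀ v ∈ Y', π v = v := by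
      intro v hv
      obtain ⟨-, h0, h1⟩ := (hY'mem v).1 hv
      rw [hπ, h0, h1]
      simp
    have hnd : (D.Φ.restrict Y').Nondegenerate := by
      rw [restrict_nondegenerate_iff hs] at hY ⊢
      intro y hy hy0
      obtain ⟨hyY, h0, h1⟩ := (hY'mem y).1 hy
      refine hY y hyY fun z hz => ?_
      have h3 := hy0 _ (hπY z hz)
      rw [hπ, map_sub, map_sub, map_smul, map_smul, hs.eq y e, hs.eq y f,
        h0, h1] at h3
      simpa using h3
    have heigπ : ∀ v, IsCommonEigenvector 𝒢 v → IsCommonEigenvector 𝒢 (π v) := by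
      intro v hv g hg
      obtain ⟨c, hc⟩ := heig g hg
      obtain ⟨c', hc'⟩ := hfeig g hg
      obtain ⟨d, hd⟩ := hv g hg
      refine ⟨d, ?_⟩
      have e1 := hG g hg e f
      have e2 := hG g hg e v
      have e3 := hG g hg f v
      rw [hc, hc'] at e1
      rw [hc, hd] at e2
      rw [hc', hd] at e3
      simp only [map_smul, LinearMap.smul_apply, smul_eq_mul, hef] at e1 e2 e3
      rw [hπ, map_sub, map_sub, map_smul, map_smul, hc, hc', hd, smul_sub, smul_sub, smul_smul,
        smul_smul, smul_smul, smul_smul]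
      congr 2
      · congr 1
        linear_combination d * D.Φ f v * e1 - c * e3
      · linear_combination d * D.Φ e v * e1 - c' * e2
    have hspan' : Y' ≤ Submodule.span K {v | v ∈ Y' ∧ IsCommonEigenvector 𝒢 v} := by
      intro v hv
      have h3 : π v ∈ (Submodule.span K {v | v ∈ Y ∧ IsCommonEigenvector 𝒢 v}).map π :=
        ⟨v, hspan ((hY'mem v).1 hv).1, rfl⟩
      rw [hπY' v hv, Submodule.map_span] at h3
      refine Submodule.span_mono ?_ h3
      rintro _ ⟨u, hu, rfl⟩
      exact ⟨hπY u hu.1, heigπ u hu.2⟩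
    obtain ⟨b, hb, hbeig, hbfix⟩ := ih Y' hnd hrank' hspan' fun v hv =>
      hfix v ((hY'mem v).1 hv).1
    have hbe : ∀ i, D.Φ e (b i) = 0 := fun i => ((hY'mem _).1 (hb.mem i)).2.1
    have hbf : ∀ i, D.Φ f (b i) = 0 := fun i => ((hY'mem _).1 (hb.mem i)).2.2
    have hbe' : ∀ i, D.Φ (b i) e = 0 := fun i => (hs.eq _ _).trans (hbe i)
    have hbf' : ∀ i, D.Φ (b i) f = 0 := fun i => (hs.eq _ _).trans (hbf i)
    -- The new pair `(e, f)` gets index 0 and the old pairs are shifted by one.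
    let b' : HypIndex (m + 1) → V := fun i => i.elim (b none) fun p =>
      Fin.cases (if p.2 then e else f) (fun k => b (some (k, p.2))) p.1
    refine ⟨b', isHypBasis_of_gram ?_ ?_ hrank, ?_, hbfix⟩
    · rintro (_ | ⟨i, s⟩) (_ | ⟨j, t⟩)
      · simpa [b', HypIndex.dual] using hb.gram none none
      · refine Fin.cases ?_ (fun j => ?_) j
        · cases t <;> simp [b', HypIndex.dual, hbe', hbf']
        · simpa [b', HypIndex.dual] using hb.gram none (some (j, t))
      · refine Fin.cases ?_ (fun i => ?_) i
        · cases s <;> simp [b', HypIndex.dual, hbe, hbf]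
        · simpa [b', HypIndex.dual] using hb.gram (some (i, s)) none
      · refine Fin.cases ?_ (fun i => ?_) i <;> refine Fin.cases ?_ (fun j => ?_) j
        · cases s <;> cases t <;> simp [b', HypIndex.dual, hee, hef, hff, hfe]
        · cases s <;> simp [b', HypIndex.dual, hbe, hbf, Fin.succ_ne_zero]
        · cases t <;> simp [b', HypIndex.dual, hbe', hbf', (Fin.succ_ne_zero _).symm]
        · simpa [b', HypIndex.dual] using hb.gram (some (i, s)) (some (j, t))
    · rintro (_ | ⟨i, s⟩)
      · exact ((hY'mem _).1 (hb.mem none)).1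
      · refine Fin.cases ?_ (fun i => ?_) i
        · cases s
          · exact hf
          · exact he
        · exact ((hY'mem _).1 (hb.mem (some (i, s)))).1
    · rintro (_ | ⟨i, s⟩)
      · exact hbeig none
      · refine Fin.cases ?_ (fun i => ?_) i
        · cases s
          · exact hfeig
          · exact heig
        · exact hbeig (some (i, s))

theorem exists_hypBasis (h2 : (2 : K) ≠ 0) (hD : D.IsOrthogonal)
    (hY : (D.Φ.restrict Y).Nondegenerate) {m : ℕ} (hrank : Module.finrank K Y = 2 * m + 1) :
    ∃ b : HypIndex m → V, IsHypBasis D Y b := by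
  obtain ⟨b, hb, -⟩ := exists_hypBasis_of_eigenvectors (𝒢 := ∅) h2 hD.symm (by simp) m Y hY hrank
    (fun v hv => Submodule.subset_span ⟨hv, by simp [IsCommonEigenvector]⟩) (by simp)
  exact ⟨b, hb⟩

variable (h2 : (2 : K) ≠ 0) (hD : D.IsOrthogonal) (hY : D.IsNondegSub Y)
include h2 hD hY

/-- A larger torus is commutative, so it centralizes an element of this one with distinct
eigenvalues. Being connected, it lies in the identity component of the centralizer, which is the
torus itself. -/
theorem hypTorus_isMaximalTorus (hb : IsHypBasis D Y b) :
    IsMaximalTorus (D.HY Y) (hypTorus D Y b) := by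
  have : Infinite K := IsAlgClosed.instInfinite
  refine ⟨⟨hypTorus_isTorus hD hY hb, fun g hg => hg.1⟩, ?_⟩
  rintro S ⟨⟨-, hS, B, hB⟩, hSY⟩ hle
  obtain ⟨c, hinj, hc, hc0, -⟩ := exists_generic h2 m
  obtain ⟨γ, hγ, hγc⟩ := exists_mem_hypTorus hD hY hb c hc hc0
  have hreg := isRegularIn_of_injective hD hY hb h2 hγ hγc hinj
  unfold IsRegularIn at hreg
  let _ := zariskiGL K V
  intro g hg
  have h3 := hS.isPreconnected.subset_connectedComponentIn
    (F := {g | g ∈ D.HY Y ∧ g * γ = γ * g}) (one_mem S) (fun s hs => ⟨hSY hs, ?_⟩) hg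
  · rw [hreg] at h3
    exact h3
  · refine LinearEquiv.toLinearMap_injective (B.ext fun i => ?_)
    obtain ⟨a, ha⟩ := hB s hs i
    obtain ⟨d, hd⟩ := hB γ (hle hγ) i
    change s (γ (B i)) = γ (s (B i))
    rw [hd, ha, map_smul, map_smul, ha, hd, smul_comm]

/-- Projecting a diagonalizing basis of `V` to `Y` shows that common eigenvectors span `Y`. An
anisotropic one has eigenvalue `±1`, and `t ↦ Φ(v, t v)` is constant on the connected group `T`, so
it is fixed. This yields a hyperbolic basis of eigenvectors, and maximality gives equality. -/
theorem exists_eq_hypTorus {m : ℕ} (hrank : Module.finrank K Y = 2 * m + 1)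
    {T : Subgroup (V ≃ₗ[K] V)} (hT : IsMaximalTorus (D.HY Y) T) :
    ∃ b : HypIndex m → V, IsHypBasis D Y b ∧ T = hypTorus D Y b := by
  have : Infinite K := IsAlgClosed.instInfinite
  obtain ⟨⟨⟨-, hconn, B, hB⟩, hTY⟩, hmax⟩ := hT
  have hc := isCompl_of_isNondegSub hD hY
  have hspan : Y ≤ Submodule.span K {v | v ∈ Y ∧ IsCommonEigenvector (T : Set (V ≃ₗ[K] V)) v} := by
    let P : V →ₗ[K] V := Y.subtype ∘ₗ proj Y (D.Φ.orthogonal Y)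
    have hP : ∀ g ∈ T, ∀ v, g (P v) = P (g v) := by
      intro g hg v
      have h3 : ((g : V →ₗ[K] V) ∘ₗ P) = P ∘ₗ (g : V →ₗ[K] V) := by
        refine linearMap_ext_of_isNondegSub hD hY (fun y hy => ?_) fun z hz => ?_
        · change g (proj Y _ y : V) = (proj Y _ (g y) : V)
          rw [proj_of_mem_left hc hy, proj_of_mem_left hc (HY_mem hD (hTY hg) hy)]
        · change g (proj Y _ z : V) = (proj Y _ (g z) : V)
          rw [(hTY hg).2 z hz, proj_of_mem_right hc hz]
          simp
      exact LinearMap.congr_fun h3 v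
    intro y hy
    have h3 : P y ∈ (⊤ : Submodule K V).map P := ⟨y, trivial, rfl⟩
    rw [← B.span_eq, Submodule.map_span] at h3
    have h4 : P y = y := proj_of_mem_left hc hy
    rw [h4] at h3
    refine Submodule.span_mono ?_ h3
    rintro _ ⟨_, ⟨i, rfl⟩, rfl⟩
    refine ⟨Subtype.mem _, fun g hg => ?_⟩
    obtain ⟨c, hc⟩ := hB g hg i
    exact ⟨c, by rw [hP g hg, hc, map_smul]⟩
  have hfixed : ∀ v ∈ Y, IsCommonEigenvector (T : Set (V ≃ₗ[K] V)) v → D.Φ v v ≠ 0 →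
      ∀ g ∈ (T : Set (V ≃ₗ[K] V)), g v = v := by
      intro v hv heig hvv g hg
      have hval : ∀ g ∈ (T : Set (V ≃ₗ[K] V)), ∃ c : K, g v = c • v ∧ (c = 1 ∨ c = -1) := by
        intro g hg
        obtain ⟨c, hc⟩ := heig g hg
        refine ⟨c, hc, mul_self_eq_one_iff.1 ?_⟩
        have h3 := (hTY hg).1 v v
        rw [hc] at h3
        simp only [map_smul, LinearMap.smul_apply, smul_eq_mul] at h3
        have h4 : (c * c - 1) * D.Φ v v = 0 := by linear_combination h3
        exact sub_eq_zero.1 ((mul_eq_zero.1 h4).resolve_right hvv)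
      have hne : D.Φ v v ≠ -D.Φ v v := fun h => by
        have h3 : 2 * D.Φ v v = 0 := by linear_combination h
        exact (mul_ne_zero h2 hvv) h3
      have h3 := eq_of_isPreconnected
        (@IsConnected.isPreconnected _ (zariskiGL K V) _ hconn) (coefficient_mem_polyFun (D.Φ v) v) hne
        (fun g hg => by
          obtain ⟨c, hc, rfl | rfl⟩ := hval g hg
          · left; change D.Φ v (g v) = _; rw [hc, one_smul]
          · right; change D.Φ v (g v) = _; rw [hc]; simp) (one_mem T) rfl hg
      have h3 : D.Φ v (g v) = D.Φ v v := h3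
      obtain ⟨c, hc, rfl | rfl⟩ := hval g hg
      · rw [hc, one_smul]
      · rw [hc] at h3
        exact absurd (by simpa using h3.symm) hne
  obtain ⟨b, hb, heig, hfix⟩ := exists_hypBasis_of_eigenvectors (𝒢 := (T : Set (V ≃ₗ[K] V))) h2
    hD.symm (fun g hg => (hTY hg).1) m Y hY.2.1 hrank hspan hfixed
  have hle : T ≤ hypTorus D Y b := fun g hg => ⟨hTY hg, fun i => heig i g hg, hfix g hg⟩
  exact ⟨b, hb, le_antisymm hle (hmax ⟨hypTorus_isTorus hD hY hb, fun g hg => hg.1⟩ hle)⟩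

end Existence

/-! ### Transitivity of `H` over an algebraically closed field -/

section Orthonormal

variable {K V : Type*} [Field K] [IsAlgClosed K] [AddCommGroup V] [Module K V]
  [FiniteDimensional K V] {D : Datum K V}

theorem exists_orthonormal (h2 : (2 : K) ≠ 0) {Φ : LinearMap.BilinForm K V} (hs : Φ.IsSymm)
    {A : Submodule K V} (hA : (Φ.restrict A).Nondegenerate) {r : ℕ}
    (hr : Module.finrank K A = r) :
    ∃ c : Fin r → V, (∀ i j, Φ (c i) (c j) = if i = j then 1 else 0) ∧
      LinearIndependent K c ∧ Submodule.span K (Set.range c) = A := by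
  subst hr
  have : Invertible (2 : K) := invertibleOfNonzero h2
  obtain ⟨v, hv⟩ := LinearMap.BilinForm.exists_orthogonal_basis (B := Φ.restrict A)
    ⟨fun x y => hs.eq x y⟩
  have hvv : ∀ i, Φ (v i) (v i) ≠ 0 := fun i =>
    LinearMap.BilinForm.iIsOrtho.not_isOrtho_basis_self_of_nondegenerate hv hA i
  choose a ha using fun i => IsAlgClosed.exists_pow_nat_eq (Φ (v i) (v i))⁻¹ (n := 2) (by norm_num)
  have hmem : ∀ i, a i • (v i : V) ∈ A := fun i => Submodule.smul_mem _ _ (v i).2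
  have hgram : ∀ i j, Φ (a i • (v i : V)) (a j • (v j : V)) = if i = j then 1 else 0 := by
    intro i j
    simp only [map_smul, LinearMap.smul_apply, smul_eq_mul]
    split_ifs with h
    · subst h
      rw [← mul_assoc, ← pow_two, ha, inv_mul_cancel₀ (hvv i)]
    · have : Φ (v i) (v j) = 0 := hv h
      rw [this, mul_zero, mul_zero]
  have hli : LinearIndependent K fun i => a i • (v i : V) := by
    refine (restrict_nondegenerate_of_gram hs (Φ := Φ) ?_).1
    have : (Matrix.of fun i j => Φ (a i • (v i : V)) (a j • (v j : V))) = 1 := by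
      ext i j
      rw [Matrix.of_apply, hgram, Matrix.one_apply]
    rw [this, Matrix.det_one]
    exact one_ne_zero
  refine ⟨fun i => a i • (v i : V), hgram, hli, Submodule.eq_of_le_of_finrank_eq ?_ ?_⟩
  · rw [Submodule.span_le]
    rintro _ ⟨i, rfl⟩
    exact hmem i
  · rw [finrank_span_eq_card hli, Fintype.card_fin]

variable (h2 : (2 : K) ≠ 0) (hD : D.IsOrthogonal)
include h2 hD

theorem exists_isNondegSub (hle : Module.finrank K D.W ≤ Module.finrank K D.X) :
    ∃ Y, D.IsNondegSub Y := by
  obtain ⟨c, hgram, hli, hspan⟩ := exists_orthonormal h2 hD.symm hD.restrict_X_nondegenerate rfl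
  let c' := c ∘ Fin.castLE hle
  have hdet : (Matrix.of fun i j => D.Φ (c' i) (c' j)).det ≠ 0 := by
    have : (Matrix.of fun i j => D.Φ (c' i) (c' j)) = 1 := by
      ext i j
      rw [Matrix.of_apply, Matrix.one_apply]
      simp [c', hgram]
    rw [this, Matrix.det_one]
    exact one_ne_zero
  obtain ⟨h3, h4⟩ := restrict_nondegenerate_of_gram hD.symm hdet
  refine ⟨_, ?_, h4, by rw [finrank_span_eq_card h3, Fintype.card_fin]⟩
  rw [← hspan]
  exact Submodule.span_mono (Set.range_comp_subset_range _ _)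

/-- `H` acts transitively on the hyperbolic bases of nondegenerate subspaces of `X`. -/
theorem exists_mem_H_map_hypBasis {m : ℕ} {Y Y' : Submodule K V} (hY : D.IsNondegSub Y)
    (hY' : D.IsNondegSub Y') {b b' : HypIndex m → V} (hb : IsHypBasis D Y b)
    (hb' : IsHypBasis D Y' b') : ∃ h ∈ D.H, ∀ i, h (b i) = b' i := by
  -- Complete `b` by an orthonormal basis of the orthogonal complement of `Y` in `X`. The Gram
  -- matrix of the resulting basis of `X` does not depend on `Y`, so matching two such bases is an
  -- isometry.
  have key : ∀ {Y : Submodule K V} {b : HypIndex m → V}, D.IsNondegSub Y → IsHypBasis D Y b →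
      ∃ c : Fin (Module.finrank K D.X - Module.finrank K D.W) → V,
        (∀ i j, D.Φ (c i) (c j) = if i = j then 1 else 0) ∧ (∀ i j, D.Φ (b i) (c j) = 0) ∧
        (∀ i j, D.Φ (c i) (b j) = 0) ∧ LinearIndependent K (Sum.elim b c) ∧
        Submodule.span K (Set.range (Sum.elim b c)) = D.X := by
    intro Y b hY hb
    have hc := isCompl_of_isNondegSub hD hY
    let Z : Submodule K V := D.Φ.orthogonal Y ⊓ D.X
    have hsup : Y ⊔ Z = D.X := by
      refine le_antisymm (sup_le hY.1 inf_le_right) fun x hx => ?_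
      have h3 := proj_add_proj hc x
      rw [← h3]
      refine Submodule.add_mem_sup (Subtype.mem _) ⟨Subtype.mem _, ?_⟩
      rw [← h3] at hx
      exact (Submodule.add_mem_iff_right _ (hY.1 (Subtype.mem _))).1 hx
    have hinf : Y ⊓ Z = ⊥ := by
      rw [eq_bot_iff, ← hc.inf_eq_bot]
      exact inf_le_inf_left _ inf_le_left
    have hZ : (D.Φ.restrict Z).Nondegenerate := by
      rw [restrict_nondegenerate_iff hD.symm]
      intro z hz h0
      refine hD.eq_zero_of_mem_X hz.2 fun x hx => ?_
      rw [← hsup] at hx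
      obtain ⟨y, hy, z', hz', rfl⟩ := Submodule.mem_sup.1 hx
      rw [map_add, h0 z' hz', hD.comm, hz.1 y hy, add_zero]
    have hrank : Module.finrank K Z = Module.finrank K D.X - Module.finrank K D.W := by
      have h3 := Submodule.finrank_sup_add_finrank_inf_eq Y Z
      rw [hsup, hinf, finrank_bot, hY.2.2] at h3
      omega
    obtain ⟨c, h3, h4, h5⟩ := exists_orthonormal h2 hD.symm hZ hrank
    have hcZ : ∀ i, c i ∈ Z := fun i => h5 ▸ Submodule.subset_span ⟨i, rfl⟩
    have hbc : ∀ i j, D.Φ (b i) (c j) = 0 := fun i j => (hcZ j).1 _ (hb.mem i)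
    refine ⟨c, h3, hbc, fun i j => (hD.comm _ _).trans (hbc j i), ?_, ?_⟩
    · refine hb.linearIndependent.sum_type h4 ?_
      rw [hb.span, h5]
      exact disjoint_iff.2 hinf
    · rw [Set.Sum.elim_range, Submodule.span_union, hb.span, h5, hsup]
  obtain ⟨c, h1, h3, h4, h5, h6⟩ := key hY hb
  obtain ⟨c', h1', h3', h4', h5', h6'⟩ := key hY' hb'
  obtain ⟨u, hu, huv, huX⟩ := exists_isometry_of_families hD.symm hD.nondegenerate
    hD.restrict_X_nondegenerate h5 h6 (v' := Sum.elim b' c')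
    (fun i => h6'.le (Submodule.subset_span (Set.mem_range_self i))) (by
      rintro (i | i) (j | j)
      · exact (hb'.gram i j).trans (hb.gram i j).symm
      · exact (h3' i j).trans (h3 i j).symm
      · exact (h4' i j).trans (h4 i j).symm
      · exact (h1' i j).trans (h1 i j).symm)
  rw [hD.orthogonal_X] at huX
  exact ⟨u, ⟨hu, huX⟩, fun i => huv (Sum.inl i)⟩

end Orthonormal

end Datum

end

end OddNorm

namespace OddNorm

noncomputable section

namespace Datum

/-! ### The support of the norm -/

section Field

variable {K V : Type*} [Field K] [AddCommGroup V] [Module K V] [FiniteDimensional K V]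
  {D : Datum K V} (hD : D.IsOrthogonal) {Y : Submodule K V}
include hD

theorem norm_isometry {n : Module.End K V} (hn : n ∈ D.N') (v v' : V) :
    D.Φ (D.norm n v) (D.norm n v') = D.Φ v v' := by
  obtain ⟨w, hw, x, hx, u, hu, rfl⟩ := hD.exists_decomposition v
  obtain ⟨w', hw', x', hx', u', hu', rfl⟩ := hD.exists_decomposition v'
  simp only [map_add, norm_apply_W hD n hw, norm_apply_W hD n hw', norm_apply_W' hD n hu,
    norm_apply_W' hD n hu', LinearMap.add_apply, norm_isometry_X hD hn hx hx',
    IsOrthogonal.apply_W_X hw (norm_mem_X hD n hx'), hD.apply_X_W hw' (norm_mem_X hD n hx),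
    IsOrthogonal.apply_W'_X hu (norm_mem_X hD n hx'),
    hD.apply_X_W' hu' (norm_mem_X hD n hx), IsOrthogonal.apply_W_X hw hx', hD.apply_X_W hw' hx,
    IsOrthogonal.apply_W'_X hu hx', hD.apply_X_W' hu' hx]


/-- Take `γ = ε_Y a`, using `ε_Y² = 1`. -/
theorem exists_mem_HY_of_isNormOn (hY : D.IsNondegSub Y) {a : Module.End K V}
    (ha : IsNormOn D Y a) :
    ∃ γ ∈ D.HY Y, D.eps Y * (γ : Module.End K V) = a ∧
      Set.BijOn (D.eps Y * (γ : Module.End K V) - 1 : Module.End K V) (Y : Set V) (Y : Set V) := by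
  have hiso : ∀ v w, D.Φ ((D.eps Y * a) v) ((D.eps Y * a) w) = D.Φ v w := fun v w =>
    (eps_isometry hD hY _ _).trans (ha.isometry v w)
  have hinj : Function.Injective (D.eps Y * a) := by
    rw [← LinearMap.ker_eq_bot, LinearMap.ker_eq_bot']
    intro v hv
    refine hD.nondegenerate.1 v fun w => ?_
    rw [← hiso, hv, map_zero, LinearMap.zero_apply]
  have he : D.eps Y * ((LinearEquiv.ofInjectiveEndo _ hinj : V ≃ₗ[K] V) : Module.End K V) = a := by
    have : ((LinearEquiv.ofInjectiveEndo _ hinj : V ≃ₗ[K] V) : Module.End K V) = D.eps Y * a := rfl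
    rw [this, ← mul_assoc, eps_mul_eps hD hY, one_mul]
  refine ⟨LinearEquiv.ofInjectiveEndo _ hinj, ⟨hiso, fun v hv => ?_⟩, he, by rw [he]; exact ha.bijOn⟩
  change D.eps Y (a v) = v
  rw [ha.fix v hv, eps_apply_of_mem_orthogonal hD hY hv]

variable {ι : Type*} [Fintype ι] [DecidableEq ι] (w : Module.Basis ι K D.W')

theorem norm_sum_xiFamily {n : Module.End K V} (hn : n ∈ D.N') (q : ι → K) :
    D.norm n (∑ i, q i • xiFamily w n i) =
      -∑ i, (((etaMatrix w n)⁻¹ * (etaMatrix w n).transpose).mulVec q) i • xiFamily w n i := by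
  simp only [map_sum, map_smul, norm_xiFamily w hD hn, smul_neg, Finset.sum_neg_distrib,
    Finset.smul_sum, smul_smul, Matrix.mulVec, dotProduct, Finset.sum_smul]
  rw [Finset.sum_comm]
  simp only [mul_comm]

/-- One determinant does two things. `-(B + Bᵀ)` is the Gram matrix of the family, which gives
independence and nondegeneracy, and `Norm - 1` has matrix `-B⁻¹(B + Bᵀ)` on the span. On the
orthogonal complement `ξ` vanishes, so the norm is trivial there. -/
theorem isNondegSub_span_xiFamily {n : Module.End K V} (hn : n ∈ D.N')
    (hdet : (etaMatrix w n + (etaMatrix w n).transpose).det ≠ 0) :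
    LinearIndependent K (xiFamily w n) ∧
      D.IsNondegSub (Submodule.span K (Set.range (xiFamily w n))) ∧
      IsNormOn D (Submodule.span K (Set.range (xiFamily w n))) (D.norm n) := by
  have hgram : (Matrix.of fun i j => D.Φ (xiFamily w n i) (xiFamily w n j)).det ≠ 0 := by
    have : (Matrix.of fun i j => D.Φ (xiFamily w n i) (xiFamily w n j)) =
        -(etaMatrix w n + (etaMatrix w n).transpose) := by
      ext i j
      rw [Matrix.of_apply, gram_xiFamily w hD hn.1, Matrix.neg_apply]
    rw [this, Matrix.det_neg]
    exact mul_ne_zero (pow_ne_zero _ (neg_ne_zero.2 one_ne_zero)) hdet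
  obtain ⟨hli, hnd⟩ := restrict_nondegenerate_of_gram hD.symm hgram
  set Y := Submodule.span K (Set.range (xiFamily w n)) with hYdef
  have hYX : Y ≤ D.X := by
    rw [hYdef, Submodule.span_le]
    rintro _ ⟨i, rfl⟩
    exact Subtype.mem _
  have hmem : ∀ y ∈ Y, ∃ q : ι → K, ∑ i, q i • xiFamily w n i = y := fun y hy =>
    (Submodule.mem_span_range_iff_exists_fun K).1 hy
  have hsum : ∀ q : ι → K, ∑ i, q i • xiFamily w n i ∈ Y := fun q =>
    (Submodule.mem_span_range_iff_exists_fun K).2 ⟨q, rfl⟩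
  have hmaps : ∀ y ∈ Y, (D.norm n - 1) y ∈ Y := by
    intro y hy
    obtain ⟨q, rfl⟩ := hmem y hy
    refine sub_mem ?_ hy
    rw [norm_sum_xiFamily hD w hn]
    exact neg_mem (hsum _)
  have hinj : ∀ y ∈ Y, (D.norm n - 1) y = 0 → y = 0 := by
    intro y hy h0
    obtain ⟨q, rfl⟩ := hmem y hy
    have h1 : D.norm n (∑ i, q i • xiFamily w n i) - ∑ i, q i • xiFamily w n i = 0 := h0
    rw [norm_sum_xiFamily hD w hn, ← neg_add', neg_eq_zero, ← Finset.sum_add_distrib] at h1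
    simp only [← add_smul] at h1
    have h3 := Fintype.linearIndependent_iff.1 hli _ h1
    have hB : IsUnit (etaMatrix w n).det := ((mem_N'_iff_det w hD hn.1).1 hn).isUnit
    have h4 : (etaMatrix w n + (etaMatrix w n).transpose).mulVec q = 0 := by
      have h5 : ((etaMatrix w n)⁻¹ * (etaMatrix w n).transpose).mulVec q + q = 0 := funext h3
      have h6 := congrArg (etaMatrix w n).mulVec h5
      rw [Matrix.mulVec_add, Matrix.mulVec_mulVec, ← mul_assoc, Matrix.mul_nonsing_inv _ hB,
        one_mul, Matrix.mulVec_zero] at h6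
      rw [Matrix.add_mulVec, add_comm]
      exact h6
    have h5 : q = 0 := by
      by_contra hq
      exact hdet (Matrix.exists_mulVec_eq_zero_iff.1 ⟨q, hq, h4⟩)
    simp [h5]
  refine ⟨hli, ⟨hYX, hnd, ?_⟩, ⟨norm_isometry hD hn, fun z hz => ?_, ?_⟩⟩
  · rw [finrank_span_eq_card hli, ← Module.finrank_eq_card_basis w, hD.finrank_W']
  · have hz' : D.norm n z - z = 0 := by
      obtain ⟨w₁, hw₁, x, hx, u, hu, rfl⟩ := hD.exists_decomposition z
      have hxi : D.xiOf n ⟨x, hx⟩ = 0 := by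
        refine eq_zero_of_apply_basis w hD fun i => ?_
        rw [← hD.xiStar_apply]
        have h3 : ((D.xiStar (D.xiOf n) (w i) : D.X) : V) ∈ Y := by
          rw [hYdef, span_xiFamily w hD hn.1]
          exact ⟨w i, rfl⟩
        have h4 := hz _ h3
        change D.Φ _ _ = 0 at h4
        rw [map_add, map_add, hD.apply_X_W hw₁ (hYX h3), hD.apply_X_W' hu (hYX h3)] at h4
        simpa using h4
      have hx0 : D.norm n x = x := by
        change x + _ = x
        simp only [LinearMap.comp_apply]
        rw [show D.projX x = ⟨x, hx⟩ from Subtype.ext (hD.projX_of_mem_X hx), hxi]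
        simp
      rw [map_add, map_add, norm_apply_W hD n hw₁, hx0, norm_apply_W' hD n hu, sub_self]
    exact sub_eq_zero.1 hz'
  · let f : Y →ₗ[K] Y := (D.norm n - 1).restrict hmaps
    have hf : Function.Injective f := by
      rw [← LinearMap.ker_eq_bot, LinearMap.ker_eq_bot']
      intro y hy
      exact Subtype.ext (hinj y y.2 (congrArg Subtype.val hy))
    refine ⟨hmaps, fun y hy z hz h => ?_, fun y hy => ?_⟩
    · exact congrArg Subtype.val (@hf ⟨y, hy⟩ ⟨z, hz⟩ (Subtype.ext h))
    · obtain ⟨z, hz⟩ := LinearMap.injective_iff_surjective.1 hf ⟨y, hy⟩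
      exact ⟨z, z.2, congrArg Subtype.val hz⟩

end Field

/-! ### The matrix criterion for `N_reg` -/

section Nreg

variable {K V : Type*} [Field K] [IsAlgClosed K] [AddCommGroup V] [Module K V]
  [FiniteDimensional K V] {D : Datum K V} (h2 : (2 : K) ≠ 0) (hD : D.IsOrthogonal)
  {Y : Submodule K V} {m : ℕ} (hrank : Module.finrank K D.W = 2 * m + 1)
  {ι : Type*} [Fintype ι] [DecidableEq ι] (w : Module.Basis ι K D.W')
include h2 hD hrank

/-- On `Y`, `γ = -Norm` has matrix `B⁻¹Bᵀ`, so the eigenvectors of this matrix give an eigenbasis of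
`γ`. An anisotropic eigenvector has eigenvalue `±1`, and `-1` would be a fixed vector of the norm in
`Y`; so `γ` alone satisfies the hypotheses for a hyperbolic basis of eigenvectors. -/
theorem exists_hypBasis_of_norm {n : Module.End K V} (hn : n ∈ D.N')
    (hdet : (etaMatrix w n + (etaMatrix w n).transpose).det ≠ 0)
    (hdist : HasDistinctEigenvalues ((etaMatrix w n)⁻¹ * (etaMatrix w n).transpose))
    (hYn : Y = Submodule.span K (Set.range (xiFamily w n)))
    {γ : V ≃ₗ[K] V} (hγ : γ ∈ D.HY Y) (hγn : D.eps Y * (γ : Module.End K V) = D.norm n) :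
    ∃ (b : HypIndex m → V) (c : HypIndex m → K), IsHypBasis D Y b ∧ Function.Injective c ∧
      (∀ i, γ (b i) = c i • b i) ∧ γ ∈ hypTorus D Y b := by
  obtain ⟨hli, hY, hnorm⟩ := isNondegSub_span_xiFamily hD w hn hdet
  rw [← hYn] at hY hnorm
  obtain ⟨d, hd, hdq⟩ := hdist
  choose q hq0 hq using hdq
  have hγY : ∀ y ∈ Y, γ y = -D.norm n y := by
    intro y hy
    rw [← hγn]
    change _ = -D.eps Y (γ y)
    rw [eps_apply_of_mem hD hY (HY_mem hD hγ hy), neg_neg]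
  let u : ι → V := fun i => ∑ j, q i j • xiFamily w n j
  have huY : ∀ i, u i ∈ Y := fun i => by
    rw [hYn]
    exact (Submodule.mem_span_range_iff_exists_fun K).2 ⟨q i, rfl⟩
  have hu0 : ∀ i, u i ≠ 0 := fun i h => hq0 i (funext (Fintype.linearIndependent_iff.1 hli _ h))
  have hγu : ∀ i, γ (u i) = d i • u i := by
    intro i
    rw [hγY _ (huY i), norm_sum_xiFamily hD w hn, neg_neg, hq, Finset.smul_sum]
    simp only [Pi.smul_apply, smul_eq_mul, smul_smul]
  have hcard : Fintype.card ι = 2 * m + 1 := by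
    rw [← Module.finrank_eq_card_basis w, hD.finrank_W', hrank]
  have huli : LinearIndependent K u := by
    refine Module.End.eigenvectors_linearIndependent' (γ : Module.End K V) d hd u fun i => ?_
    exact ⟨Module.End.mem_eigenspace_iff.2 (hγu i), hu0 i⟩
  have huspan : Submodule.span K (Set.range u) = Y := by
    refine Submodule.eq_of_le_of_finrank_eq ?_ ?_
    · rw [Submodule.span_le]
      rintro _ ⟨i, rfl⟩
      exact huY i
    · rw [finrank_span_eq_card huli, hcard, hY.2.2, hrank]
  have hfix : ∀ v ∈ Y, IsCommonEigenvector {γ} v → D.Φ v v ≠ 0 →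
      ∀ g ∈ ({γ} : Set (V ≃ₗ[K] V)), g v = v := by
    rintro v hv heig hvv g rfl
    obtain ⟨c, hc⟩ := heig g rfl
    have h3 := hγ.1 v v
    rw [hc] at h3
    simp only [map_smul, LinearMap.smul_apply, smul_eq_mul] at h3
    have h4 : (c * c - 1) * D.Φ v v = 0 := by linear_combination h3
    rcases mul_self_eq_one_iff.1 (sub_eq_zero.1 ((mul_eq_zero.1 h4).resolve_right hvv)) with
      rfl | rfl
    · rw [hc, one_smul]
    · have h5 : (D.norm n - 1) v = (D.norm n - 1) 0 := by
        have h6 := hγY v hv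
        rw [hc, neg_smul, one_smul, neg_inj] at h6
        rw [map_zero, LinearMap.sub_apply, ← h6]
        exact sub_self v
      have h6 := hnorm.bijOn.injOn hv (zero_mem Y) h5
      rw [h6] at hvv
      exact absurd (by simp) hvv
  obtain ⟨b, hb, heig, hb0⟩ := exists_hypBasis_of_eigenvectors (𝒢 := {γ}) h2 hD.symm
    (by rintro g rfl; exact hγ.1) m Y hY.2.1 (hY.2.2.trans hrank) (by
      conv_lhs => rw [← huspan]
      refine Submodule.span_mono ?_
      rintro _ ⟨i, rfl⟩
      refine ⟨huY i, ?_⟩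
      rintro g rfl
      exact ⟨d i, hγu i⟩) hfix
  choose c hc using fun i => heig i γ rfl
  -- The distinct eigenvalues `d` occur among the `c`, and both families have `2m + 1` members, so
  -- the `c` are distinct too.
  have hdc : ∀ i, ∃ j, c j = d i := by
    intro i
    by_contra! hcon
    have h3 : ∀ j, D.Φ (b (HypIndex.dual j)) (u i) = 0 := by
      intro j
      have h4 := hγu i
      rw [hb.eq_sum (huY i), map_sum, Finset.smul_sum] at h4
      simp only [map_smul, hc, smul_smul] at h4
      have h5 := congrArg (D.Φ (b (HypIndex.dual j))) h4
      rw [hb.apply_sum, hb.apply_sum] at h5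
      have h6 : (c j - d i) * D.Φ (b (HypIndex.dual j)) (u i) = 0 := by linear_combination h5
      exact (mul_eq_zero.1 h6).resolve_left (sub_ne_zero.2 (hcon j))
    apply hu0 i
    rw [hb.eq_sum (huY i)]
    simp [h3]
  choose f hf using hdc
  have hfinj : Function.Injective f := fun i j h => hd (by rw [← hf, ← hf, h])
  have hfbij : Function.Bijective f := (Fintype.bijective_iff_injective_and_card f).2
    ⟨hfinj, by rw [hcard, HypIndex.card]⟩
  refine ⟨b, c, hb, fun i j h => ?_, hc, hγ, fun i => ⟨c i, hc i⟩, hb0 γ rfl⟩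
  obtain ⟨i, rfl⟩ := hfbij.2 i
  obtain ⟨j, rfl⟩ := hfbij.2 j
  rw [hf, hf] at h
  rw [hd h]

omit hrank in
/-- The elements of `T_reg`, for a maximal torus `T = T_b`. -/
theorem mem_Treg_hypTorus_iff (hY : D.IsNondegSub Y) {b : HypIndex m → V}
    (hb : IsHypBasis D Y b) {γ : V ≃ₗ[K] V} :
    γ ∈ D.Treg Y (hypTorus D Y b) ↔ γ ∈ hypTorus D Y b ∧
      ∃ c : HypIndex m → K, Function.Injective c ∧ (∀ i, γ (b i) = c i • b i) ∧ ∀ i, c i ≠ -1 := by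
  have : Infinite K := IsAlgClosed.instInfinite
  constructor
  · rintro ⟨hγ, hreg, hbij⟩
    choose c hc using hγ.2.1
    have hneg : ∀ i, c i ≠ -1 := by
      intro i hi
      refine hb.ne_zero i (hbij.injOn (hb.mem i) (zero_mem Y) ?_)
      rw [map_zero, LinearMap.sub_apply]
      change D.eps Y (γ (b i)) - b i = 0
      rw [hc, map_smul, eps_apply_of_mem hD hY (hb.mem i), hi]
      simp
    exact ⟨hγ, c, injective_of_isRegularIn h2 hD hb hγ hc hneg hreg, hc, hneg⟩
  · rintro ⟨hγ, c, hinj, hc, hneg⟩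
    refine ⟨hγ, isRegularIn_of_injective hD hY hb h2 hγ hc hinj, ?_⟩
    -- `ε_Yγ - 1` multiplies `b i` by `-(c i + 1)`, so invertibility on `Y` excludes exactly the
    -- eigenvalue `-1`.
    have hval : ∀ y ∈ Y, (D.eps Y * (γ : Module.End K V) - 1 : Module.End K V) y =
        ∑ i, (-(c i + 1) * D.Φ (b i.dual) y) • b i := by
      intro y hy
      rw [LinearMap.sub_apply]
      change D.eps Y (γ y) - y = _
      rw [eps_apply_of_mem hD hY (HY_mem hD hγ.1 hy)]
      conv_lhs => rw [hb.eq_sum hy]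
      rw [map_sum, ← Finset.sum_neg_distrib, ← Finset.sum_sub_distrib]
      refine Finset.sum_congr rfl fun i _ => ?_
      rw [map_smul, hc, smul_smul, ← neg_smul, ← sub_smul]
      congr 1
      ring
    refine ⟨fun y hy => ?_, fun y hy z hz h => ?_, fun y hy => ?_⟩
    · rw [hval y hy]
      exact sum_mem fun i _ => Submodule.smul_mem _ _ (hb.mem i)
    · rw [hval y hy, hval z hz] at h
      rw [hb.eq_sum hy, hb.eq_sum hz]
      refine Finset.sum_congr rfl fun i _ => ?_
      have h3 := congrArg (D.Φ (b i.dual)) h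
      rw [hb.apply_sum, hb.apply_sum] at h3
      rw [mul_left_cancel₀ (neg_ne_zero.2 fun h0 => hneg i (eq_neg_of_add_eq_zero_left h0)) h3]
    · have hz : ∑ i, (-(c i + 1)⁻¹ * D.Φ (b i.dual) y) • b i ∈ Y :=
        sum_mem fun i _ => Submodule.smul_mem _ _ (hb.mem i)
      refine ⟨_, hz, ?_⟩
      rw [hval _ hz]
      conv_rhs => rw [hb.eq_sum hy]
      refine Finset.sum_congr rfl fun i _ => ?_
      rw [hb.apply_sum]
      have h3 : c i + 1 ≠ 0 := fun h0 => hneg i (eq_neg_of_add_eq_zero_left h0)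
      congr 1
      field_simp

/-- `N_reg` in terms of the matrix of `η`. -/
theorem mem_Nreg_iff (hY : D.IsNondegSub Y) {T : Subgroup (V ≃ₗ[K] V)}
    (hT : IsMaximalTorus (D.HY Y) T) {n : Module.End K V} :
    n ∈ D.Nreg Y T ↔ n ∈ D.N ∧ (etaMatrix w n).det ≠ 0 ∧
      (etaMatrix w n + (etaMatrix w n).transpose).det ≠ 0 ∧
      HasDistinctEigenvalues ((etaMatrix w n)⁻¹ * (etaMatrix w n).transpose) := by
  obtain ⟨b, hb, rfl⟩ := exists_eq_hypTorus h2 hD hY (hY.2.2.trans hrank) hT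
  have hcard : Fintype.card ι = 2 * m + 1 := by
    rw [← Module.finrank_eq_card_basis w, hD.finrank_W', hrank]
  constructor
  · rintro ⟨hn, h, hh, γ, hγ, hnorm⟩
    have hN : IsNormOn D Y (D.eps Y * (γ : Module.End K V)) :=
      isNormOn_eps_mul hD hY hγ.1.1 hγ.2.2
    obtain ⟨hγT, c, hinj, hc, hneg⟩ := (mem_Treg_hypTorus_iff h2 hD hY hb).1 hγ
    have hN' := hN.conj hh.1
    rw [← hnorm] at hN'
    have hY' := hY.map_H hD hh
    have hspan := (span_xiFamily w hD hn.1).trans (hN'.xiOf hD hY').2.2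
    have hli : LinearIndependent K (xiFamily w n) := by
      rw [linearIndependent_iff_card_eq_finrank_span, Set.finrank, hspan, hY'.2.2, hrank, hcard]
    have hdet : (etaMatrix w n + (etaMatrix w n).transpose).det ≠ 0 := by
      have h3 := gram_det_ne_zero (Φ := D.Φ) hli (by rw [hspan]; exact hY'.2.1)
      have : (Matrix.of fun i j => D.Φ (xiFamily w n i) (xiFamily w n j)) =
          -(etaMatrix w n + (etaMatrix w n).transpose) := by
        ext i j
        rw [Matrix.of_apply, gram_xiFamily w hD hn.1, Matrix.neg_apply]
      rw [this, Matrix.det_neg] at h3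
      exact right_ne_zero_of_mul h3
    refine ⟨hn.1, (mem_N'_iff_det w hD hn.1).1 hn, hdet, ?_⟩
    let e : ι ≃ HypIndex m := Fintype.equivOfCardEq (by rw [hcard, HypIndex.card])
    refine ⟨c ∘ e, hinj.comp e.injective, fun i => ?_⟩
    -- `h (b (e i))` is an eigenvector of the norm for `-c (e i)`; its coordinates in the family
    -- form an eigenvector of `B⁻¹Bᵀ` for `c (e i)`.
    have h3 : h (b (e i)) ∈ Submodule.span K (Set.range (xiFamily w n)) := by
      rw [hspan]
      exact ⟨_, hb.mem _, rfl⟩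
    obtain ⟨q, hq⟩ := (Submodule.mem_span_range_iff_exists_fun K).1 h3
    refine ⟨q, fun hq0 => ?_, ?_⟩
    · rw [hq0] at hq
      simp only [Pi.zero_apply, zero_smul, Finset.sum_const_zero] at hq
      exact hb.ne_zero (e i) ((map_eq_zero_iff h h.injective).1 hq.symm)
    · have h4 : D.norm n (h (b (e i))) = -(c (e i) • h (b (e i))) := by
        rw [hnorm, LinearEquiv.conj_apply_apply, h.symm_apply_apply]
        change h (D.eps Y (γ (b (e i)))) = _
        rw [hc, map_smul, eps_apply_of_mem hD hY (hb.mem _), smul_neg, map_neg, map_smul]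
      rw [← hq, norm_sum_xiFamily hD w hn, neg_inj, Finset.smul_sum, ← sub_eq_zero,
        ← Finset.sum_sub_distrib] at h4
      simp only [smul_smul, ← sub_smul] at h4
      have h5 := Fintype.linearIndependent_iff.1 hli _ h4
      exact funext fun j => sub_eq_zero.1 (h5 j)
  · rintro ⟨hnN, hdet0, hdet, hdist⟩
    have hn : n ∈ D.N' := (mem_N'_iff_det w hD hnN).2 hdet0
    obtain ⟨hli, hY', hnorm⟩ := isNondegSub_span_xiFamily hD w hn hdet
    obtain ⟨γ', hγ', hγn, hbij⟩ := exists_mem_HY_of_isNormOn hD hY' hnorm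
    obtain ⟨b', c, hb', hinj, hc, hγb'⟩ :=
      exists_hypBasis_of_norm h2 hD hrank w hn hdet hdist rfl hγ' hγn
    -- The support `Y'` of the norm and the given `Y` may differ. An element of `H` matches their
    -- hyperbolic bases, and the element of the given torus with the same eigenvalues as `γ'` is
    -- then conjugate to `γ'`.
    obtain ⟨h, hh, hhb⟩ := exists_mem_H_map_hypBasis h2 hD hY hY' hb hb'
    have : Infinite K := IsAlgClosed.instInfinite
    have hreg : γ' ∈ D.Treg _ (hypTorus D _ b') :=
      ⟨hγb', isRegularIn_of_injective hD hY' hb' h2 hγb' hc hinj, hbij⟩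
    obtain ⟨-, c', -, hc', hneg⟩ := (mem_Treg_hypTorus_iff h2 hD hY' hb').1 hreg
    have hcc' : c' = c := funext fun i => by
      have h3 := (hc' i).symm.trans (hc i)
      exact smul_left_injective K (hb'.ne_zero i) h3
    subst hcc'
    obtain ⟨γ, hγ, hγc⟩ := exists_mem_hypTorus hD hY hb c'
      (fun i => mul_dual_eq_one hb' hγ'.1 hc i)
      (smul_left_injective K (hb'.ne_zero none) (by
        change c' none • b' none = (1 : K) • b' none
        rw [← hc, hγb'.2.2, one_smul]))
    refine ⟨hn, h, hh, γ, (mem_Treg_hypTorus_iff h2 hD hY hb).2 ⟨hγ, c', hinj, hγc, hneg⟩, ?_⟩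
    rw [← hγn]
    refine linearMap_ext_of_isHypBasis hD hY' hb' (fun i => ?_) fun z hz => ?_
    · change D.eps _ (γ' (b' i)) = h (D.eps Y (γ (h.symm (b' i))))
      rw [hc, map_smul, eps_apply_of_mem hD hY' (hb'.mem i), ← hhb, h.symm_apply_apply, hγc,
        map_smul, eps_apply_of_mem hD hY (hb.mem i), map_smul, map_neg]
    · have hz' : h.symm z ∈ D.Φ.orthogonal Y := by
        have hmap : ∀ y ∈ Y, h y ∈ Submodule.span K (Set.range (xiFamily w n)) := by
          intro y hy
          rw [hb.eq_sum hy, map_sum]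
          refine sum_mem fun i _ => ?_
          rw [map_smul, hhb]
          exact Submodule.smul_mem _ _ (hb'.mem i)
        intro y hy
        have h3 := hz _ (hmap y hy)
        change D.Φ (h y) z = 0 at h3
        change D.Φ y (h.symm z) = 0
        rw [← hh.1, h.apply_symm_apply, h3]
      change D.eps _ (γ' z) = h (D.eps Y (γ (h.symm z)))
      rw [hγ'.2 z hz, eps_apply_of_mem_orthogonal hD hY' hz, hγ.1.2 _ hz',
        eps_apply_of_mem_orthogonal hD hY hz', h.apply_symm_apply]

/-- `n_Y(ε_Yγ)` is such an element when `γ` has generic eigenvalues. -/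
theorem Nreg_nonempty (hY : D.IsNondegSub Y) {T : Subgroup (V ≃ₗ[K] V)}
    (hT : IsMaximalTorus (D.HY Y) T) : (D.Nreg Y T).Nonempty := by
  have : Infinite K := IsAlgClosed.instInfinite
  obtain ⟨b, hb, rfl⟩ := exists_eq_hypTorus h2 hD hY (hY.2.2.trans hrank) hT
  obtain ⟨c, hinj, hc, hc0, hneg⟩ := exists_generic h2 m
  obtain ⟨γ, hγ, hγc⟩ := exists_mem_hypTorus hD hY hb c hc hc0
  have hreg := (mem_Treg_hypTorus_iff h2 hD hY hb).2 ⟨hγ, c, hinj, hγc, hneg⟩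
  let ξ : Y ≃ₗ[K] D.W := LinearEquiv.ofFinrankEq _ _ hY.2.2
  have ha := isNormOn_eps_mul hD hY hγ.1 hreg.2.2
  refine ⟨_, nY_mem_N' hD hY ξ.bijective ha, 1, one_mem _, γ, hreg, ?_⟩
  rw [norm_nY hD hY ξ.bijective ha]
  rfl

theorem exists_isOpen_Nreg (hY : D.IsNondegSub Y) {T : Subgroup (V ≃ₗ[K] V)}
    (hT : IsMaximalTorus (D.HY Y) T) :
    ∃ U, IsOpen[zariski K (Module.End K V)] U ∧ D.Nreg Y T = U ∩ D.N := by
  let w := Module.finBasis K D.W'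
  have : Nonempty (Fin (Module.finrank K D.W')) := by
    rw [hD.finrank_W', hrank]
    exact ⟨0⟩
  obtain ⟨f, hf, hfn⟩ := exists_polyFun w
  refine ⟨_, isOpen_ne_zero hf, Set.ext fun n => ?_⟩
  rw [mem_Nreg_iff h2 hD hrank w hY hT, Set.mem_inter_iff, Set.mem_ofPred_eq, hfn, and_comm]

end Nreg

end Datum

end

end OddNorm

namespace OddNorm

noncomputable section

/-! ### Polynomial functions with coefficients in `F` -/

section Coefficient

variable {K E : Type*} [Field K] [AddCommGroup E] [Module K E]

/-- The matrix coefficient `a ↦ φ (a v)`. -/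
def coefficient : Module.Dual K E →ₗ[K] E →ₗ[K] (Module.End K E → K) :=
  LinearMap.mk₂ K (fun φ v a => φ (a v)) (fun _ _ _ => rfl) (fun _ _ _ => rfl)
    (fun φ v w => funext fun a => by simp) (fun c φ v => funext fun a => by simp)

theorem coefficient_apply (φ : Module.Dual K E) (v : E) (a : Module.End K E) :
    coefficient φ v a = φ (a v) := rfl

theorem coefficient_mem (φ : Module.Dual K E) (v : E) :
    coefficient φ v ∈ polyFun K (Module.End K E) := coefficient_mem_polyFun φ v

theorem dual_eq_sum_coefficient {ι : Type*} [Fintype ι] (B : Module.Basis ι K E)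
    (ψ : Module.Dual K (Module.End K E)) :
    (fun a => ψ a) =
      ∑ i, ∑ j, ψ ((B.coord j).smulRight (B i)) • coefficient (B.coord i) (B j) := by
  funext a
  have h : a = ∑ i, ∑ j, B.coord i (a (B j)) • (B.coord j).smulRight (B i) := by
    classical
    refine B.ext fun k => ?_
    simp only [LinearMap.sum_apply, LinearMap.smul_apply, LinearMap.smulRight_apply,
      Module.Basis.coord_apply, Module.Basis.repr_self, Finsupp.single_apply, ite_smul, one_smul,
      zero_smul, smul_ite, smul_zero, Finset.sum_ite_eq, Finset.mem_univ, if_true]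
    exact (B.sum_repr _).symm
  conv_lhs => rw [h]
  simp only [map_sum, map_smul, Finset.sum_apply, Pi.smul_apply, smul_eq_mul, coefficient_apply,
    mul_comm]

end Coefficient

section BaseChange

variable {F K V : Type*} [Field F] [Field K] [Algebra F K] [AddCommGroup V] [Module F V]

variable {M : Type*} [AddCommGroup M] [Module K M] {J : Submodule K M}

/-- Reduces a `K`-linear membership claim to rational vectors. -/
theorem mem_of_tmul {L : (K ⊗[F] V) →ₗ[K] M} (h : ∀ v, L (1 ⊗ₜ v) ∈ J) (v : K ⊗[F] V) :
    L v ∈ J := by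
  induction v with
  | zero => simp
  | tmul a x =>
    have : a ⊗ₜ[F] x = a • (1 ⊗ₜ[F] x) := by rw [TensorProduct.smul_tmul', smul_eq_mul, mul_one]
    rw [this, map_smul]
    exact J.smul_mem _ (h x)
  | add x y hx hy =>
    rw [map_add]
    exact add_mem hx hy

theorem ker_baseChange_eq {V' : Type*} [AddCommGroup V'] [Module F V'] (f : V →ₗ[F] V') :
    (f.baseChange K).ker = f.ker.baseChange K := by
  refine le_antisymm (fun v hv => ?_) ?_
  · have h : v ∈ LinearMap.ker (TensorProduct.AlgebraTensorModule.lTensor K K f) := hv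
    rw [Module.Flat.ker_lTensor_eq] at h
    obtain ⟨u, rfl⟩ := h
    exact mem_of_tmul (fun x => Submodule.tmul_mem_baseChange_of_mem 1 x.2) u
  · rw [Submodule.baseChange_eq_span, Submodule.span_le]
    rintro _ ⟨x, hx, rfl⟩
    change f.baseChange K (1 ⊗ₜ x) = 0
    rw [LinearMap.baseChange_tmul, LinearMap.mem_ker.1 hx, TensorProduct.tmul_zero]

theorem mem_of_dual_baseChange [FiniteDimensional F V] {L : Module.Dual K (K ⊗[F] V) →ₗ[K] M}
    (h : ∀ φ : Module.Dual F V, L (Module.Dual.baseChange K φ) ∈ J) (φ : Module.Dual K (K ⊗[F] V)) :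
    L φ ∈ J := by
  let e := Module.finBasis F V
  have hφ : φ = ∑ i, φ (1 ⊗ₜ e i) • Module.Dual.baseChange K (e.coord i) := by
    refine (e.baseChange K).ext fun j => ?_
    simp [Finsupp.single_apply]
  rw [hφ, map_sum]
  refine sum_mem fun i _ => ?_
  rw [map_smul]
  exact J.smul_mem _ (h _)

/-- In a rational basis every linear function is a `K`-combination of rational matrix coefficients,
and the `K`-span of the rational functions is closed under products. -/
theorem polyFun_le_span_ratPolyFun [FiniteDimensional F V] {f : Module.End K (K ⊗[F] V) → K}
    (hf : f ∈ polyFun K (Module.End K (K ⊗[F] V))) :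
    f ∈ Submodule.span K (ratPolyFun F K V : Set (Module.End K (K ⊗[F] V) → K)) := by
  let S := (Submodule.span K (ratPolyFun F K V : Set (Module.End K (K ⊗[F] V) → K))).toSubalgebra
    (Submodule.subset_span (one_mem _)) (by
      intro x y hx hy
      have h := Submodule.mul_mem_mul hx hy
      rw [Submodule.span_mul_span] at h
      refine Submodule.span_mono ?_ h
      rintro _ ⟨u, hu, v, hv, rfl⟩
      exact mul_mem hu hv)
  refine (Algebra.adjoin_le (S := S) ?_) hf
  rintro _ ⟨ψ, rfl⟩
  let e := Module.finBasis F V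
  rw [dual_eq_sum_coefficient (e.baseChange K) ψ]
  refine sum_mem fun i _ => sum_mem fun j _ => Subalgebra.smul_mem _ ?_ _
  refine Submodule.subset_span (Algebra.subset_adjoin ⟨e.coord i, e j, ?_⟩)
  rw [Module.Basis.baseChange_apply]
  funext a
  rw [coefficient_apply]
  congr 1
  refine (e.baseChange K).ext fun k => ?_
  simp [Finsupp.single_apply]

/-- The ideal of the polynomial functions that is generated by those with coefficients in `F` that
vanish on `T`. -/
def rationalIdeal (T : Subgroup ((K ⊗[F] V) ≃ₗ[K] (K ⊗[F] V))) :
    Submodule K (Module.End K (K ⊗[F] V) → K) :=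
  Submodule.span K {g | g ∈ ratPolyFun F K V ∧ ∀ t ∈ T, g (t : Module.End K (K ⊗[F] V)) = 0}

variable {T : Subgroup ((K ⊗[F] V) ≃ₗ[K] (K ⊗[F] V))}

/-- The span is an ideal: a product of rational functions still vanishes on `T` if the first factor
does, and these products span. -/
theorem mul_mem_rationalIdeal [FiniteDimensional F V] {g f : Module.End K (K ⊗[F] V) → K}
    (hg : g ∈ rationalIdeal T) (hf : f ∈ polyFun K (Module.End K (K ⊗[F] V))) :
    g * f ∈ rationalIdeal T := by
  have h := Submodule.mul_mem_mul hg (polyFun_le_span_ratPolyFun hf)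
  unfold rationalIdeal at h
  rw [Submodule.span_mul_span] at h
  refine Submodule.span_mono ?_ h
  rintro _ ⟨u, hu, v, hv, rfl⟩
  exact ⟨mul_mem hu.1 hv, fun t ht => by simp [hu.2 t ht]⟩

theorem apply_eq_zero_of_mem_rationalIdeal {g : Module.End K (K ⊗[F] V) → K}
    (hg : g ∈ rationalIdeal T) {t : (K ⊗[F] V) ≃ₗ[K] (K ⊗[F] V)} (ht : t ∈ T) :
    g (t : Module.End K (K ⊗[F] V)) = 0 := by
  have h : rationalIdeal T ≤ (LinearMap.proj (R := K) (φ := fun _ => K)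
      (t : Module.End K (K ⊗[F] V))).ker :=
    Submodule.span_le.2 fun g hg => hg.2 t ht
  exact h hg

theorem coefficient_mem_ratPolyFun (φ : Module.Dual F V) (v : V) :
    coefficient (Module.Dual.baseChange K φ) (1 ⊗ₜ v) ∈ ratPolyFun F K V :=
  Algebra.subset_adjoin ⟨φ, v, rfl⟩

theorem ratPolyFun_le {f : Module.End K (K ⊗[F] V) → K} (hf : f ∈ ratPolyFun F K V) :
    f ∈ polyFun K (Module.End K (K ⊗[F] V)) := by
  refine (Algebra.adjoin_le (S := (polyFun K (Module.End K (K ⊗[F] V))).restrictScalars F) ?_) hf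
  rintro _ ⟨φ, v, rfl⟩
  exact coefficient_mem (Module.Dual.baseChange K φ) (1 ⊗ₜ v)

theorem rationalIdeal_le {f : Module.End K (K ⊗[F] V) → K} (hf : f ∈ rationalIdeal T) :
    f ∈ polyFun K (Module.End K (K ⊗[F] V)) := by
  have h : rationalIdeal T ≤ Subalgebra.toSubmodule (polyFun K (Module.End K (K ⊗[F] V))) :=
    Submodule.span_le.2 fun g hg => ratPolyFun_le hg.1
  exact h hf

end BaseChange

end

end OddNorm

/-! ### The torus of a rational regular element is defined over `F` -/

namespace OddNorm

noncomputable section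

theorem eq_of_forall_pow_eq {K : Type*} [Field K] [Infinite K] {a b : ℕ}
    (h : ∀ s : K, s ≠ 0 → s ^ a = s ^ b) : a = b := by
  -- The extra factor `X` makes both sides agree at 0, where the hypothesis gives nothing.
  have h1 : (Polynomial.X ^ (a + 1) : Polynomial K) = Polynomial.X ^ (b + 1) := by
    refine Polynomial.funext fun s => ?_
    rw [Polynomial.eval_pow, Polynomial.eval_pow, Polynomial.eval_X]
    rcases eq_or_ne s 0 with rfl | hs
    · simp
    · rw [pow_succ, pow_succ, h s hs]
  have h3 := congrArg Polynomial.natDegree h1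
  rw [Polynomial.natDegree_X_pow, Polynomial.natDegree_X_pow] at h3
  omega

namespace Datum

section Character

variable {K V : Type*} [Field K] [AddCommGroup V] [Module K V] [FiniteDimensional K V]
  {D : Datum K V} (hD : D.IsOrthogonal) {Y : Submodule K V} (hY : D.IsNondegSub Y)
  {m : ℕ} {b : HypIndex m → V} (hb : IsHypBasis D Y b)

/-- The diagonal entry at `b i`. -/
def diagEntry (D : Datum K V) (b : HypIndex m → V) (i : HypIndex m) : Module.End K V → K :=
  coefficient (D.Φ (b i.dual)) (b i)

include hb in
theorem apply_eq_diagEntry_smul {t : V ≃ₗ[K] V} (ht : t ∈ hypTorus D Y b) (i : HypIndex m) :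
    t (b i) = diagEntry D b i (t : Module.End K V) • b i :=
  hb.apply_eq_smul (g := (t : Module.End K V)) (ht.2.1 i)

/-- The monomials in the diagonal entries, as characters of the torus. -/
def monomialCharacter (hb : IsHypBasis D Y b) (p : HypIndex m → ℕ) :
    hypTorus D Y b →* K where
  toFun t := (∏ i, diagEntry D b i ^ p i) ((t : V ≃ₗ[K] V) : Module.End K V)
  map_one' := by
    rw [Finset.prod_apply]
    refine Finset.prod_eq_one fun i _ => ?_
    have h : diagEntry D b i (((1 : hypTorus D Y b) : V ≃ₗ[K] V) : Module.End K V) = 1 := by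
      refine smul_left_injective K (hb.ne_zero i) ?_
      change _ • b i = (1 : K) • b i
      rw [← apply_eq_diagEntry_smul hb (Subtype.mem _), one_smul]
      rfl
    rw [Pi.pow_apply, h, one_pow]
  map_mul' s t := by
    simp only [Finset.prod_apply, Pi.pow_apply]
    rw [← Finset.prod_mul_distrib]
    refine Finset.prod_congr rfl fun i _ => ?_
    rw [← mul_pow]
    congr 1
    refine smul_left_injective K (hb.ne_zero i) ?_
    change _ • b i = (_ * _) • b i
    rw [← apply_eq_diagEntry_smul hb (Subtype.mem _), mul_comm, mul_smul,
      ← apply_eq_diagEntry_smul hb s.2, ← map_smul, ← apply_eq_diagEntry_smul hb t.2]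
    rfl

include hD hY in
-- Evaluate at the torus element with eigenvalue `s` at `i`, `s⁻¹` at `i.dual` and 1 elsewhere: the
-- character determines `p i - p i.dual`, stated here without subtraction.
theorem exponents_of_monomialCharacter_eq [Infinite K] {p q : HypIndex m → ℕ}
    (h : monomialCharacter hb p = monomialCharacter hb q) (i : HypIndex m) :
    p i + q i.dual = q i + p i.dual := by
  rcases eq_or_ne i.dual i with hi | hi
  · rw [hi, add_comm]
  refine eq_of_forall_pow_eq (K := K) fun s hs => ?_
  let c : HypIndex m → K := fun k => (if k = i then s else 1) * (if k = i.dual then s⁻¹ else 1)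
  have hc : ∀ k, c k * c k.dual = 1 := by
    intro k
    have e1 : k.dual = i ↔ k = i.dual := HypIndex.dual_eq_iff
    have e2 : k.dual = i.dual ↔ k = i := HypIndex.dual_injective.eq_iff
    simp only [c, e1, e2]
    split_ifs <;> simp [hs]
  have hn : (none : HypIndex m) ≠ i := fun h0 => hi (by rw [← h0]; rfl)
  have hn' : (none : HypIndex m) ≠ i.dual := fun h0 => hi (by
    have := congrArg HypIndex.dual h0
    rw [HypIndex.dual_dual, HypIndex.dual_none] at this
    rw [← h0, this])
  obtain ⟨t, ht, htc⟩ := exists_mem_hypTorus hD hY hb c hc (by simp [c, hn, hn'])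
  have hval : ∀ p : HypIndex m → ℕ, monomialCharacter hb p ⟨t, ht⟩ = s ^ p i * s⁻¹ ^ p i.dual := by
    intro p
    change (∏ i, diagEntry D b i ^ p i) (t : Module.End K V) = _
    rw [Finset.prod_apply]
    have e : ∀ k, diagEntry D b k (t : Module.End K V) = c k := fun k =>
      smul_left_injective K (hb.ne_zero k) ((apply_eq_diagEntry_smul hb ht k).symm.trans (htc k))
    simp only [Pi.pow_apply, e, c, mul_pow, Finset.prod_mul_distrib, ite_pow, one_pow,
      Finset.prod_ite_eq', Finset.mem_univ, if_true]
  have h3 := (hval p).symm.trans ((DFunLike.congr_fun h _).trans (hval q))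
  rw [inv_pow, inv_pow, ← div_eq_mul_inv, ← div_eq_mul_inv,
    div_eq_div_iff (pow_ne_zero _ hs) (pow_ne_zero _ hs)] at h3
  rw [pow_add, pow_add, h3]

end Character

section Rational

variable {F K V : Type*} [Field F] [Field K] [Algebra F K] [AddCommGroup V] [Module F V]
  [FiniteDimensional F V] {D : Datum F V} (hD : (D.baseChange K).IsOrthogonal)
  {Y : Submodule K (K ⊗[F] V)} (hY : (D.baseChange K).IsNondegSub Y)
  {m : ℕ} {b : HypIndex m → K ⊗[F] V} (hb : IsHypBasis (D.baseChange K) Y b)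

/-- The expression is bilinear in `(u, v)`, and for rational vectors it is a function with
coefficients in `F` that vanishes on `T`. -/
theorem form_mem_rationalIdeal {T : Subgroup ((K ⊗[F] V) ≃ₗ[K] (K ⊗[F] V))}
    (hT : T ≤ (D.baseChange K).isom) (u v : K ⊗[F] V) :
    (fun a : Module.End K (K ⊗[F] V) => (D.baseChange K).Φ (a u) (a v) -
      (D.baseChange K).Φ u v) ∈ rationalIdeal T := by
  let L : (K ⊗[F] V) →ₗ[K] (K ⊗[F] V) →ₗ[K] (Module.End K (K ⊗[F] V) → K) :=
    LinearMap.mk₂ K (fun u v a => (D.baseChange K).Φ (a u) (a v) - (D.baseChange K).Φ u v)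
      (fun u u' v => funext fun a => by simp; ring)
      (fun c u v => funext fun a => by simp; ring)
      (fun u v v' => funext fun a => by simp; ring)
      (fun c u v => funext fun a => by simp; ring)
  change L u v ∈ _
  refine mem_of_tmul (L := L u) (fun v => ?_) v
  change L.flip (1 ⊗ₜ v) u ∈ _
  refine mem_of_tmul (L := L.flip (1 ⊗ₜ v)) (fun u => ?_) u
  refine Submodule.subset_span ⟨?_, fun t ht => sub_eq_zero.2 (hT ht _ _)⟩
  let e := Module.finBasis F V
  have h : L.flip (1 ⊗ₜ v) (1 ⊗ₜ u) = ∑ i, ∑ j,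
      D.Φ (e i) (e j) • (coefficient (Module.Dual.baseChange K (e.coord i)) (1 ⊗ₜ u) *
        coefficient (Module.Dual.baseChange K (e.coord j)) (1 ⊗ₜ v)) -
      algebraMap F _ (D.Φ u v) := by
    funext a
    have h1 : ∀ x : K ⊗[F] V, x = ∑ i, Module.Dual.baseChange K (e.coord i) x • (1 ⊗ₜ[F] e i) := by
      intro x
      have h3 : LinearMap.id = ∑ i,
          (Module.Dual.baseChange K (e.coord i)).smulRight (1 ⊗ₜ[F] e i : K ⊗[F] V) := by
        refine (e.baseChange K).ext fun j => ?_
        simp [Finsupp.single_apply]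
      conv_lhs => rw [← LinearMap.id_apply (R := K) x, h3]
      simp
    change (D.baseChange K).Φ (a (1 ⊗ₜ u)) (a (1 ⊗ₜ v)) - (D.baseChange K).Φ (1 ⊗ₜ u) (1 ⊗ₜ v) = _
    conv_lhs => rw [h1 (a (1 ⊗ₜ u)), h1 (a (1 ⊗ₜ v))]
    have h3 : ∀ x y : V, (D.baseChange K).Φ (1 ⊗ₜ x) (1 ⊗ₜ y) = algebraMap F K (D.Φ x y) := by
      intro x y
      change LinearMap.BilinForm.baseChange K D.Φ _ _ = _
      rw [LinearMap.BilinForm.baseChange_tmul, mul_one, Algebra.smul_def, mul_one]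
    simp only [map_sum, map_smul, LinearMap.sum_apply, LinearMap.smul_apply, h3, Pi.sub_apply,
      Finset.sum_apply, Pi.mul_apply, coefficient_apply, Algebra.smul_def, Pi.algebraMap_apply]
    congr 1
    rw [Finset.sum_comm]
    refine Finset.sum_congr rfl fun i _ => ?_
    rw [Finset.mul_sum]
    refine Finset.sum_congr rfl fun j _ => ?_
    simp only [Algebra.algebraMap_self, RingHom.id_apply]
    ring
  rw [h]
  refine sub_mem (sum_mem fun i _ => sum_mem fun j _ => Subalgebra.smul_mem _ (mul_mem ?_ ?_) _)
    (Subalgebra.algebraMap_mem _ _)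
  · exact coefficient_mem_ratPolyFun _ _
  · exact coefficient_mem_ratPolyFun _ _

/-- The elements congruent to `1` modulo the rational ideal. -/
def oneModRationalIdeal (T : Subgroup ((K ⊗[F] V) ≃ₗ[K] (K ⊗[F] V))) :
    Submonoid (Module.End K (K ⊗[F] V) → K) where
  carrier := {g | g ∈ polyFun K (Module.End K (K ⊗[F] V)) ∧ g - 1 ∈ rationalIdeal T}
  mul_mem' := by
    rintro g h ⟨hg, hg1⟩ ⟨hh, hh1⟩
    refine ⟨mul_mem hg hh, ?_⟩
    have : g * h - 1 = (g - 1) * h + (h - 1) := by ring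
    rw [this]
    exact add_mem (mul_mem_rationalIdeal hg1 hh) hh1
  one_mem' := ⟨one_mem _, by simp⟩

variable {γ : V ≃ₗ[F] V} (hγ : LinearEquiv.baseChange F K V V γ ∈ hypTorus (D.baseChange K) Y b)
  {c : HypIndex m → K} (hc : ∀ i, LinearEquiv.baseChange F K V V γ (b i) = c i • b i)
  (hinj : Function.Injective c)
include hD hY hb hγ hc hinj

omit hD hY in
-- On `Y` the eigenvalue 1 of `γ` is simple, so `γ`-fixed vectors lie in `Y^⊥` plus the line of the
-- anisotropic vector, where the torus acts trivially.
theorem apply_eq_of_apply_eq {v : K ⊗[F] V} (hcompl : v ∈ Y ⊔ (D.baseChange K).Φ.orthogonal Y)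
    (hv : LinearEquiv.baseChange F K V V γ v = v) {t : (K ⊗[F] V) ≃ₗ[K] (K ⊗[F] V)}
    (ht : t ∈ hypTorus (D.baseChange K) Y b) : t v = v := by
  have hcn : c none = 1 := by
    refine smul_left_injective K (hb.ne_zero none) ?_
    change c none • b none = (1 : K) • b none
    rw [← hc, hγ.2.2, one_smul]
  obtain ⟨y, hy, z, hz, rfl⟩ := Submodule.mem_sup.1 hcompl
  rw [map_add, hγ.1.2 z hz, add_left_inj] at hv
  have h3 := eq_smul_of_apply_eq_smul hb hγ.1.1 hc hinj hy (i := none) (by rw [hv, hcn, one_smul])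
  rw [map_add, ht.1.2 z hz, h3, map_smul, ht.2.2]

/-- As `γ` is rational, its fixed space is spanned by rational vectors `x`; the torus fixes these,
so `φ(a x) - φ(x)` is a rational equation of the torus for rational `φ`. -/
theorem coefficient_fixed_mem {v : K ⊗[F] V} (hv : LinearEquiv.baseChange F K V V γ v = v)
    (φ : Module.Dual K (K ⊗[F] V)) :
    coefficient φ v - φ v • 1 ∈ rationalIdeal (hypTorus (D.baseChange K) Y b) := by
  let L : Module.Dual K (K ⊗[F] V) →ₗ[K] (K ⊗[F] V) →ₗ[K] (Module.End K (K ⊗[F] V) → K) :=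
    coefficient - LinearMap.mk₂ K (fun φ v => φ v • (1 : Module.End K (K ⊗[F] V) → K))
      (fun _ _ _ => add_smul _ _ _) (fun _ _ _ => by simp [smul_smul])
      (fun _ _ _ => by rw [map_add, add_smul]) (fun _ _ _ => by simp [smul_smul])
  change L φ v ∈ _
  have hmem : v ∈ ((((γ : V →ₗ[F] V) - 1).baseChange K)).ker := by
    rw [LinearMap.mem_ker, LinearMap.baseChange_sub, LinearMap.baseChange_one, LinearMap.sub_apply]
    exact sub_eq_zero.2 hv
  rw [ker_baseChange_eq, Submodule.baseChange_eq_span] at hmem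
  refine (Submodule.span_le (p := (rationalIdeal (hypTorus (D.baseChange K) Y b)).comap (L φ))).2 ?_ hmem
  rintro _ ⟨x, hx, rfl⟩
  change L.flip (1 ⊗ₜ x) φ ∈ rationalIdeal (hypTorus (D.baseChange K) Y b)
  refine mem_of_dual_baseChange (L := L.flip (1 ⊗ₜ x)) (fun φ => ?_) φ
  have hx' : LinearEquiv.baseChange F K V V γ (1 ⊗ₜ x) = 1 ⊗ₜ x := by
    rw [LinearEquiv.baseChange_tmul]
    congr 1
    exact sub_eq_zero.1 (LinearMap.mem_ker.1 hx)
  refine Submodule.subset_span ⟨?_, fun t ht => ?_⟩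
  · have h3 : L.flip (1 ⊗ₜ x) (Module.Dual.baseChange K φ) =
        coefficient (Module.Dual.baseChange K φ) (1 ⊗ₜ x) - algebraMap F _ (φ x) := by
      funext a
      change _ - Module.Dual.baseChange K φ (1 ⊗ₜ x) • (1 : K) = _
      rw [Module.Dual.baseChange_apply_tmul, smul_eq_mul, mul_one, Algebra.smul_def, mul_one]
      rfl
    rw [h3]
    exact sub_mem (coefficient_mem_ratPolyFun _ _) (Subalgebra.algebraMap_mem _ _)
  · have h3 := apply_eq_of_apply_eq hb hγ hc hinj
      (by rw [(isCompl_of_isNondegSub hD hY).sup_eq_top]; trivial) hx' ht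
    change Module.Dual.baseChange K φ (t (1 ⊗ₜ x)) -
      Module.Dual.baseChange K φ (1 ⊗ₜ x) • (1 : K) = 0
    rw [h3, smul_eq_mul, mul_one, sub_self]

/-- These are the entries of `aγ - γa`, rational because `γ` is, and zero on the torus. -/
theorem coefficient_commute_mem (v : K ⊗[F] V) (φ : Module.Dual K (K ⊗[F] V)) :
    coefficient φ (LinearEquiv.baseChange F K V V γ v) -
      coefficient (φ ∘ₗ (LinearEquiv.baseChange F K V V γ : Module.End K (K ⊗[F] V))) v ∈
      rationalIdeal (hypTorus (D.baseChange K) Y b) := by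
  let g : Module.End K (K ⊗[F] V) := (LinearEquiv.baseChange F K V V γ : Module.End K (K ⊗[F] V))
  let L : Module.Dual K (K ⊗[F] V) →ₗ[K] (K ⊗[F] V) →ₗ[K] (Module.End K (K ⊗[F] V) → K) :=
    coefficient.compl₂ g - coefficient ∘ₗ g.dualMap
  change L φ v ∈ _
  refine mem_of_tmul (L := L φ) (fun v => ?_) v
  change L.flip (1 ⊗ₜ v) φ ∈ _
  refine mem_of_dual_baseChange (L := L.flip (1 ⊗ₜ v)) (fun φ => ?_) φ
  refine Submodule.subset_span ⟨?_, fun t ht => ?_⟩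
  · have h3 : L.flip (1 ⊗ₜ v) (Module.Dual.baseChange K φ) =
        coefficient (Module.Dual.baseChange K φ) (1 ⊗ₜ γ v) -
          coefficient (Module.Dual.baseChange K (φ ∘ₗ (γ : V →ₗ[F] V))) (1 ⊗ₜ v) := by
      have h4 : Module.Dual.baseChange K φ ∘ₗ g =
          Module.Dual.baseChange K (φ ∘ₗ (γ : V →ₗ[F] V)) := by
        refine TensorProduct.AlgebraTensorModule.ext fun a x => ?_
        change Module.Dual.baseChange K φ (LinearEquiv.baseChange F K V V γ (a ⊗ₜ x)) = _
        rw [LinearEquiv.baseChange_tmul]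
        rfl
      rw [← h4]
      change coefficient (Module.Dual.baseChange K φ) (LinearEquiv.baseChange F K V V γ (1 ⊗ₜ v)) -
        coefficient (Module.Dual.baseChange K φ ∘ₗ g) (1 ⊗ₜ v) = _
      rw [LinearEquiv.baseChange_tmul]
    rw [h3]
    exact sub_mem (coefficient_mem_ratPolyFun _ _) (coefficient_mem_ratPolyFun _ _)
  · have h3 : (t : Module.End K (K ⊗[F] V)) ∘ₗ g = g ∘ₗ (t : Module.End K (K ⊗[F] V)) := by
      refine linearMap_ext_of_isHypBasis hD hY hb (fun i => ?_) fun z hz => ?_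
      · obtain ⟨d, hd⟩ := ht.2.1 i
        change t (LinearEquiv.baseChange F K V V γ (b i)) =
          LinearEquiv.baseChange F K V V γ (t (b i))
        rw [hc, hd, map_smul, map_smul, hd, hc, smul_comm]
      · change t (LinearEquiv.baseChange F K V V γ z) = LinearEquiv.baseChange F K V V γ (t z)
        rw [hγ.1.2 z hz, ht.1.2 z hz, hγ.1.2 z hz]
    have h4 := LinearMap.congr_fun h3 (1 ⊗ₜ v)
    exact sub_eq_zero.2 (congrArg (Module.Dual.baseChange K φ) h4)

/-- Commutation with `γ` puts `(d - d')` times the coefficient in the ideal, and `d ≠ d'`. -/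
theorem coefficient_eigen_mem {v : K ⊗[F] V} {φ : Module.Dual K (K ⊗[F] V)} {d d' : K}
    (hv : LinearEquiv.baseChange F K V V γ v = d • v)
    (hφ : ∀ x, φ (LinearEquiv.baseChange F K V V γ x) = d' * φ x) (hne : d ≠ d') :
    coefficient φ v ∈ rationalIdeal (hypTorus (D.baseChange K) Y b) := by
  have h3 := coefficient_commute_mem hD hY hb hγ hc hinj v φ
  have h4 : φ ∘ₗ (LinearEquiv.baseChange F K V V γ : Module.End K (K ⊗[F] V)) = d' • φ :=
    LinearMap.ext hφ
  rw [hv, h4, map_smul, map_smul, LinearMap.smul_apply, ← sub_smul] at h3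
  exact (Submodule.smul_mem_iff _ (sub_ne_zero.2 hne)).1 h3

/-- The matrix coefficients at the vectors of the hyperbolic basis are congruent to multiples of
the diagonal entries. -/
theorem coefficient_basis_mem (φ : Module.Dual K (K ⊗[F] V)) (i : HypIndex m) :
    coefficient φ (b i) - φ (b i) • diagEntry (D.baseChange K) b i ∈
      rationalIdeal (hypTorus (D.baseChange K) Y b) := by
  set D' := D.baseChange K
  have hcn : c none = 1 := by
    refine smul_left_injective K (hb.ne_zero none) ?_
    change c none • b none = (1 : K) • b none
    rw [← hc, hγ.2.2, one_smul]
  -- The part of `φ` that vanishes on `Y`; it is `γ`-invariant. Its coefficient at `b i` is removed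
  -- by comparing eigenvalues if `i ≠ none`, and by the fixed-vector equations if `i = none`.
  -- Comparing eigenvalues also removes the off-diagonal terms of the sum.
  let φ' : Module.Dual K (K ⊗[F] V) := φ - ∑ j, φ (b j) • D'.Φ (b j.dual)
  have hφ : φ = φ' + ∑ j, φ (b j) • D'.Φ (b j.dual) := by simp [φ']
  have hφ'b : ∀ j, φ' (b j) = 0 := by
    intro j
    simp only [φ', LinearMap.sub_apply, LinearMap.sum_apply, LinearMap.smul_apply, hb.gram,
      HypIndex.dual_dual, smul_eq_mul, mul_ite, mul_one, mul_zero, Finset.sum_ite_eq,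
      Finset.mem_univ, if_true, sub_self]
  have hφ'γ : ∀ x, φ' (LinearEquiv.baseChange F K V V γ x) = 1 * φ' x := by
    have h3 : φ' ∘ₗ (LinearEquiv.baseChange F K V V γ : Module.End K (K ⊗[F] V)) = φ' := by
      refine linearMap_ext_of_isHypBasis hD hY hb (fun j => ?_) fun z hz => ?_
      · change φ' (LinearEquiv.baseChange F K V V γ (b j)) = _
        rw [hc, map_smul, hφ'b, smul_zero]
      · change φ' (LinearEquiv.baseChange F K V V γ z) = _
        rw [hγ.1.2 z hz]
    intro x
    rw [one_mul]
    exact LinearMap.congr_fun h3 x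
  have hΦγ : ∀ j x, D'.Φ (b (HypIndex.dual j)) (LinearEquiv.baseChange F K V V γ x) =
      c j * D'.Φ (b (HypIndex.dual j)) x := by
    intro j x
    have h3 := hγ.1.1 (b (HypIndex.dual j)) x
    rw [hc, map_smul, LinearMap.smul_apply, smul_eq_mul] at h3
    rw [← h3, ← mul_assoc, mul_dual_eq_one hb hγ.1.1 hc, one_mul]
  have h1 : coefficient φ' (b i) ∈ rationalIdeal (hypTorus D' Y b) := by
    rcases eq_or_ne i none with rfl | hi
    · have h3 := coefficient_fixed_mem hD hY hb hγ hc hinj (v := b none)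
        (by rw [hc, hcn, one_smul]) φ'
      rwa [hφ'b, zero_smul, sub_zero] at h3
    · exact coefficient_eigen_mem hD hY hb hγ hc hinj (hc i) hφ'γ fun h0 =>
        hi (hinj (h0.trans hcn.symm))
  have h3 : coefficient φ (b i) - φ (b i) • diagEntry D' b i = coefficient φ' (b i) +
      ∑ j ∈ Finset.univ.erase i, φ (b j) • coefficient (D'.Φ (b (HypIndex.dual j))) (b i) := by
    conv_lhs => rw [hφ]
    rw [map_add, LinearMap.add_apply, map_sum, LinearMap.sum_apply,
      ← Finset.add_sum_erase _ _ (Finset.mem_univ i)]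
    simp only [map_smul, LinearMap.smul_apply]
    rw [← hφ]
    change _ + (_ • diagEntry D' b i + _) - _ = _
    abel
  rw [h3]
  refine add_mem h1 (sum_mem fun j hj => Submodule.smul_mem _ _ ?_)
  exact coefficient_eigen_mem hD hY hb hγ hc hinj (hc i) (hΦγ j) fun h0 =>
    (Finset.ne_of_mem_erase hj) (hinj h0).symm

theorem diagEntry_none_mem :
    diagEntry (D.baseChange K) b none ∈ oneModRationalIdeal (hypTorus (D.baseChange K) Y b) := by
  refine ⟨coefficient_mem _ _, ?_⟩
  have h3 := coefficient_fixed_mem hD hY hb hγ hc hinj hγ.2.2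
    ((D.baseChange K).Φ (b (HypIndex.dual none)))
  have h4 : (D.baseChange K).Φ (b (HypIndex.dual none)) (b none) = 1 := by
    rw [hb.gram, HypIndex.dual_dual, if_pos rfl]
  rwa [h4, one_smul] at h3

/-- Start from the isometry equation `Φ(a b_i, a b_i.dual) = 1` and replace `a b_i` by its diagonal
entry times `b_i`, which is allowed modulo the ideal. -/
theorem diagEntry_mul_dual_mem (i : HypIndex m) :
    diagEntry (D.baseChange K) b i * diagEntry (D.baseChange K) b i.dual ∈
      oneModRationalIdeal (hypTorus (D.baseChange K) Y b) := by
  refine ⟨mul_mem (coefficient_mem _ _) (coefficient_mem _ _), ?_⟩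
  set D' := D.baseChange K
  let B := Module.finBasis K (K ⊗[F] V)
  have hle : hypTorus D' Y b ≤ D'.isom := fun t ht => ht.1.1
  have h1 := form_mem_rationalIdeal hle (b i) (b i.dual)
  have h3 : diagEntry D' b i * diagEntry D' b i.dual - 1 =
      (fun a : Module.End K (K ⊗[F] V) => D'.Φ (a (b i)) (a (b i.dual)) -
        D'.Φ (b i) (b i.dual)) -
      ∑ k, (coefficient (B.coord k) (b i) - B.coord k (b i) • diagEntry D' b i) *
        coefficient (D'.Φ (B k)) (b i.dual) := by
    funext a
    have h4 : ∀ x, D'.Φ x (a (b i.dual)) = ∑ k, B.coord k x * D'.Φ (B k) (a (b i.dual)) := by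
      intro x
      conv_lhs => rw [← B.sum_repr x]
      simp only [map_sum, map_smul, LinearMap.sum_apply, LinearMap.smul_apply, smul_eq_mul,
        Module.Basis.coord_apply]
    have h5 : D'.Φ (b i) (b i.dual) = 1 := by rw [hb.gram, if_pos rfl]
    have h6 : diagEntry D' b i.dual a = D'.Φ (b i) (a (b i.dual)) := by
      change D'.Φ (b i.dual.dual) (a (b i.dual)) = _
      rw [HypIndex.dual_dual]
    simp only [Pi.sub_apply, Pi.mul_apply, Finset.sum_apply, Pi.one_apply, Pi.smul_apply,
      coefficient_apply, smul_eq_mul, sub_mul, Finset.sum_sub_distrib]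
    rw [← h4, h5, h6]
    have h7 : ∑ k, B.coord k (b i) * diagEntry D' b i a * D'.Φ (B k) (a (b i.dual)) =
        diagEntry D' b i a * D'.Φ (b i) (a (b i.dual)) := by
      rw [h4 (b i), Finset.mul_sum]
      exact Finset.sum_congr rfl fun k _ => by ring
    rw [h7]
    ring
  rw [h3]
  exact sub_mem h1 (sum_mem fun k _ => mul_mem_rationalIdeal
    (coefficient_basis_mem hD hY hb hγ hc hinj _ i) (coefficient_mem _ _))

theorem monomial_mem_of_balanced {r : HypIndex m → ℕ} (hr : ∀ i : HypIndex m, r i.dual = r i) :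
    ∏ i, diagEntry (D.baseChange K) b i ^ r i ∈
      oneModRationalIdeal (hypTorus (D.baseChange K) Y b) := by
  rw [Fintype.prod_option, Fintype.prod_prod_type]
  refine mul_mem (pow_mem (diagEntry_none_mem hD hY hb hγ hc hinj) _) (prod_mem fun j _ => ?_)
  rw [Fintype.prod_bool]
  have h : r (some (j, false)) = r (some (j, true)) := hr (some (j, true))
  rw [h, ← mul_pow]
  exact pow_mem (diagEntry_mul_dual_mem hD hY hb hγ hc hinj (some (j, true))) _

/-- Modulo the ideal, the monomial with exponents `q i.dual` inverts the one with exponents `q i`.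
When the characters agree, the exponents `p i + q i.dual` are invariant under duality, so that the
corresponding monomial is congruent to 1 as well. -/
theorem monomial_sub_mem [Infinite K] {p q : HypIndex m → ℕ}
    (h : monomialCharacter hb p = monomialCharacter hb q) :
    ∏ i, diagEntry (D.baseChange K) b i ^ p i - ∏ i, diagEntry (D.baseChange K) b i ^ q i ∈
      rationalIdeal (hypTorus (D.baseChange K) Y b) := by
  have hexp := exponents_of_monomialCharacter_eq hD hY hb h
  set x := diagEntry (D.baseChange K) b
  have hpoly : ∀ p : HypIndex m → ℕ, ∏ i, x i ^ p i ∈ polyFun K (Module.End K (K ⊗[F] V)) :=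
    fun p => prod_mem fun i _ => pow_mem (coefficient_mem _ _) _
  have h1 := (monomial_mem_of_balanced hD hY hb hγ hc hinj (r := fun i => q i + q i.dual)
    fun i => by rw [HypIndex.dual_dual, add_comm]).2
  have h3 := (monomial_mem_of_balanced hD hY hb hγ hc hinj (r := fun i => p i + q i.dual)
    fun i => by rw [HypIndex.dual_dual, hexp, add_comm]).2
  have h4 : ∏ i, x i ^ p i - ∏ i, x i ^ q i =
      (∏ i, x i ^ (p i + q i.dual) - 1) * ∏ i, x i ^ q i -
      (∏ i, x i ^ (q i + q i.dual) - 1) * ∏ i, x i ^ p i := by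
    simp only [pow_add, Finset.prod_mul_distrib]
    ring
  rw [h4]
  exact sub_mem (mul_mem_rationalIdeal h3 (hpoly q)) (mul_mem_rationalIdeal h1 (hpoly p))

/-- Matrix coefficients at `b i` reduce to multiples of the diagonal entries, those at vectors of
`Y^⊥` to constants. The sum of an ideal and a span of monomials is closed under products. -/
theorem polyFun_le_sup {f : Module.End K (K ⊗[F] V) → K}
    (hf : f ∈ polyFun K (Module.End K (K ⊗[F] V))) :
    f ∈ rationalIdeal (hypTorus (D.baseChange K) Y b) ⊔ Submodule.span K
      (Set.range fun p : HypIndex m → ℕ => ∏ i, diagEntry (D.baseChange K) b i ^ p i) := by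
  set x := diagEntry (D.baseChange K) b with hx
  set C := Submodule.span K (Set.range fun p : HypIndex m → ℕ => ∏ i, x i ^ p i) with hC
  set J := rationalIdeal (hypTorus (D.baseChange K) Y b) with hJ
  have hCpoly : ∀ g ∈ C, g ∈ polyFun K (Module.End K (K ⊗[F] V)) := by
    have h : C ≤ Subalgebra.toSubmodule (polyFun K (Module.End K (K ⊗[F] V))) := by
      rw [hC, Submodule.span_le]
      rintro _ ⟨p, rfl⟩
      change _ ∈ polyFun K (Module.End K (K ⊗[F] V))
      exact prod_mem fun i _ => pow_mem (coefficient_mem _ _) _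
    exact fun g hg => h hg
  have hC1 : (1 : Module.End K (K ⊗[F] V) → K) ∈ C := Submodule.subset_span ⟨0, by simp⟩
  have hCx : ∀ i, x i ∈ C := fun i => Submodule.subset_span ⟨Pi.single i 1, by
    simp [Pi.single_apply, pow_ite, Finset.prod_ite_eq']⟩
  have hCmul : ∀ g ∈ C, ∀ h ∈ C, g * h ∈ C := by
    intro g hg h hh
    have h3 := Submodule.mul_mem_mul hg hh
    rw [hC, Submodule.span_mul_span] at h3
    refine Submodule.span_mono ?_ h3
    rintro _ ⟨_, ⟨p, rfl⟩, _, ⟨q, rfl⟩, rfl⟩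
    exact ⟨p + q, by simp only [Pi.add_apply, pow_add, Finset.prod_mul_distrib]⟩
  let S := (J ⊔ C).toSubalgebra (Submodule.mem_sup_right hC1) (by
    intro g' h' hg' hh'
    obtain ⟨j, hj, g, hg, rfl⟩ := Submodule.mem_sup.1 hg'
    obtain ⟨k, hk, h, hh, rfl⟩ := Submodule.mem_sup.1 hh'
    have h3 : (j + g) * (k + h) = j * (k + h) + k * g + g * h := by ring
    rw [h3]
    refine add_mem (Submodule.mem_sup_left (add_mem ?_ ?_))
      (Submodule.mem_sup_right (hCmul g hg h hh))
    · exact mul_mem_rationalIdeal hj (add_mem (rationalIdeal_le hk) (hCpoly h hh))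
    · exact mul_mem_rationalIdeal hk (hCpoly g hg))
  refine (Algebra.adjoin_le (S := S) ?_) hf
  rintro _ ⟨ψ, rfl⟩
  let B := Module.finBasis K (K ⊗[F] V)
  rw [dual_eq_sum_coefficient B ψ]
  have hcoef : ∀ φ v, coefficient φ v ∈ J ⊔ C := by
    intro φ v
    have h3 : (⊤ : Submodule K (K ⊗[F] V)) ≤ (J ⊔ C).comap (coefficient φ) := by
      rw [← (isCompl_of_isNondegSub hD hY).sup_eq_top]
      refine sup_le ?_ fun z hz => ?_
      · conv_lhs => rw [← hb.span]
        rw [Submodule.span_le]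
        rintro _ ⟨i, rfl⟩
        have h4 := coefficient_basis_mem hD hY hb hγ hc hinj φ i
        have h5 := add_mem (Submodule.mem_sup_left h4 : _ ∈ J ⊔ C)
          (Submodule.mem_sup_right (C.smul_mem (φ (b i)) (hCx i)))
        rwa [sub_add_cancel] at h5
      · have h4 := coefficient_fixed_mem hD hY hb hγ hc hinj (hγ.1.2 z hz) φ
        have h5 := add_mem (Submodule.mem_sup_left h4 : _ ∈ J ⊔ C)
          (Submodule.mem_sup_right (C.smul_mem (φ z) hC1))
        rwa [sub_add_cancel] at h5
    exact h3 trivial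
  exact sum_mem fun i _ => sum_mem fun j _ => (J ⊔ C).smul_mem _ (hcoef _ _)

/-- The torus of a hyperbolic basis of eigenvectors of a rational isometry with distinct
eigenvalues is defined over `F`. -/
theorem hypTorus_isDefinedOver [Infinite K] :
    IsDefinedOver (hypTorus (D.baseChange K) Y b) := by
  intro f hf hf0
  set x := diagEntry (D.baseChange K) b with hx
  set J := rationalIdeal (hypTorus (D.baseChange K) Y b) with hJ
  change f ∈ J
  -- It remains to treat a combination `g` of monomials that vanishes on the torus.
  obtain ⟨j, hj, g, hg, rfl⟩ := Submodule.mem_sup.1 (polyFun_le_sup hD hY hb hγ hc hinj hf)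
  refine add_mem hj ?_
  obtain ⟨r, rfl⟩ := Finsupp.mem_span_range_iff_exists_finsupp.1 hg
  let u : (HypIndex m → ℕ) → (Module.End K (K ⊗[F] V) → K) ⧸ J := fun p =>
    J.mkQ (∏ i, x i ^ p i)
  have hfac : Function.FactorsThrough u (monomialCharacter hb) := by
    intro p q h
    rw [← sub_eq_zero, ← map_sub, Submodule.mkQ_apply, Submodule.Quotient.mk_eq_zero]
    exact monomial_sub_mem hD hY hb hγ hc hinj h
  -- By independence of characters, the coefficients summed over monomials with a common character
  -- vanish; such monomials have the same class modulo `J`, so the class of `g` is zero.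
  have hlin := linearIndependent_iff.1 (linearIndependent_monoidHom
    (hypTorus (D.baseChange K) Y b) K) (r.mapDomain (monomialCharacter hb)) (by
      rw [Finsupp.linearCombination_mapDomain, Finsupp.linearCombination_apply]
      funext t
      have h3 := hf0 t t.2
      rw [Pi.add_apply, apply_eq_zero_of_mem_rationalIdeal hj t.2, zero_add] at h3
      rw [Finsupp.sum_apply'] at h3 ⊢
      exact h3)
  have h3 : Finsupp.linearCombination K u r = 0 := by
    have h4 : u = Function.extend (monomialCharacter hb) u 0 ∘ monomialCharacter hb :=
      funext fun p => (hfac.extend_apply 0 p).symm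
    rw [h4, ← Finsupp.linearCombination_mapDomain, hlin, map_zero]
  rw [← Submodule.Quotient.mk_eq_zero, ← Submodule.mkQ_apply, Finsupp.sum, map_sum]
  rw [Finsupp.linearCombination_apply, Finsupp.sum] at h3
  simpa only [map_smul] using h3

end Rational

end Datum

end

end OddNorm

namespace OddNorm

noncomputable section

/-! ### Extension of scalars -/

section BaseChange

variable {F K V : Type*} [Field F] [Field K] [Algebra F K] [AddCommGroup V] [Module F V]

theorem baseChange_le {A : Submodule F V} {B : Submodule K (K ⊗[F] V)}
    (h : ∀ a ∈ A, (1 ⊗ₜ[F] a : K ⊗[F] V) ∈ B) : A.baseChange K ≤ B := by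
  rw [Submodule.baseChange_eq_span, Submodule.span_le]
  rintro _ ⟨a, ha, rfl⟩
  exact h a ha

theorem baseChange_sup (A B : Submodule F V) :
    (A ⊔ B).baseChange K = A.baseChange K ⊔ B.baseChange K := by
  refine le_antisymm (baseChange_le fun v hv => ?_) (sup_le (Submodule.baseChange_mono K le_sup_left)
    (Submodule.baseChange_mono K le_sup_right))
  obtain ⟨a, ha, b, hb, rfl⟩ := Submodule.mem_sup.1 hv
  rw [TensorProduct.tmul_add]
  exact Submodule.add_mem_sup (Submodule.tmul_mem_baseChange_of_mem 1 ha)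
    (Submodule.tmul_mem_baseChange_of_mem 1 hb)

theorem finrank_submodule_baseChange (A : Submodule F V) :
    Module.finrank K (A.baseChange K) = Module.finrank F A := by
  rw [← (Submodule.toBaseChange.toLinearEquiv K A).finrank_eq, Module.finrank_baseChange]

theorem disjoint_baseChange [FiniteDimensional F V] {A B : Submodule F V} (h : Disjoint A B) :
    Disjoint (A.baseChange K) (B.baseChange K) := by
  rw [disjoint_iff] at h ⊢
  have h1 := Submodule.finrank_sup_add_finrank_inf_eq (A.baseChange K) (B.baseChange K)
  have h3 := Submodule.finrank_sup_add_finrank_inf_eq A B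
  rw [h, finrank_bot] at h3
  rw [← baseChange_sup, finrank_submodule_baseChange, finrank_submodule_baseChange,
    finrank_submodule_baseChange] at h1
  exact Submodule.finrank_eq_zero.1 (by omega)

theorem one_tmul_injective : Function.Injective fun v : V => (1 ⊗ₜ[F] v : K ⊗[F] V) :=
  Module.FaithfullyFlat.tensorProduct_mk_injective (A := F) (B := K) V

theorem baseChange_apply_eq {V' : Type*} [AddCommGroup V'] [Module F V'] {f g : V →ₗ[F] V'}
    {A : Submodule F V} (h : ∀ a ∈ A, f a = g a) {v : K ⊗[F] V} (hv : v ∈ A.baseChange K) :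
    f.baseChange K v = g.baseChange K v := by
  have h1 : A.baseChange K ≤ LinearMap.eqLocus (f.baseChange K) (g.baseChange K) :=
    baseChange_le fun a ha => by
      change f.baseChange K (1 ⊗ₜ a) = g.baseChange K (1 ⊗ₜ a)
      rw [LinearMap.baseChange_tmul, LinearMap.baseChange_tmul, h a ha]
  exact h1 hv

theorem baseChange_apply_mem {V' : Type*} [AddCommGroup V'] [Module F V'] {f : V →ₗ[F] V'}
    {A : Submodule F V} {B : Submodule F V'} (h : ∀ a ∈ A, f a ∈ B) {v : K ⊗[F] V}
    (hv : v ∈ A.baseChange K) : f.baseChange K v ∈ B.baseChange K := by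
  have h1 : A.baseChange K ≤ (B.baseChange K).comap (f.baseChange K) :=
    baseChange_le fun a ha => by
      change f.baseChange K (1 ⊗ₜ a) ∈ B.baseChange K
      rw [LinearMap.baseChange_tmul]
      exact Submodule.tmul_mem_baseChange_of_mem 1 (h a ha)
  exact h1 hv

variable (Φ : LinearMap.BilinForm F V)

theorem bilinForm_baseChange_one_tmul (x y : V) :
    Φ.baseChange K (1 ⊗ₜ x) (1 ⊗ₜ y) = algebraMap F K (Φ x y) := by
  rw [LinearMap.BilinForm.baseChange_tmul, mul_one, Algebra.smul_def, mul_one]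

variable {Φ}

theorem bilinForm_baseChange_eq_zero {A B : Submodule F V} (h : ∀ a ∈ A, ∀ b ∈ B, Φ a b = 0)
    {x y : K ⊗[F] V} (hx : x ∈ A.baseChange K) (hy : y ∈ B.baseChange K) :
    Φ.baseChange K x y = 0 := by
  have h1 : A.baseChange K ≤ ((Φ.baseChange K).flip y).ker := baseChange_le fun a ha => by
    have h3 : B.baseChange K ≤ (Φ.baseChange K (1 ⊗ₜ a)).ker := baseChange_le fun b hb => by
      rw [LinearMap.mem_ker, bilinForm_baseChange_one_tmul, h a ha b hb, map_zero]
    exact h3 hy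
  exact h1 hx

theorem baseChange_isometry {f : V →ₗ[F] V} (h : ∀ x y, Φ (f x) (f y) = Φ x y)
    (x y : K ⊗[F] V) :
    Φ.baseChange K (f.baseChange K x) (f.baseChange K y) = Φ.baseChange K x y := by
  let L : (K ⊗[F] V) →ₗ[K] (K ⊗[F] V) →ₗ[K] K :=
    (Φ.baseChange K).compl₁₂ (f.baseChange K) (f.baseChange K) - Φ.baseChange K
  have h1 : L x y ∈ (⊥ : Submodule K K) := by
    refine mem_of_tmul (L := L x) (fun y => ?_) y
    change L.flip (1 ⊗ₜ y) x ∈ _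
    refine mem_of_tmul (L := L.flip (1 ⊗ₜ y)) (fun x => ?_) x
    change Φ.baseChange K (f.baseChange K (1 ⊗ₜ x)) (f.baseChange K (1 ⊗ₜ y)) -
      Φ.baseChange K (1 ⊗ₜ x) (1 ⊗ₜ y) = 0
    rw [LinearMap.baseChange_tmul, LinearMap.baseChange_tmul, bilinForm_baseChange_one_tmul,
      bilinForm_baseChange_one_tmul, h, sub_self]
  exact sub_eq_zero.1 h1

theorem isSymm_baseChange (hs : Φ.IsSymm) : (Φ.baseChange K).IsSymm := by
  refine ⟨fun x y => ?_⟩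
  let L : (K ⊗[F] V) →ₗ[K] (K ⊗[F] V) →ₗ[K] K := Φ.baseChange K - (Φ.baseChange K).flip
  have h1 : L x y ∈ (⊥ : Submodule K K) := by
    refine mem_of_tmul (L := L x) (fun y => ?_) y
    change L.flip (1 ⊗ₜ y) x ∈ _
    refine mem_of_tmul (L := L.flip (1 ⊗ₜ y)) (fun x => ?_) x
    change Φ.baseChange K (1 ⊗ₜ x) (1 ⊗ₜ y) - Φ.baseChange K (1 ⊗ₜ y) (1 ⊗ₜ x) = 0
    rw [bilinForm_baseChange_one_tmul, bilinForm_baseChange_one_tmul, hs.eq x y, sub_self]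
  exact sub_eq_zero.1 h1

variable [FiniteDimensional F V]

/-- Gram determinants are preserved by the embedding of fields. -/
theorem baseChange_restrict_nondegenerate (hs : Φ.IsSymm) {A : Submodule F V}
    (hA : (Φ.restrict A).Nondegenerate) :
    ((Φ.baseChange K).restrict (A.baseChange K)).Nondegenerate := by
  let a := Module.finBasis F A
  let v : Fin (Module.finrank F A) → V := fun i => a i
  have hli : LinearIndependent F v := a.linearIndependent.map' A.subtype A.ker_subtype
  have hspan : Submodule.span F (Set.range v) = A := by
    have : v = A.subtype ∘ a := rfl
    rw [this, Set.range_comp, ← Submodule.map_span, a.span_eq, Submodule.map_top,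
      Submodule.range_subtype]
  have h1 := gram_det_ne_zero (Φ := Φ) hli (by rw [hspan]; exact hA)
  have h3 := restrict_nondegenerate_of_gram (Φ := Φ.baseChange K)
    (v := fun i => (1 ⊗ₜ[F] v i : K ⊗[F] V)) (isSymm_baseChange hs) (by
      have e : (Matrix.of fun i j => Φ.baseChange K (1 ⊗ₜ[F] v i) (1 ⊗ₜ[F] v j)) =
          (algebraMap F K).mapMatrix (Matrix.of fun i j => Φ (v i) (v j)) := by
        ext i j
        rw [Matrix.of_apply, bilinForm_baseChange_one_tmul]
        rfl
      rw [e, ← RingHom.map_det]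
      exact (map_ne_zero _).2 h1)
  have h4 : A.baseChange K = Submodule.span K (Set.range fun i => (1 ⊗ₜ[F] v i : K ⊗[F] V)) := by
    conv_lhs => rw [← hspan, Submodule.baseChange_span, ← Set.range_comp]
    rfl
  rw [h4]
  exact h3.2

/-- One inclusion is formal. Equality follows since the smaller space together with `A.baseChange K`
spans everything, and the larger one meets it trivially. -/
theorem baseChange_orthogonal (hs : Φ.IsSymm) {A : Submodule F V}
    (hA : (Φ.restrict A).Nondegenerate) :
    (Φ.baseChange K).orthogonal (A.baseChange K) = (Φ.orthogonal A).baseChange K := by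
  have hc := isCompl_orthogonal (isSymm_baseChange hs)
    (baseChange_restrict_nondegenerate (K := K) hs hA)
  have hle : (Φ.orthogonal A).baseChange K ≤ (Φ.baseChange K).orthogonal (A.baseChange K) :=
    fun z hz a ha => bilinForm_baseChange_eq_zero (B := Φ.orthogonal A) (fun a ha b hb => hb a ha)
      ha hz
  refine le_antisymm (fun v hv => ?_) hle
  have h1 : v ∈ A.baseChange K ⊔ (Φ.orthogonal A).baseChange K := by
    rw [← baseChange_sup, (isCompl_orthogonal hs hA).sup_eq_top, Submodule.baseChange_top]
    trivial
  obtain ⟨a, ha, z, hz, rfl⟩ := Submodule.mem_sup.1 h1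
  have h3 : a ∈ A.baseChange K ⊓ (Φ.baseChange K).orthogonal (A.baseChange K) :=
    ⟨ha, (Submodule.add_mem_iff_left _ (hle hz)).1 hv⟩
  rw [hc.inf_eq_bot, Submodule.mem_bot] at h3
  rw [h3, zero_add]
  exact hz

end BaseChange

namespace Datum

section BaseChange

variable {F K V : Type*} [Field F] [Field K] [Algebra F K] [AddCommGroup V] [Module F V]
  [FiniteDimensional F V] {D : Datum F V} (hD : D.IsOrthogonal) {Y : Submodule F V}
include hD

theorem IsOrthogonal.baseChange : (D.baseChange K).IsOrthogonal where
  symm := isSymm_baseChange hD.symm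
  nondegenerate := by
    have hs : (D.Φ.baseChange K).IsSymm := isSymm_baseChange hD.symm
    have h1 : (D.Φ.restrict ⊤).Nondegenerate :=
      (restrict_nondegenerate_iff hD.symm).2 fun y _ hy =>
        hD.nondegenerate.1 y fun z => hy z trivial
    have h3 := baseChange_restrict_nondegenerate (K := K) hD.symm h1
    rw [Submodule.baseChange_top, restrict_nondegenerate_iff hs] at h3
    exact ⟨fun y hy => h3 y trivial fun z _ => hy z,
      fun y hy => h3 y trivial fun z _ => (hs.eq y z).trans (hy z)⟩
  isotropic _ hv _ hw := bilinForm_baseChange_eq_zero hD.isotropic hv hw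
  isotropic' _ hv _ hw := bilinForm_baseChange_eq_zero hD.isotropic' hv hw
  disjoint := disjoint_baseChange hD.disjoint
  nondegenerate_sup := by
    have h := baseChange_restrict_nondegenerate (K := K) hD.symm hD.nondegenerate_sup
    rwa [baseChange_sup] at h

theorem baseChange_X : (D.baseChange K).X = D.X.baseChange K := by
  rw [X, X, ← baseChange_orthogonal hD.symm hD.nondegenerate_sup, baseChange_sup]
  rfl

theorem IsNondegSub.baseChange (hY : D.IsNondegSub Y) :
    (D.baseChange K).IsNondegSub (Y.baseChange K) := by
  refine ⟨?_, baseChange_restrict_nondegenerate hD.symm hY.2.1, ?_⟩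
  · rw [baseChange_X hD]
    exact Submodule.baseChange_mono K hY.1
  · change _ = Module.finrank K (D.W.baseChange K)
    rw [finrank_submodule_baseChange, finrank_submodule_baseChange, hY.2.2]

theorem baseChange_mem_N {n : Module.End F V} (hn : n ∈ D.N) :
    LinearMap.baseChange K n ∈ (D.baseChange K).N := by
  obtain ⟨h1, h3, h4, h5⟩ := hn
  have e : ∀ v, LinearMap.baseChange K n v - v = LinearMap.baseChange K (n - 1) v := by
    intro v
    rw [LinearMap.baseChange_sub, LinearMap.baseChange_one]
    rfl
  refine ⟨baseChange_isometry h1, fun w hw => ?_, fun x hx => ?_, fun w hw => ?_⟩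
  · have h6 := baseChange_apply_eq (K := K) (f := n) (g := 1) h3 hw
    rwa [LinearMap.baseChange_one] at h6
  · rw [baseChange_X hD] at hx
    rw [e]
    exact baseChange_apply_mem (B := D.W) h4 hx
  · rw [e, baseChange_X hD]
    change _ ∈ D.X.baseChange K ⊔ D.W.baseChange K
    rw [← baseChange_sup]
    exact baseChange_apply_mem (B := D.X ⊔ D.W) h5 hw

omit hD [FiniteDimensional F V] in
/-- A basis of `W'` as a basis of the extension of scalars. -/
def basisBaseChange (K : Type*) [Field K] [Algebra F K] {ι : Type*}
    (w : Module.Basis ι F D.W') : Module.Basis ι K (D.baseChange K).W' :=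
  (w.baseChange K).map (Submodule.toBaseChange.toLinearEquiv K D.W')

omit hD [FiniteDimensional F V] in
theorem basisBaseChange_apply {ι : Type*} (w : Module.Basis ι F D.W') (i : ι) :
    (basisBaseChange K w i : K ⊗[F] V) = 1 ⊗ₜ (w i : V) := by
  change (Submodule.toBaseChange.toLinearEquiv K D.W' (w.baseChange K i) : K ⊗[F] V) = _
  rw [Module.Basis.baseChange_apply]
  rfl

omit hD [FiniteDimensional F V] in
theorem etaMatrix_baseChange {ι : Type*} (w : Module.Basis ι F D.W')
    (n : Module.End F V) :
    etaMatrix (basisBaseChange K w) (LinearMap.baseChange K n) =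
      (etaMatrix w n).map (algebraMap F K) := by
  ext i j
  change (D.baseChange K).Φ _ (LinearMap.baseChange K n _) = algebraMap F K (D.Φ _ _)
  rw [basisBaseChange_apply, basisBaseChange_apply, LinearMap.baseChange_tmul]
  exact bilinForm_baseChange_one_tmul _ _ _

theorem projX_baseChange (v : V) :
    ((D.baseChange K).projX (1 ⊗ₜ v) : K ⊗[F] V) = 1 ⊗ₜ (D.projX v : V) := by
  have hDK : (D.baseChange K).IsOrthogonal := hD.baseChange
  obtain ⟨w, hw, x, hx, u, hu, rfl⟩ := hD.exists_decomposition v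
  have hxK : (1 ⊗ₜ[F] x : K ⊗[F] V) ∈ (D.baseChange K).X := by
    rw [baseChange_X hD]
    exact Submodule.tmul_mem_baseChange_of_mem 1 hx
  have hwK : (1 ⊗ₜ[F] w : K ⊗[F] V) ∈ (D.baseChange K).W :=
    Submodule.tmul_mem_baseChange_of_mem 1 hw
  have huK : (1 ⊗ₜ[F] u : K ⊗[F] V) ∈ (D.baseChange K).W' :=
    Submodule.tmul_mem_baseChange_of_mem 1 hu
  rw [TensorProduct.tmul_add, TensorProduct.tmul_add]
  simp only [map_add, hD.projX_of_mem_X hx, hD.projX_of_mem_W hw,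
    hD.projX_of_mem_W' hu, hDK.projX_of_mem_X hxK, hDK.projX_of_mem_W hwK,
    hDK.projX_of_mem_W' huK, zero_add, add_zero]

theorem span_xiFamily_baseChange {ι : Type*} (w : Module.Basis ι F D.W')
    (n : Module.End F V) :
    Submodule.span K (Set.range (xiFamily (basisBaseChange K w) (LinearMap.baseChange K n))) =
      (Submodule.span F (Set.range (xiFamily w n))).baseChange K := by
  rw [Submodule.baseChange_span, ← Set.range_comp]
  congr 2
  funext i
  change ((D.baseChange K).projX (LinearMap.baseChange K n _) : K ⊗[F] V) = 1 ⊗ₜ _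
  rw [basisBaseChange_apply, LinearMap.baseChange_tmul, projX_baseChange hD]
  rfl

theorem baseChange_mem_N'_iff {n : Module.End F V} (hn : n ∈ D.N) :
    LinearMap.baseChange K n ∈ (D.baseChange K).N' ↔ n ∈ D.N' := by
  let w := Module.finBasis F D.W'
  rw [mem_N'_iff_det w hD hn,
    mem_N'_iff_det (basisBaseChange K w) hD.baseChange (baseChange_mem_N hD hn),
    etaMatrix_baseChange, ← RingHom.mapMatrix_apply, ← RingHom.map_det, Ne, Ne,
    map_eq_zero]

/-- The norm relation holds at rational vectors and is preserved by sums and scalars, hence holds on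
all of the extended `X`; uniqueness identifies the norm. -/
theorem norm_baseChange {n : Module.End F V} (hn : n ∈ D.N') :
    (D.baseChange K).norm (LinearMap.baseChange K n) = LinearMap.baseChange K (D.norm n) := by
  symm
  refine eq_norm hD.baseChange ((baseChange_mem_N'_iff hD hn.1).2 hn) (fun w hw => ?_)
    (fun w hw => ?_) fun x hx => ?_
  · have h := baseChange_apply_eq (K := K) (f := D.norm n) (g := 1)
      (fun w hw => norm_apply_W hD n hw) hw
    rwa [LinearMap.baseChange_one] at h
  · have h := baseChange_apply_eq (K := K) (f := D.norm n) (g := 1)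
      (fun w hw => norm_apply_W' hD n hw) hw
    rwa [LinearMap.baseChange_one] at h
  · rw [baseChange_X hD] at hx ⊢
    refine ⟨baseChange_apply_mem (B := D.X) (fun x hx => norm_mem_X hD n hx) hx, ?_⟩
    rw [Submodule.baseChange_eq_span] at hx
    induction hx using Submodule.span_induction with
    | mem x hx =>
      obtain ⟨x, hx, rfl⟩ := hx
      obtain ⟨w, hw, h⟩ := norm_relation hD hn hx
      refine ⟨1 ⊗ₜ w, Submodule.tmul_mem_baseChange_of_mem 1 hw, ?_⟩
      change LinearMap.baseChange K n (1 ⊗ₜ x - 1 ⊗ₜ w) =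
        LinearMap.baseChange K (D.norm n) (1 ⊗ₜ x) - 1 ⊗ₜ w
      rw [← TensorProduct.tmul_sub, LinearMap.baseChange_tmul, LinearMap.baseChange_tmul, h,
        TensorProduct.tmul_sub]
    | zero => exact ⟨0, zero_mem _, by simp⟩
    | add x y _ _ hx hy =>
      obtain ⟨u, hu, h⟩ := hx
      obtain ⟨v, hv, h'⟩ := hy
      refine ⟨u + v, add_mem hu hv, ?_⟩
      rw [add_sub_add_comm, map_add, h, h', map_add]
      abel
    | smul a x _ hx =>
      obtain ⟨u, hu, h⟩ := hx
      refine ⟨a • u, Submodule.smul_mem _ _ hu, ?_⟩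
      rw [← smul_sub, map_smul, h, map_smul, smul_sub]

theorem eps_baseChange (hY : D.IsNondegSub Y) :
    (D.baseChange K).eps (Y.baseChange K) = LinearMap.baseChange K (D.eps Y) := by
  have hDK : (D.baseChange K).IsOrthogonal := hD.baseChange
  have hYK := hY.baseChange hD (K := K)
  refine linearMap_ext_of_isNondegSub hDK hYK (fun y hy => ?_) fun z hz => ?_
  · rw [eps_apply_of_mem hDK hYK hy]
    have h := baseChange_apply_eq (K := K) (f := D.eps Y) (g := -1)
      (fun y hy => eps_apply_of_mem hD hY hy) hy
    rw [LinearMap.baseChange_neg, LinearMap.baseChange_one] at h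
    exact h.symm
  · rw [eps_apply_of_mem_orthogonal hDK hYK hz]
    have hz' : z ∈ (D.Φ.orthogonal Y).baseChange K := by
      rw [← baseChange_orthogonal hD.symm hY.2.1]
      exact hz
    have h := baseChange_apply_eq (K := K) (f := D.eps Y) (g := 1)
      (fun y hy => eps_apply_of_mem_orthogonal hD hY hy) hz'
    rw [LinearMap.baseChange_one] at h
    exact h.symm

theorem fixing_baseChange_iff {A : Submodule F V} {g : V ≃ₗ[F] V} :
    LinearEquiv.baseChange F K V V g ∈ (D.baseChange K).fixing (A.baseChange K) ↔
      g ∈ D.fixing A := by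
  constructor
  · rintro ⟨h1, h3⟩
    refine ⟨fun x y => ?_, fun v hv => ?_⟩
    · have h := h1 (1 ⊗ₜ x) (1 ⊗ₜ y)
      rw [LinearEquiv.baseChange_tmul, LinearEquiv.baseChange_tmul] at h
      change D.Φ.baseChange K _ _ = D.Φ.baseChange K _ _ at h
      rw [bilinForm_baseChange_one_tmul, bilinForm_baseChange_one_tmul] at h
      exact (algebraMap F K).injective h
    · have h := h3 _ (Submodule.tmul_mem_baseChange_of_mem 1 hv)
      rw [LinearEquiv.baseChange_tmul] at h
      exact one_tmul_injective h
  · rintro ⟨h1, h3⟩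
    refine ⟨fun x y => baseChange_isometry (f := (g : V →ₗ[F] V)) h1 x y, fun v hv => ?_⟩
    have h := baseChange_apply_eq (K := K) (f := (g : V →ₗ[F] V)) (g := 1) h3 hv
    rwa [LinearMap.baseChange_one] at h

theorem baseChange_mem_HY_iff (hY : D.IsNondegSub Y) {g : V ≃ₗ[F] V} :
    LinearEquiv.baseChange F K V V g ∈ (D.baseChange K).HY (Y.baseChange K) ↔ g ∈ D.HY Y := by
  rw [HY, HY, ← fixing_baseChange_iff hD (K := K), ← baseChange_orthogonal hD.symm hY.2.1]
  rfl

theorem baseChange_mem_H_iff {g : V ≃ₗ[F] V} :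
    LinearEquiv.baseChange F K V V g ∈ (D.baseChange K).H ↔ g ∈ D.H := by
  rw [H, H, ← fixing_baseChange_iff hD (K := K), baseChange_sup]
  rfl

/-- The condition that `a - 1` is invertible on `Y` descends. -/
theorem bijOn_of_baseChange {a : Module.End F V} (ha : ∀ y ∈ Y, a y ∈ Y)
    (h : Set.BijOn (LinearMap.baseChange K a) (Y.baseChange K : Set (K ⊗[F] V))
      (Y.baseChange K : Set (K ⊗[F] V))) : Set.BijOn a (Y : Set V) (Y : Set V) := by
  have hinj : Set.InjOn a (Y : Set V) := by
    intro y hy z hz hyz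
    refine one_tmul_injective (K := K) (h.injOn (Submodule.tmul_mem_baseChange_of_mem 1 hy)
      (Submodule.tmul_mem_baseChange_of_mem 1 hz) ?_)
    rw [LinearMap.baseChange_tmul, LinearMap.baseChange_tmul, hyz]
  let f : Y →ₗ[F] Y := a.restrict ha
  have hf : Function.Injective f := fun y z hyz =>
    Subtype.ext (hinj y.2 z.2 (congrArg Subtype.val hyz))
  refine ⟨ha, hinj, fun y hy => ?_⟩
  obtain ⟨z, hz⟩ := LinearMap.injective_iff_surjective.1 hf ⟨y, hy⟩
  exact ⟨z, z.2, congrArg Subtype.val hz⟩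

omit hD [FiniteDimensional F V] in
theorem conj_baseChange (g : V ≃ₗ[F] V) (n : Module.End F V) :
    LinearMap.baseChange K (g.conj n) =
      (LinearEquiv.baseChange F K V V g).conj (LinearMap.baseChange K n) := by
  refine TensorProduct.AlgebraTensorModule.ext fun a x => ?_
  rw [LinearEquiv.conj_apply_apply, LinearMap.baseChange_tmul, LinearEquiv.conj_apply_apply,
    LinearEquiv.baseChange_symm_tmul, LinearMap.baseChange_tmul, LinearEquiv.baseChange_tmul]

omit hD [FiniteDimensional F V] in
theorem coe_baseChange_mul (e : Module.End F V) (γ : V ≃ₗ[F] V) :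
    LinearMap.baseChange K (e * (γ : Module.End F V)) = LinearMap.baseChange K e *
      ((LinearEquiv.baseChange F K V V γ : (K ⊗[F] V) ≃ₗ[K] (K ⊗[F] V)) :
        Module.End K (K ⊗[F] V)) :=
  LinearMap.baseChange_mul _ _

end BaseChange

end Datum

end

end OddNorm

namespace OddNorm

noncomputable section

/-! ### The cells and the decomposition of the rational points -/

section Conj

variable {K V : Type*} [Field K] [AddCommGroup V] [Module K V] (g h : V ≃ₗ[K] V)
  (a : Module.End K V)

theorem conj_conj_eq_mul : g.conj (h.conj a) = (g * h).conj a := LinearMap.ext fun _ => rfl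

theorem conj_inv_conj : g⁻¹.conj (g.conj a) = a := by
  rw [conj_conj_eq_mul, inv_mul_cancel]
  rfl

theorem conj_conj_inv : g.conj (g⁻¹.conj a) = a := by
  rw [conj_conj_eq_mul, mul_inv_cancel]
  rfl

end Conj

namespace Datum

section Field

variable {K V : Type*} [Field K] [AddCommGroup V] [Module K V] [FiniteDimensional K V]
  {D : Datum K V} (hD : D.IsOrthogonal) {Y Y' : Submodule K V}
include hD

theorem map_eq_of_mem_HY {h : V ≃ₗ[K] V} (hh : h ∈ D.HY Y) : Y.map (h : V →ₗ[K] V) = Y := by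
  refine le_antisymm ?_ fun y hy => ⟨h⁻¹ y, HY_mem hD (inv_mem hh) hy, h.apply_symm_apply y⟩
  rintro _ ⟨y, hy, rfl⟩
  exact HY_mem hD hh hy

theorem conj_eps_mul (hY : D.IsNondegSub Y) {h : V ≃ₗ[K] V} (hh : h ∈ D.HY Y)
    (γ : V ≃ₗ[K] V) :
    h.conj (D.eps Y * (γ : Module.End K V)) =
      D.eps Y * ((h * γ * h⁻¹ : V ≃ₗ[K] V) : Module.End K V) := by
  have hcomm : (h : V →ₗ[K] V) ∘ₗ D.eps Y = D.eps Y ∘ₗ (h : V →ₗ[K] V) := by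
    refine linearMap_ext_of_isNondegSub hD hY (fun y hy => ?_) fun z hz => ?_
    · change h (D.eps Y y) = D.eps Y (h y)
      rw [eps_apply_of_mem hD hY hy, eps_apply_of_mem hD hY (HY_mem hD hh hy), map_neg]
    · change h (D.eps Y z) = D.eps Y (h z)
      rw [hh.2 z hz, eps_apply_of_mem_orthogonal hD hY hz, hh.2 z hz]
  exact LinearMap.ext fun v => LinearMap.congr_fun hcomm (γ (h⁻¹ v))

theorem Treg_conj (hY : D.IsNondegSub Y) {T : Subgroup (V ≃ₗ[K] V)} (hT : T ≤ D.HY Y)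
    {h : V ≃ₗ[K] V} (hh : h ∈ D.HY Y) {γ : V ≃ₗ[K] V} (hγ : γ ∈ D.Treg Y T) :
    MulAut.conj h γ ∈ D.Treg Y (T.map (MulAut.conj h).toMonoidHom) := by
  refine ⟨⟨γ, hγ.1, rfl⟩, hγ.2.1.conj hh, ?_⟩
  have h1 := ((isNormOn_eps_mul hD hY (hT hγ.1) hγ.2.2).conj hh.1).bijOn
  rw [map_eq_of_mem_HY hD hh, conj_eps_mul hD hY hh] at h1
  exact h1

theorem Nreg_conj {T : Subgroup (V ≃ₗ[K] V)} {h : V ≃ₗ[K] V} (hh : h ∈ D.H)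
    {n : Module.End K V} (hn : n ∈ D.Nreg Y T) : h.conj n ∈ D.Nreg Y T := by
  obtain ⟨hn, h', hh', γ, hγ, e⟩ := hn
  refine ⟨conj_mem_N' hD (mem_M_of_mem_H hh) hn, h * h', mul_mem hh hh', γ, hγ, ?_⟩
  rw [norm_conj_H hD hh hn, e, conj_conj_eq_mul]

/-- The subspace on which a norm is supported is unique. -/
theorem eq_of_isNormOn_norm (hY : D.IsNondegSub Y) (hY' : D.IsNondegSub Y')
    {n : Module.End K V} (h : IsNormOn D Y (D.norm n)) (h' : IsNormOn D Y' (D.norm n)) : Y = Y' :=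
  (h.xiOf hD hY).2.2.symm.trans (h'.xiOf hD hY').2.2

/-- Elements of `ε_Y H_Y` that are conjugate in `H` are conjugate in `H_Y`. -/
theorem exists_mem_HY_conj (hY : D.IsNondegSub Y) {g : V ≃ₗ[K] V} (hg : g ∈ D.isom)
    (hgY : Y.map (g : V →ₗ[K] V) = Y) {γ γ' : V ≃ₗ[K] V} (hγ : γ ∈ D.HY Y) (hγ' : γ' ∈ D.HY Y)
    (h : g.conj (D.eps Y * (γ : Module.End K V)) = D.eps Y * (γ' : Module.End K V)) :
    ∃ h ∈ D.HY Y, h * γ * h⁻¹ = γ' := by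
  have hgm : ∀ y ∈ Y, g y ∈ Y := fun y hy => hgY.le ⟨y, hy, rfl⟩
  -- Keep the action of `g` on `Y` and replace it by the identity on `Y^⊥`, where both elements are
  -- trivial.
  obtain ⟨u, hu, hug, hu1⟩ := exists_isometry_of_map_le hD.symm hD.nondegenerate hY.2.1
    (g : V →ₗ[K] V) hg hgm
  have huY : u ∈ D.HY Y := ⟨hu, hu1⟩
  refine ⟨u, huY, ?_⟩
  rw [mul_inv_eq_iff_eq_mul]
  refine LinearEquiv.toLinearMap_injective
    (linearMap_ext_of_isNondegSub hD hY (fun y hy => ?_) fun z hz => ?_)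
  · change u (γ y) = γ' (u y)
    rw [hug _ (HY_mem hD hγ hy), hug y hy]
    have h1 := LinearMap.congr_fun h (g y)
    rw [LinearEquiv.conj_apply_apply, g.symm_apply_apply] at h1
    change g (D.eps Y (γ y)) = D.eps Y (γ' (g y)) at h1
    rw [eps_apply_of_mem hD hY (HY_mem hD hγ hy),
      eps_apply_of_mem hD hY (HY_mem hD hγ' (hgm y hy)), map_neg, neg_inj] at h1
    exact h1
  · change u (γ z) = γ' (u z)
    rw [hγ.2 z hz, hu1 z hz, hγ'.2 z hz]

end Field

section Rational

variable {F V : Type*} [Field F] [AddCommGroup V] [Module F V] [FiniteDimensional F V]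
  {D : Datum F V} (hD : D.IsOrthogonal) {Y : Submodule F V} {T : Subgroup (GLbar F V)}
include hD

theorem mem_NYTupper_iff {n : Module.End F V} :
    n ∈ D.NYTupper Y T ↔ n ∈ D.N' ∧ ∃ h ∈ D.H, ∃ γ ∈ D.TregRat Y T, ∃ h' ∈ D.HY Y,
      D.norm n = h.conj (h'.conj (D.eps Y * (γ : Module.End F V))) := by
  constructor
  · rintro ⟨h, hh, n₀, ⟨hn₀, h₁, hh₁, γ, hγ, e⟩, rfl⟩
    refine ⟨conj_mem_N' hD (mem_M_of_mem_H hh) hn₀, h, hh, γ, hγ, h₁⁻¹, inv_mem hh₁, ?_⟩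
    rw [norm_conj_H hD hh hn₀, ← e, conj_inv_conj]
  · rintro ⟨hn, h, hh, γ, hγ, h', hh', e⟩
    have hn₀ : h⁻¹.conj n ∈ D.N' := conj_mem_N' hD (mem_M_of_mem_H (inv_mem hh)) hn
    refine ⟨h, hh, h⁻¹.conj n, ⟨hn₀, h'⁻¹, inv_mem hh', γ, hγ, ?_⟩, (conj_conj_inv _ _).symm⟩
    rw [norm_conj_H hD (inv_mem hh) hn, e, conj_inv_conj, conj_inv_conj]

theorem mem_NYTupper_iff' (hY : D.IsNondegSub Y) {n : Module.End F V} :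
    n ∈ D.NYTupper Y T ↔ n ∈ D.N' ∧ ∃ h ∈ D.H, ∃ γ ∈ D.TregRat Y T,
      D.norm n = h.conj (D.eps Y * (γ : Module.End F V)) := by
  rw [mem_NYTupper_iff hD]
  constructor
  · rintro ⟨hn, h, hh, γ, hγ, h', hh', e⟩
    exact ⟨hn, h * h', mul_mem hh (HY_le_H hD hY hh'), γ, hγ, by rw [e, conj_conj_eq_mul]⟩
  · rintro ⟨hn, h, hh, γ, hγ, e⟩
    exact ⟨hn, h, hh, γ, hγ, 1, one_mem _, e⟩

theorem isNormOn_of_mem_TregRat (hY : D.IsNondegSub Y)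
    (hT : T ≤ D.bar.HY (Y.baseChange (AlgebraicClosure F))) {γ : V ≃ₗ[F] V}
    (hγ : γ ∈ D.TregRat Y T) :
    γ ∈ D.HY Y ∧ IsNormOn D Y (D.eps Y * (γ : Module.End F V)) := by
  have hγY : γ ∈ D.HY Y := (baseChange_mem_HY_iff hD hY).1 (hT hγ.1)
  refine ⟨hγY, isNormOn_eps_mul hD hY hγY ?_⟩
  refine bijOn_of_baseChange (K := AlgebraicClosure F) hD (fun y hy => ?_) ?_
  · change D.eps Y (γ y) - y ∈ Y
    rw [eps_apply_of_mem hD hY (HY_mem hD hγY hy)]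
    exact sub_mem (neg_mem (HY_mem hD hγY hy)) hy
  · have h := hγ.2.2
    rw [LinearMap.baseChange_sub, LinearMap.baseChange_one, coe_baseChange_mul,
      ← eps_baseChange hD hY]
    exact h

/-- The norm of `Int(m) n_Y(a)` is the conjugate of `a` by the `X`-component of `m`, and elements
with norm `a` are `M`-conjugate to `n_Y(a)`. In particular the cell does not depend on the choice of
`ξ`. -/
theorem cell_eq_NYTupper (hY : D.IsNondegSub Y)
    (hT : T ≤ D.bar.HY (Y.baseChange (AlgebraicClosure F))) {ξ : Y →ₗ[F] D.W}
    (hξ : Function.Bijective ξ) : D.cell Y ξ T = D.NYTupper Y T := by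
  ext n
  rw [mem_NYTupper_iff' hD hY]
  constructor
  · rintro ⟨m, hm, γ, hγ, rfl⟩
    obtain ⟨hγY, ha⟩ := isNormOn_of_mem_TregRat hD hY hT hγ
    have hn := nY_mem_N' hD hY hξ ha
    obtain ⟨h, hh, hhm⟩ := exists_mem_H_eq hD hm
    refine ⟨conj_mem_N' hD hm hn, h, hh, γ, hγ, ?_⟩
    rw [norm_conj_eq hD hm hh hhm hn, norm_nY hD hY hξ ha]
  · rintro ⟨hn, h, hh, γ, hγ, e⟩
    obtain ⟨hγY, ha⟩ := isNormOn_of_mem_TregRat hD hY hT hγ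
    have hn₀ : h⁻¹.conj n ∈ D.N' := conj_mem_N' hD (mem_M_of_mem_H (inv_mem hh)) hn
    have e₀ : D.norm (h⁻¹.conj n) = D.eps Y * (γ : Module.End F V) := by
      rw [norm_conj_H hD (inv_mem hh) hn, e, conj_inv_conj]
    obtain ⟨m, hm, hnm⟩ := exists_conj_nY hD hY hξ ha hn₀ e₀
    refine ⟨h * m, mul_mem (mem_M_of_mem_H hh) hm, γ, hγ, ?_⟩
    rw [← conj_conj_eq_mul, ← hnm, conj_conj_inv]

omit hD [FiniteDimensional F V] in
theorem toBar_conj (h γ : V ≃ₗ[F] V) : toBar (h * γ * h⁻¹) = MulAut.conj (toBar h) (toBar γ) := by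
  refine LinearEquiv.toLinearMap_injective (TensorProduct.AlgebraTensorModule.ext fun a x => ?_)
  rfl

/-- The cells of representatives are disjoint. -/
theorem eq_of_mem_NYTupper {𝒴 : Set (Submodule F V)}
    (h𝒴 : IsRepresentatives D.IsNondegSub D.SameOrbit 𝒴)
    {𝒯 : Submodule F V → Set (Subgroup (GLbar F V))}
    (h𝒯 : ∀ Y ∈ 𝒴, IsRepresentatives (D.IsRatMaximalTorus Y) (D.ConjTori Y) (𝒯 Y))
    {Y' : Submodule F V} {T' : Subgroup (GLbar F V)} (hY : Y ∈ 𝒴) (hT : T ∈ 𝒯 Y)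
    (hY' : Y' ∈ 𝒴) (hT' : T' ∈ 𝒯 Y') {n : Module.End F V} (hn : n ∈ D.NYTupper Y T)
    (hn' : n ∈ D.NYTupper Y' T') : Y = Y' ∧ T = T' := by
  have hYn := h𝒴.1 Y hY
  have hYn' := h𝒴.1 Y' hY'
  obtain ⟨hnN, h, hh, γ, hγ, e⟩ := (mem_NYTupper_iff' hD hYn).1 hn
  obtain ⟨-, h', hh', γ', hγ', e'⟩ := (mem_NYTupper_iff' hD hYn').1 hn'
  have hTr := (h𝒯 Y hY).1 T hT
  have hTr' := (h𝒯 Y' hY').1 T' hT'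
  obtain ⟨hγY, ha⟩ := isNormOn_of_mem_TregRat hD hYn hTr.1.1.2 hγ
  obtain ⟨hγY', ha'⟩ := isNormOn_of_mem_TregRat hD hYn' hTr'.1.1.2 hγ'
  -- Both sides are the image of `ξ*`, the support of the norm of `n`.
  have hmap : Y.map (h : V →ₗ[F] V) = Y'.map (h' : V →ₗ[F] V) := by
    refine eq_of_isNormOn_norm hD (hYn.map_H hD hh) (hYn'.map_H hD hh') (n := n) ?_ ?_
    · rw [e]
      exact ha.conj hh.1
    · rw [e']
      exact ha'.conj hh'.1
  have hg : Y.map ((h'⁻¹ * h : V ≃ₗ[F] V) : V →ₗ[F] V) = Y' := by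
    have h1 : ((h'⁻¹ * h : V ≃ₗ[F] V) : V →ₗ[F] V) =
        ((h'⁻¹ : V ≃ₗ[F] V) : V →ₗ[F] V) ∘ₗ (h : V →ₗ[F] V) := rfl
    have h3 : ((h'⁻¹ : V ≃ₗ[F] V) : V →ₗ[F] V) ∘ₗ (h' : V →ₗ[F] V) = LinearMap.id :=
      LinearMap.ext fun v => h'.symm_apply_apply v
    rw [h1, Submodule.map_comp, hmap, ← Submodule.map_comp, h3, Submodule.map_id]
  have hgH : h'⁻¹ * h ∈ D.H := mul_mem (inv_mem hh') hh
  have hYY : Y = Y' := (h𝒴.2 Y' hYn').unique ⟨hY, _, hgH, hg⟩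
    ⟨hY', 1, one_mem _, Submodule.map_id Y'⟩
  subst hYY
  refine ⟨rfl, ?_⟩
  have hconj : (h'⁻¹ * h).conj (D.eps Y * (γ : Module.End F V)) =
      D.eps Y * (γ' : Module.End F V) := by
    rw [← conj_conj_eq_mul, ← e, e', conj_inv_conj]
  obtain ⟨u, hu, huγ⟩ := exists_mem_HY_conj hD hYn hgH.1 hg hγY hγY' hconj
  have hbar : toBar u ∈ D.bar.HY (Y.baseChange (AlgebraicClosure F)) :=
    (baseChange_mem_HY_iff hD hYn).2 hu
  have hreg := hγ.2.1.conj hbar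
  rw [← toBar_conj, huγ] at hreg
  -- Both tori are the identity component of the centralizer of the same regular element `γ'`.
  have hTT : T.map (MulAut.conj (toBar u)).toMonoidHom = T' :=
    SetLike.coe_injective (hreg.symm.trans hγ'.2.1)
  refine ((h𝒯 Y hY).2 T' hTr').unique ⟨hT, u, hu, hTT⟩ ⟨hT', 1, one_mem _, ?_⟩
  have h1 : toBar (1 : V ≃ₗ[F] V) = 1 :=
    LinearEquiv.toLinearMap_injective (TensorProduct.AlgebraTensorModule.ext fun a x => rfl)
  rw [h1, map_one]
  exact Subgroup.map_id T'

variable (h2 : (2 : F) ≠ 0) {m : ℕ} (hrank : Module.finrank F D.W = 2 * m + 1)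
  {Y₀ : Submodule (AlgebraicClosure F) (Vbar F V)} {T₀ : Subgroup (GLbar F V)}
  (hY₀ : D.bar.IsNondegSub Y₀) (hT₀ : IsMaximalTorus (D.bar.HY Y₀) T₀)
include h2 hrank hY₀ hT₀

omit hY₀ hT₀ hD hrank [FiniteDimensional F V] in
theorem two_ne_zero_algebraicClosure : (2 : AlgebraicClosure F) ≠ 0 := by
  rw [← map_ofNat (algebraMap F (AlgebraicClosure F)) 2]
  exact (map_ne_zero _).2 h2

omit hY₀ hT₀ hD h2 [FiniteDimensional F V] in
theorem finrank_bar_W : Module.finrank (AlgebraicClosure F) D.bar.W = 2 * m + 1 :=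
  (finrank_submodule_baseChange (K := AlgebraicClosure F) D.W).trans hrank

/-- The matrix criterion does not mention `(Y₀, T₀)`, so it can be tested with the extension of
scalars of `Y` and with `T` itself. -/
theorem mem_NregRat_of_mem_NYTupper (hY : D.IsNondegSub Y)
    (hT : IsMaximalTorus (D.bar.HY (Y.baseChange (AlgebraicClosure F))) T) {n : Module.End F V}
    (hn : n ∈ D.NYTupper Y T) : n ∈ D.NregRat Y₀ T₀ := by
  have hDb : D.bar.IsOrthogonal := hD.baseChange
  have hYb : D.bar.IsNondegSub (Y.baseChange (AlgebraicClosure F)) := hY.baseChange hD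
  have h2b := two_ne_zero_algebraicClosure h2
  have hrb := finrank_bar_W hrank
  obtain ⟨hnN, h, hh, γ, hγ, e⟩ := (mem_NYTupper_iff' hD hY).1 hn
  refine ⟨hnN.1, ?_⟩
  let w : Module.Basis _ (AlgebraicClosure F) D.bar.W' :=
    basisBaseChange (AlgebraicClosure F) (Module.finBasis F D.W')
  rw [mem_Nreg_iff h2b hDb hrb w hY₀ hT₀, ← mem_Nreg_iff h2b hDb hrb w hYb hT]
  refine ⟨(baseChange_mem_N'_iff hD hnN.1).2 hnN, toBar h, (baseChange_mem_H_iff hD).2 hh,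
    toBar γ, hγ, ?_⟩
  have h1 : D.bar.norm (LinearMap.baseChange (AlgebraicClosure F) n) = _ := norm_baseChange hD hnN
  have h3 : D.bar.eps (Y.baseChange (AlgebraicClosure F)) = _ := eps_baseChange hD hY
  rw [h1, h3, e, conj_baseChange, coe_baseChange_mul]
  rfl

/-- The support of the norm of `n` is rational and is moved to its representative `Y` by `H`. Then
`γ = ε_Y Norm` is a rational element with distinct eigenvalues on `Y`, so its eigenbasis torus over
the closure is a maximal torus defined over `F`, which `H_Y` moves to its representative. -/
theorem exists_mem_NYTupper {𝒴 : Set (Submodule F V)}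
    (h𝒴 : IsRepresentatives D.IsNondegSub D.SameOrbit 𝒴)
    {𝒯 : Submodule F V → Set (Subgroup (GLbar F V))}
    (h𝒯 : ∀ Y ∈ 𝒴, IsRepresentatives (D.IsRatMaximalTorus Y) (D.ConjTori Y) (𝒯 Y))
    {n : Module.End F V} (hn : n ∈ D.NregRat Y₀ T₀) :
    ∃ Y ∈ 𝒴, ∃ T ∈ 𝒯 Y, n ∈ D.NYTupper Y T := by
  have hDb : D.bar.IsOrthogonal := hD.baseChange
  have h2b := two_ne_zero_algebraicClosure h2
  have hrb := finrank_bar_W hrank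
  have : Infinite (AlgebraicClosure F) := IsAlgClosed.instInfinite
  let w := Module.finBasis F D.W'
  let wb : Module.Basis _ (AlgebraicClosure F) D.bar.W' := basisBaseChange (AlgebraicClosure F) w
  have hdet : ∀ n : Module.End F V,
      (etaMatrix wb (LinearMap.baseChange (AlgebraicClosure F) n) +
        (etaMatrix wb (LinearMap.baseChange (AlgebraicClosure F) n)).transpose).det ≠ 0 →
      (etaMatrix w n + (etaMatrix w n).transpose).det ≠ 0 := by
    intro n h h0
    apply h
    have h1 : etaMatrix wb (LinearMap.baseChange (AlgebraicClosure F) n) = _ :=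
      etaMatrix_baseChange w n
    have h3 : (etaMatrix w n).map (algebraMap F (AlgebraicClosure F)) +
        ((etaMatrix w n).map (algebraMap F (AlgebraicClosure F))).transpose =
        (algebraMap F (AlgebraicClosure F)).mapMatrix
          (etaMatrix w n + (etaMatrix w n).transpose) := by
      ext i j
      simp
    rw [h1, h3, ← RingHom.map_det, h0, map_zero]
  have hN' : ∀ {n : Module.End F V}, n ∈ D.NregRat Y₀ T₀ → n ∈ D.N' := fun hn =>
    (baseChange_mem_N'_iff hD hn.1).1 hn.2.1
  have hnN := hN' hn
  obtain ⟨-, -, hnd, -⟩ := (mem_Nreg_iff h2b hDb hrb wb hY₀ hT₀).1 hn.2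
  obtain ⟨-, hYn, hnorm⟩ := isNondegSub_span_xiFamily hD w hnN (hdet n hnd)
  obtain ⟨Y, ⟨hY𝒴, h₀, hh₀, hmap₀⟩, -⟩ := h𝒴.2 _ hYn
  obtain ⟨h₃, hh₃, hmap⟩ : ∃ h ∈ D.H,
      (Submodule.span F (Set.range (xiFamily w n))).map (h : V →ₗ[F] V) = Y := by
    refine ⟨h₀⁻¹, inv_mem hh₀, ?_⟩
    have h1 : ((h₀⁻¹ : V ≃ₗ[F] V) : V →ₗ[F] V) ∘ₗ (h₀ : V →ₗ[F] V) = LinearMap.id :=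
      LinearMap.ext fun v => h₀.symm_apply_apply v
    rw [← hmap₀, ← Submodule.map_comp, h1, Submodule.map_id]
  have hY := h𝒴.1 Y hY𝒴
  have hYb : D.bar.IsNondegSub (Y.baseChange (AlgebraicClosure F)) := hY.baseChange hD
  set n₁ := h₃.conj n with hn₁
  have hn₁N : n₁ ∈ D.N' := conj_mem_N' hD (mem_M_of_mem_H hh₃) hnN
  have hn₁b : LinearMap.baseChange (AlgebraicClosure F) n₁ ∈ D.bar.Nreg Y₀ T₀ := by
    rw [hn₁, conj_baseChange]
    exact Nreg_conj hDb ((baseChange_mem_H_iff hD).2 hh₃) hn.2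
  have hnorm₁ : IsNormOn D Y (D.norm n₁) := by
    rw [hn₁, norm_conj_H hD hh₃ hnN, ← hmap]
    exact hnorm.conj hh₃.1
  have hspan : Submodule.span F (Set.range (xiFamily w n₁)) = Y :=
    (span_xiFamily w hD hn₁N.1).trans (hnorm₁.xiOf hD hY).2.2
  obtain ⟨γ, hγ, hγn, -⟩ := exists_mem_HY_of_isNormOn hD hY hnorm₁
  obtain ⟨-, -, hnd₁, hdist⟩ := (mem_Nreg_iff h2b hDb hrb wb hY₀ hT₀).1 hn₁b
  have hspanb : Y.baseChange (AlgebraicClosure F) = Submodule.span (AlgebraicClosure F)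
      (Set.range (xiFamily wb (LinearMap.baseChange (AlgebraicClosure F) n₁))) := by
    have h1 := span_xiFamily_baseChange (K := AlgebraicClosure F) hD w n₁
    rw [hspan] at h1
    exact h1.symm
  have hγb : toBar γ ∈ D.bar.HY (Y.baseChange (AlgebraicClosure F)) :=
    (baseChange_mem_HY_iff hD hY).2 hγ
  have hγnb : D.bar.eps (Y.baseChange (AlgebraicClosure F)) *
      (toBar γ : Module.End (AlgebraicClosure F) (Vbar F V)) =
      D.bar.norm (LinearMap.baseChange (AlgebraicClosure F) n₁) := by
    have h1 : D.bar.norm (LinearMap.baseChange (AlgebraicClosure F) n₁) = _ :=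
      norm_baseChange hD hn₁N
    have h3 : D.bar.eps (Y.baseChange (AlgebraicClosure F)) = _ := eps_baseChange hD hY
    rw [h1, h3, ← hγn, coe_baseChange_mul]
    rfl
  obtain ⟨b, c, hb, hinj, hc, hγT⟩ := exists_hypBasis_of_norm h2b hDb hrb wb hn₁b.1 hnd₁ hdist
    hspanb hγb hγnb
  obtain ⟨-, -, hnormb⟩ := isNondegSub_span_xiFamily hDb wb hn₁b.1 hnd₁
  rw [← hspanb, ← hγnb] at hnormb
  have hmax := hypTorus_isMaximalTorus h2b hDb hYb hb
  have hrat : D.IsRatMaximalTorus Y (hypTorus D.bar (Y.baseChange (AlgebraicClosure F)) b) :=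
    ⟨hmax, hypTorus_isDefinedOver (D := D) hDb hYb hb hγT hc hinj⟩
  have hreg : toBar γ ∈ D.bar.Treg (Y.baseChange (AlgebraicClosure F))
      (hypTorus D.bar (Y.baseChange (AlgebraicClosure F)) b) :=
    ⟨hγT, isRegularIn_of_injective hDb hYb hb h2b hγT hc hinj, hnormb.bijOn⟩
  obtain ⟨T, ⟨hT, h₂, hh₂, hconj₀⟩, -⟩ := (h𝒯 Y hY𝒴).2 _ hrat
  obtain ⟨h₁, hh₁, hconj⟩ : ∃ h ∈ D.HY Y,
      (hypTorus D.bar (Y.baseChange (AlgebraicClosure F)) b).map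
        (MulAut.conj (toBar h)).toMonoidHom = T := by
    refine ⟨h₂⁻¹, inv_mem hh₂, ?_⟩
    have h1 : (MulAut.conj (toBar h₂⁻¹)).toMonoidHom.comp (MulAut.conj (toBar h₂)).toMonoidHom =
        MonoidHom.id _ := by
      ext g : 1
      have h4 : toBar h₂⁻¹ = (toBar h₂)⁻¹ := LinearEquiv.toLinearMap_injective
        (TensorProduct.AlgebraTensorModule.ext fun a x => rfl)
      rw [h4]
      change (toBar h₂)⁻¹ * (toBar h₂ * g * (toBar h₂)⁻¹) * ((toBar h₂)⁻¹)⁻¹ = g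
      group
    rw [← hconj₀, Subgroup.map_map, h1, Subgroup.map_id]
  have hh₁b : toBar h₁ ∈ D.bar.HY (Y.baseChange (AlgebraicClosure F)) :=
    (baseChange_mem_HY_iff hD hY).2 hh₁
  have hreg₁ := Treg_conj hDb hYb hmax.1.2 hh₁b hreg
  rw [hconj, ← toBar_conj] at hreg₁
  refine ⟨Y, hY𝒴, T, hT, (mem_NYTupper_iff' hD hY).2 ⟨hnN, h₃⁻¹ * h₁⁻¹,
    mul_mem (inv_mem hh₃) (HY_le_H hD hY (inv_mem hh₁)), h₁ * γ * h₁⁻¹, hreg₁, ?_⟩⟩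
  rw [← conj_eps_mul hD hY hh₁, ← conj_conj_eq_mul, conj_inv_conj, hγn, hn₁,
    norm_conj_H hD hh₃ hnN, conj_inv_conj]

end Rational

end Datum

end

end OddNorm

open OddNorm
theorem mainTheorem4 {F V : Type*} [Field F] [AddCommGroup V] [Module F V]
    [FiniteDimensional F V] (hF : (2 : F) ≠ 0)
    (D : Datum F V) (hD : D.IsOrthogonal)
    (hodd : Odd (Module.finrank F D.W))
    (hle : Module.finrank F D.W ≤ Module.finrank F D.X)
    (𝒴 : Set (Submodule F V))
    (h𝒴 : IsRepresentatives D.IsNondegSub D.SameOrbit 𝒴)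
    (𝒯 : Submodule F V → Set (Subgroup (GLbar F V)))
    (h𝒯 : ∀ Y ∈ 𝒴, IsRepresentatives (D.IsRatMaximalTorus Y) (D.ConjTori Y) (𝒯 Y))
    (ξ : ∀ Y : Submodule F V, Y →ₗ[F] D.W)
    (hξ : ∀ Y ∈ 𝒴, Function.Bijective (ξ Y)) :
    (∃ Y₀ T₀, D.bar.IsNondegSub Y₀ ∧ IsMaximalTorus (D.bar.HY Y₀) T₀) ∧
    ∀ Y₀ T₀, D.bar.IsNondegSub Y₀ → IsMaximalTorus (D.bar.HY Y₀) T₀ →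
      ((D.bar.Nreg Y₀ T₀).Nonempty ∧
        ∃ U, IsOpen[zariski (AlgebraicClosure F)
            (Module.End (AlgebraicClosure F) (Vbar F V))] U ∧
          D.bar.Nreg Y₀ T₀ = U ∩ D.bar.N) ∧
      D.NregRat Y₀ T₀ = ⋃ Y ∈ 𝒴, ⋃ T ∈ 𝒯 Y, D.NYTupper Y T ∧
      D.NregRat Y₀ T₀ = ⋃ Y ∈ 𝒴, ⋃ T ∈ 𝒯 Y, D.cell Y (ξ Y) T ∧
      {p : Submodule F V × Subgroup (GLbar F V) | p.1 ∈ 𝒴 ∧ p.2 ∈ 𝒯 p.1}.PairwiseDisjoint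
        (fun p => D.cell p.1 (ξ p.1) p.2) := by
  obtain ⟨m, hrank⟩ := hodd
  have hDb : D.bar.IsOrthogonal := hD.baseChange
  have h2b := Datum.two_ne_zero_algebraicClosure hF
  have hrb := Datum.finrank_bar_W hrank
  have hcell : ∀ Y ∈ 𝒴, ∀ T ∈ 𝒯 Y, D.cell Y (ξ Y) T = D.NYTupper Y T := fun Y hY T hT =>
    Datum.cell_eq_NYTupper hD (h𝒴.1 Y hY) ((h𝒯 Y hY).1 T hT).1.1.2 (hξ Y hY)
  refine ⟨?_, fun Y₀ T₀ hY₀ hT₀ => ?_⟩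
  · have hle' : Module.finrank (AlgebraicClosure F) D.bar.W ≤
        Module.finrank (AlgebraicClosure F) D.bar.X := by
      have h1 : D.bar.X = D.X.baseChange (AlgebraicClosure F) := Datum.baseChange_X hD
      have h3 : D.bar.W = D.W.baseChange (AlgebraicClosure F) := rfl
      rw [h1, h3, finrank_submodule_baseChange, finrank_submodule_baseChange]
      exact hle
    obtain ⟨Y₀, hY₀⟩ := Datum.exists_isNondegSub h2b hDb hle'
    obtain ⟨b, hb⟩ := Datum.exists_hypBasis h2b hDb hY₀.2.1 (hY₀.2.2.trans hrb)
    exact ⟨Y₀, _, hY₀, Datum.hypTorus_isMaximalTorus h2b hDb hY₀ hb⟩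
  have hpart2 : D.NregRat Y₀ T₀ = ⋃ Y ∈ 𝒴, ⋃ T ∈ 𝒯 Y, D.NYTupper Y T := by
    ext n
    simp only [Set.mem_iUnion, exists_prop]
    constructor
    · exact Datum.exists_mem_NYTupper hD hF hrank hY₀ hT₀ h𝒴 h𝒯
    · rintro ⟨Y, hY, T, hT, hn⟩
      exact Datum.mem_NregRat_of_mem_NYTupper hD hF hrank hY₀ hT₀ (h𝒴.1 Y hY)
        ((h𝒯 Y hY).1 T hT).1 hn
  refine ⟨⟨Datum.Nreg_nonempty h2b hDb hrb hY₀ hT₀, Datum.exists_isOpen_Nreg h2b hDb hrb hY₀ hT₀⟩,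
    hpart2, ?_, ?_⟩
  · rw [hpart2]
    exact Set.iUnion₂_congr fun Y hY => Set.iUnion₂_congr fun T hT => (hcell Y hY T hT).symm
  · rintro ⟨Y, T⟩ ⟨hY, hT⟩ ⟨Y', T'⟩ ⟨hY', hT'⟩ hne
    refine Set.disjoint_left.2 fun n hn hn' => hne ?_
    change n ∈ D.cell Y (ξ Y) T at hn
    change n ∈ D.cell Y' (ξ Y') T' at hn'
    rw [hcell Y hY T hT] at hn
    rw [hcell Y' hY' T' hT'] at hn'
    obtain ⟨rfl, rfl⟩ := Datum.eq_of_mem_NYTupper hD h𝒴 h𝒯 hY hT hY' hT' hn hn'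
    rfl
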